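/- \textbf{Setting.} Let $(W,S)$ be a Coxeter system and $\Bbbk$ a field. Let $V$ be a finite-dimensional realization of $(W,S)$ over $\Bbbk$ (roots $\alpha_s\in V$, coroots $\alpha_s^\vee\in V^*$ with $\langle\alpha_s^\vee,\alpha_s\rangle=2$; $s(v)=v-\langle\alpha_s^\vee,v\rangle\alpha_s$ defines a representation of $W$; the two-coloured quantum numbers $[m_{st}]$ vanish for $s\neq t$, $m_{st}<\infty$). Assume that $V$ is faithful, balanced ($[m_{st}-1]=1$ for $s\ne t$, $m_{st}<\infty$), reflection faithful (the fixed space of $w$ on $V$ has codimension one if and only if $w$ is a reflection), and satisfies generalized Demazure surjectivity ($\partial_{w_I}:R\to R^I$ is surjective for every finitary $I$). Here $R=\operatorname{Sym}(V)$ with $\deg V=2$; $I\subset S$ is finitary if the parabolic subgroup $W_I$ is finite, $w_I$ is its longest element, $\ell(I)=\ell(w_I)$, $R^I=R^{W_I}$, and $\partial_w$ is the Demazure operator. For $I\subset Is$ finitary, with $s\notin I$, $R^{Is}\subset R^I$ is a Frobenius extension with trace $\partial^I_{Is}=\partial_{w_{Is}w_I^{-1}}$ and coproduct element $\Delta^I_{Is}\in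 R^I\otimes_{R^{Is}}R^I$. A (singlestep) expression $I_\bullet=[I_0,\dots,I_d]$ is a sequence of finitary subsets in which consecutive ones differ by one element; we also write it as $[I_0\pm s_1\pm s_2\cdots\pm s_d]$. If $[[I_0\subset K_1\supset I_1\subset\cdots\subset K_m\supset I_m]]$ is the associated multistep expression, the Bott--Samelson bimodule is the graded $(R^{I_0},R^{I_m})$-bimodule $$\operatorname{BS}(I_\bullet)=R^{I_0}\otimes_{R^{K_1}}R^{I_1}\otimes_{R^{K_2}}\cdots\otimes_{R^{K_m}}R^{I_m}(\sigma),\qquad \sigma=\sum_{i=1}^m(\ell(K_i)-\ell(I_i)),$$ and $1^\otimes=1\otimes\cdots\otimes1$ is its 1-tensor. The expression is reduced if $x=w_{K_1}w_{I_1}^{-1}w_{K_2}\cdots w_{I_{m-1}}^{-1}w_{K_m}$ has length $\ell(K_1)-\ell(I_1)+\ell(K_2)-\cdots+\ell(K_m)$; it is then a reduced expression for the double coset $W_{I_0}xW_{I_m}$, whose longest element is $x$. Write $I_\bullet\leftrightharpoons I'_\bullet$ if both are reduced expressions for the same double coset. \textbf{Diagrams.} Morphisms between expressions are represented by string diagrams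 generated, under vertical and horizontal composition, by homogeneous polynomials $f \in R^I$ (of degree $\deg f$), clockwise cups and caps $[I,Is,I]\leftrightarrows[I]$ (degree $\ell(Is)-\ell(I)$), counterclockwise cups and caps $[Is,I,Is]\leftrightarrows[Is]$ (degree $\ell(I)-\ell(Is)$), and up-facing crossings $[I,It,Ist]\to[I,Is,Ist]$ (degree $0$); degrees add. Sideways and down-facing crossings are rotations of the up-facing ones by cups and caps. The evaluation functor $\mathcal F$ sends expressions to Bott--Samelson bimodules and diagrams to bimodule maps: polynomials act by multiplication; clockwise caps go to multiplication $R^I\otimes_{R^{Is}}R^I\to R^I$; clockwise cups to $f\mapsto f\Delta^I_{Is}$; counterclockwise caps to $\partial^I_{Is}$; counterclockwise cups to the inclusion $R^{Is}\subset R^I$; up-facing crossings to the natural isomorphism with $1\otimes1\mapsto1\otimes1$. \textbf{Rex moves.} Elementary rex moves are the following diagrams, applied anywhere inside an expression: (up-up) the crossing $[I+s+t]\to[I+t+s]$; (down-down) the crossing $[Ist-s-t]\to[Ist-t-s]$; (switchback) for $L=Iu_0$ finitary and a sequence $u_0,\dots,u_d\in L$ $(d\ge1)$, $u_i\neq u_{i+1}$,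 such that $$[I+u_0-u_d]\leftrightharpoons[I-u_1+u_0-u_2+u_1\cdots-u_d+u_{d-1}],$$ the diagram from left to right in which the strands $+u_0$ and $-u_d$ are vertical and, for $0<i<d$, the strands $-u_i$ and $+u_i$ are joined by a counterclockwise cup (all crossings being right-facing), and its upside-down flip with orientations reversed, from right to left (left-facing crossings and counterclockwise caps). A rex move $I_\bullet\to I'_\bullet$ is a composite of finitely many elementary rex moves. \textbf{Theorem.} Let $D:I_\bullet\to I'_\bullet$ be a rex move and let $\phi=\mathcal F(D):\operatorname{BS}(I_\bullet)\to\operatorname{BS}(I'_\bullet)$. Then $\phi(1^\otimes)=1^\otimes$. Moreover, rex moves have degree zero: the diagram $D$ has degree $0$, and $\phi$ maps the degree $n$ part of $\operatorname{BS}(I_\bullet)$ into the degree $n$ part of $\operatorname{BS}(I'_\bullet)$ for every $n\in\mathbb Z$. -/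

import Mathlib

open scoped TensorProduct

noncomputable section

namespace SingularSoergel

/-! ## Maps attached to a (Frobenius) extension of commutative rings -/

section FrobeniusMaps
variable {A B N : Type*} [CommRing A] [CommRing B] [Algebra A B] [AddCommGroup N] [Module A N]

/-- `x ↦ 1 ⊗ x`. -/
def unitLin (A B N : Type*) [CommRing A] [CommRing B] [Algebra A B] [AddCommGroup N]
    [Module A N] : N →ₗ[A] B ⊗[A] N := TensorProduct.mk A B N 1

/-- `b ⊗ x ↦ b x`. -/
def multLin (A B N : Type*) [CommRing A] [CommRing B] [Algebra A B] [AddCommGroup N]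
    [Module A N] [Module B N] [IsScalarTower A B N] : B ⊗[A] N →ₗ[B] N :=
  LinearMap.liftBaseChange B (LinearMap.id : N →ₗ[A] N)

/-- `b ⊗ x ↦ T(b) x`. -/
def traceLin (N : Type*) [AddCommGroup N] [Module A N] (T : B →ₗ[A] A) : B ⊗[A] N →ₗ[A] N :=
  TensorProduct.lift (LinearMap.lsmul A N ∘ₗ T)

/-- `Δ` is a coproduct element for the `A`-linear map `T : B → A`: there are dual bases `c`, `d` of
`B` over `A`, i.e. `T (c i * d j) = δ i j`, with `Δ = ∑ i, c i ⊗ d i`. -/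
def IsCoproduct (T : B →ₗ[A] A) (Δ : B ⊗[A] B) : Prop :=
  ∃ (n : ℕ) (c d : Module.Basis (Fin n) A B),
    (∀ i j, T (c i * d j) = if i = j then 1 else 0) ∧ Δ = ∑ i, c i ⊗ₜ[A] d i

open Classical in
/-- The coproduct element of a Frobenius extension `A → B` with trace `T`. (It does not depend on
the dual bases; if there are no dual bases, i.e. `T` is not a Frobenius trace, it is set to be
`0`.) -/
def coproduct (T : B →ₗ[A] A) : B ⊗[A] B :=
  if h : ∃ Δ, IsCoproduct T Δ then h.choose else 0

/-- `f Δ = Δ f`. -/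
theorem coproduct_central (T : B →ₗ[A] A) (f : B) :
    (f ⊗ₜ[A] (1 : B)) * coproduct T = ((1 : B) ⊗ₜ[A] f) * coproduct T := by
  classical
  unfold coproduct
  split_ifs with h
  swap
  · simp
  obtain ⟨n, c, d, hcd, hΔ⟩ := h.choose_spec
  rw [hΔ, Finset.mul_sum, Finset.mul_sum]
  have h1 : ∀ x : B, x = ∑ j, T (x * d j) • c j := by
    intro x
    have hx := c.sum_repr x
    have hT : ∀ j, T (x * d j) = c.repr x j := fun j => by
      conv_lhs => rw [← hx, Finset.sum_mul]
      simp only [smul_mul_assoc, map_sum, map_smul, hcd, smul_eq_mul]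
      simp
    simp only [hT, hx]
  have h2 : ∀ x : B, x = ∑ j, T (x * c j) • d j := by
    intro x
    have hx := d.sum_repr x
    have hdc : ∀ i j, T (d i * c j) = if j = i then 1 else 0 := fun i j => by rw [mul_comm, hcd]
    have hT : ∀ j, T (x * c j) = d.repr x j := fun j => by
      conv_lhs => rw [← hx, Finset.sum_mul]
      simp only [smul_mul_assoc, map_sum, map_smul, hdc, smul_eq_mul]
      simp
    simp only [hT, hx]
  simp only [Algebra.TensorProduct.tmul_mul_tmul, one_mul]
  calc ∑ i, (f * c i) ⊗ₜ[A] d i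
      = ∑ i, ∑ j, (T (f * c i * d j) • c j) ⊗ₜ[A] d i := by
        refine Finset.sum_congr rfl fun i _ => ?_
        rw [← TensorProduct.sum_tmul, ← h1]
    _ = ∑ j, ∑ i, (T (f * c i * d j) • c j) ⊗ₜ[A] d i := Finset.sum_comm
    _ = ∑ j, c j ⊗ₜ[A] (f * d j) := by
        refine Finset.sum_congr rfl fun j _ => ?_
        conv_rhs => rw [h2 (f * d j)]
        rw [TensorProduct.tmul_sum]
        refine Finset.sum_congr rfl fun i _ => ?_
        rw [TensorProduct.smul_tmul, mul_right_comm]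

/-- `x ↦ Δ x = ∑ c i ⊗ d i x`, where `Δ = ∑ c i ⊗ d i` is the coproduct element. -/
def coproductLin (N : Type*) [AddCommGroup N] [Module A N] [Module B N] [IsScalarTower A B N]
    (T : B →ₗ[A] A) : N →ₗ[B] B ⊗[A] N where
  toFun x := ((LinearMap.toSpanSingleton B N x).restrictScalars A).lTensor B (coproduct T)
  map_add' x y := by
    rw [← LinearMap.add_apply, ← LinearMap.lTensor_add]
    congr 2
    ext b
    simp
  map_smul' f x := by
    have key : ∀ z : B ⊗[A] B,
        ((LinearMap.toSpanSingleton B N (f • x)).restrictScalars A).lTensor B z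
          = ((LinearMap.toSpanSingleton B N x).restrictScalars A).lTensor B
              (((1 : B) ⊗ₜ[A] f) * z) ∧
        f • ((LinearMap.toSpanSingleton B N x).restrictScalars A).lTensor B z
          = ((LinearMap.toSpanSingleton B N x).restrictScalars A).lTensor B
              ((f ⊗ₜ[A] (1 : B)) * z) := by
      intro z
      induction z using TensorProduct.induction_on with
      | zero => simp
      | tmul b c =>
        simp [TensorProduct.smul_tmul', mul_smul, smul_comm c f x]
      | add u v hu hv =>
        exact ⟨by rw [map_add, mul_add, map_add, hu.1, hv.1],
          by rw [map_add, mul_add, map_add, smul_add, hu.2, hv.2]⟩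
    simp only [RingHom.id_apply]
    rw [(key _).1, (key _).2, coproduct_central]

/-- The natural isomorphism `B ⊗[A] (A ⊗[D] N) → B ⊗[D] N → B ⊗[A'] (A' ⊗[D] N)`,
`1 ⊗ (1 ⊗ x) ↦ 1 ⊗ x ↦ 1 ⊗ (1 ⊗ x)`. -/
def crossLin (D A A' B N : Type*) [CommRing D] [CommRing A] [CommRing A'] [CommRing B]
    [Algebra D A] [Algebra D A'] [Algebra D B] [Algebra A B] [Algebra A' B]
    [IsScalarTower D A B] [IsScalarTower D A' B] [AddCommGroup N] [Module D N] :
    B ⊗[A] (A ⊗[D] N) →ₗ[B] B ⊗[A'] (A' ⊗[D] N) :=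
  (TensorProduct.AlgebraTensorModule.cancelBaseChange D A' B B N).symm.toLinearMap ∘ₗ
    (TensorProduct.AlgebraTensorModule.cancelBaseChange D A B B N).toLinearMap

theorem unitLin_smul (a : A) (x : N) : unitLin A B N (a • x) = algebraMap A B a • unitLin A B N x := by
  rw [map_smul, algebraMap_smul]

theorem traceLin_smul (T : B →ₗ[A] A) (a : A) (x : B ⊗[A] N) :
    traceLin N T (algebraMap A B a • x) = a • traceLin N T x := by
  rw [algebraMap_smul, map_smul]

theorem traceLin_natural (T : B →ₗ[A] A) (φ : N →ₗ[A] N) (x : B ⊗[A] N) :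
    traceLin N T (φ.baseChange B x) = φ (traceLin N T x) := by
  induction x using TensorProduct.induction_on with
  | zero => simp
  | tmul b m => simp [traceLin]
  | add x y hx hy => simp only [map_add, hx, hy]

theorem multLin_natural [Module B N] [IsScalarTower A B N] (φ : N →ₗ[B] N) (x : B ⊗[A] N) :
    multLin A B N ((φ.restrictScalars A).baseChange B x) = φ (multLin A B N x) := by
  induction x using TensorProduct.induction_on with
  | zero => simp
  | tmul b m => simp [multLin]
  | add x y hx hy => simp only [map_add, hx, hy]

theorem coproductLin_natural [Module B N] [IsScalarTower A B N] (T : B →ₗ[A] A)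
    (φ : N →ₗ[B] N) (x : N) :
    coproductLin N T (φ x) = (φ.restrictScalars A).baseChange B (coproductLin N T x) := by
  simp only [coproductLin, LinearMap.coe_mk, AddHom.coe_mk]
  generalize coproduct T = z
  induction z using TensorProduct.induction_on with
  | zero => simp
  | tmul b m => simp
  | add x y hx hy => simp only [map_add, hx, hy]

theorem crossLin_natural (D A A' B N : Type*) [CommRing D] [CommRing A] [CommRing A'] [CommRing B]
    [Algebra D A] [Algebra D A'] [Algebra D B] [Algebra A B] [Algebra A' B]
    [IsScalarTower D A B] [IsScalarTower D A' B] [AddCommGroup N] [Module D N]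
    (φ : N →ₗ[D] N) (x : B ⊗[A] (A ⊗[D] N)) :
    crossLin D A A' B N ((φ.baseChange A).baseChange B x)
      = (φ.baseChange A').baseChange B (crossLin D A A' B N x) := by
  induction x using TensorProduct.induction_on with
  | zero => simp
  | tmul b y =>
    induction y using TensorProduct.induction_on with
    | zero => simp
    | tmul a m => simp [crossLin]
    | add x y hx hy => simp only [TensorProduct.tmul_add, map_add, hx, hy]
  | add x y hx hy => simp only [map_add, hx, hy]

end FrobeniusMaps

/-! ## Bimodules over commutative rings -/

universe w

/-- An `(A, C)`-bimodule over commutative rings: a left `A`-module together with an action of `C`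
by `A`-linear endomorphisms (`C` is commutative, so this is the same as a right action). -/
structure Bimod (A C : Type w) [CommRing A] [CommRing C] where
  carrier : Type w
  [acg : AddCommGroup carrier]
  [mod : Module A carrier]
  ract : C →+* Module.End A carrier

namespace Bimod

attribute [instance] Bimod.acg Bimod.mod

/-- Homomorphisms of `(A, C)`-bimodules. -/
structure Hom {A C : Type w} [CommRing A] [CommRing C] (M N : Bimod A C) where
  toLin : M.carrier →ₗ[A] N.carrier
  comm_ract : ∀ (c : C) (x : M.carrier), toLin (M.ract c x) = N.ract c (toLin x)

section
variable {A A' B C D : Type w} [CommRing A] [CommRing A'] [CommRing B] [CommRing C] [CommRing D]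

/-- `A`-linear maps `B → A`, where `A` acts on `B` along `f : A → B`. -/
abbrev LinForm (f : A →+* B) : Type w :=
  letI := f.toAlgebra
  B →ₗ[A] A

/-- The regular bimodule. -/
def self (A : Type w) [CommRing A] : Bimod A A where
  carrier := A
  ract := (Algebra.lmul A A).toRingHom

/-- Induction along `f : A → B`: the `(B, C)`-bimodule `B ⊗[A] N`. -/
def ind (f : A →+* B) (N : Bimod A C) : Bimod B C :=
  letI := f.toAlgebra
  { carrier := B ⊗[A] N.carrier
    ract := (Module.End.baseChangeHom A B N.carrier).toRingHom.comp N.ract }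

/-- Restriction along `f : A → B`: the bimodule `N` with left action restricted to `A`. -/
def res (f : A →+* B) (N : Bimod B C) : Bimod A C :=
  letI : Module A N.carrier := Module.compHom N.carrier f
  letI := f.toAlgebra
  haveI : IsScalarTower A B N.carrier := ⟨fun a b x => mul_smul (f a) b x⟩
  { carrier := N.carrier
    ract :=
      { toFun := fun c => (N.ract c).restrictScalars A
        map_one' := by ext x; simp
        map_mul' := fun c d => by ext x; simp
        map_zero' := by ext x; simp
        map_add' := fun c d => by ext x; simp } }

/-- The pure tensor `b ⊗ x` in `B ⊗[A] N`. -/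
def tmul (f : A →+* B) (N : Bimod A C) (b : B) (x : N.carrier) : (ind f N).carrier :=
  letI := f.toAlgebra
  (b ⊗ₜ[A] x : B ⊗[A] N.carrier)

/-- An element of `N`, seen in the restriction of `N`. -/
def toRes (f : A →+* B) (N : Bimod B C) (x : N.carrier) : (res f N).carrier := x

namespace Hom

/-- The identity. -/
def id (M : Bimod A C) : Hom M M := ⟨LinearMap.id, fun _ _ => rfl⟩

/-- Composition: first `φ`, then `ψ`. -/
def comp {M N P : Bimod A C} (φ : Hom M N) (ψ : Hom N P) : Hom M P :=
  ⟨ψ.toLin ∘ₗ φ.toLin, fun c x => by simp [φ.comm_ract, ψ.comm_ract]⟩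

/-- `id ⊗ φ : B ⊗[A] M → B ⊗[A] N`. -/
def ind (f : A →+* B) {M N : Bimod A C} (φ : Hom M N) : Hom (Bimod.ind f M) (Bimod.ind f N) :=
  letI := f.toAlgebra
  { toLin := φ.toLin.baseChange B
    comm_ract := fun c x => by
      change B ⊗[A] M.carrier at x
      change φ.toLin.baseChange B ((M.ract c).baseChange B x)
        = (N.ract c).baseChange B (φ.toLin.baseChange B x)
      induction x using TensorProduct.induction_on with
      | zero => simp
      | tmul b m => simp [φ.comm_ract]
      | add x y hx hy => simp only [map_add, hx, hy] }

/-- `φ`, seen as a map of restricted bimodules. -/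
def res (f : A →+* B) {M N : Bimod B C} (φ : Hom M N) : Hom (Bimod.res f M) (Bimod.res f N) where
  toLin :=
    { toFun := φ.toLin
      map_add' := map_add φ.toLin
      map_smul' := fun a x => φ.toLin.map_smul (f a) (x : M.carrier) }
  comm_ract := φ.comm_ract

/-- Left multiplication by an element of the (commutative) ring acting on the left. -/
def lmul (M : Bimod A C) (a : A) : Hom M M :=
  ⟨a • LinearMap.id, fun c x => by simp⟩


/-- The unit `N → B ⊗[A] N`, `x ↦ 1 ⊗ x`. -/
def unit (f : A →+* B) (N : Bimod A C) : Hom N (Bimod.res f (Bimod.ind f N)) :=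
  letI := f.toAlgebra
  { toLin :=
      { toFun := unitLin A B N.carrier
        map_add' := map_add _
        map_smul' := unitLin_smul }
    comm_ract := fun _ _ => rfl }

/-- For an `A`-linear map `T : B → A`, the map `B ⊗[A] N → N`, `b ⊗ x ↦ T(b) x`. -/
def trace (f : A →+* B) (T : LinForm f) (N : Bimod A C) :
    Hom (Bimod.res f (Bimod.ind f N)) N :=
  letI := f.toAlgebra
  { toLin :=
      { toFun := traceLin N.carrier T
        map_add' := map_add _
        map_smul' := traceLin_smul T }
    comm_ract := fun c => traceLin_natural T (N.ract c) }

/-- The multiplication map `B ⊗[A] N → N`, `b ⊗ x ↦ b x`, for a left `B`-module `N`. -/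
def mult (f : A →+* B) (N : Bimod B C) : Hom (Bimod.ind f (Bimod.res f N)) N :=
  letI := f.toAlgebra
  letI : Module A N.carrier := Module.compHom N.carrier f
  haveI : IsScalarTower A B N.carrier := ⟨fun a b x => mul_smul (f a) b x⟩
  { toLin := multLin A B N.carrier
    comm_ract := fun c =>
      have key := multLin_natural (A := A) (B := B) (N := N.carrier) (N.ract c)
      key }

/-- The coproduct map `N → B ⊗[A] N`, `x ↦ Δ x`, for a left `B`-module `N`. -/
def coprod (f : A →+* B) (T : LinForm f) (N : Bimod B C) :
    Hom N (Bimod.ind f (Bimod.res f N)) :=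
  letI := f.toAlgebra
  letI : Module A N.carrier := Module.compHom N.carrier f
  haveI : IsScalarTower A B N.carrier := ⟨fun a b x => mul_smul (f a) b x⟩
  { toLin := (coproductLin N.carrier T : N.carrier →ₗ[B] B ⊗[A] N.carrier)
    comm_ract := fun c x =>
      have key := coproductLin_natural (A := A) (B := B) (N := N.carrier) T (N.ract c) x
      key }

/-- For two factorizations `f ∘ g = f' ∘ g'` of one ring map `D → B`, through `A` and through `A'`,
the natural isomorphism `B ⊗[A] (A ⊗[D] N) → B ⊗[D] N → B ⊗[A'] (A' ⊗[D] N)`. -/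
def cross (g : D →+* A) (f : A →+* B) (g' : D →+* A') (f' : A' →+* B)
    (h : f.comp g = f'.comp g') (N : Bimod D C) :
    Hom (Bimod.ind f (Bimod.ind g N)) (Bimod.ind f' (Bimod.ind g' N)) :=
  letI := f.toAlgebra
  letI := g.toAlgebra
  letI := f'.toAlgebra
  letI := g'.toAlgebra
  letI := (f.comp g).toAlgebra
  haveI : IsScalarTower D A B := IsScalarTower.of_algebraMap_eq fun _ => rfl
  haveI : IsScalarTower D A' B := IsScalarTower.of_algebraMap_eq fun d => DFunLike.congr_fun h d
  { toLin := crossLin D A A' B N.carrier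
    comm_ract := fun c => crossLin_natural D A A' B N.carrier (N.ract c) }

end Hom
end
end Bimod

/-! ## Coxeter groups: finitary subsets and longest elements -/

section Coxeter

variable {S W : Type*} [Group W] {M : CoxeterMatrix S}

/-- The standard parabolic subgroup `W_I`. -/
def parabolic (cs : CoxeterSystem M W) (I : Set S) : Subgroup W :=
  Subgroup.closure (cs.simple '' I)

/-- Finitary subsets `I ⊆ S`: those for which `W_I` is finite. -/
structure Finitary (cs : CoxeterSystem M W) where
  carrier : Set S
  finite : (parabolic cs carrier : Set W).Finite

variable {cs : CoxeterSystem M W}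

theorem parabolic_mono {I J : Set S} (h : I ⊆ J) : parabolic cs I ≤ parabolic cs J :=
  Subgroup.closure_mono (Set.image_mono h)

namespace Finitary

/-- A subset of a finitary subset is finitary. -/
def restrict (L : Finitary cs) (I : Set S) (h : I ⊆ L.carrier) : Finitary cs :=
  ⟨I, L.finite.subset (parabolic_mono h)⟩

theorem exists_longest (I : Finitary cs) : ∃ w ∈ parabolic cs I.carrier,
    ∀ v ∈ parabolic cs I.carrier, cs.length v ≤ cs.length w :=
  Set.exists_max_image _ cs.length I.finite ⟨1, one_mem (parabolic cs I.carrier)⟩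

/-- The longest element `w_I` of `W_I`. -/
def longest (I : Finitary cs) : W := I.exists_longest.choose

/-- `ℓ(I)`, the length of the longest element of `W_I`. -/
def len (I : Finitary cs) : ℤ := cs.length I.longest

/-- `J = I ⊔ {s}` for some `s ∉ I`. -/
def Cov (I J : Finitary cs) : Prop := ∃ s, s ∉ I.carrier ∧ J.carrier = insert s I.carrier

theorem Cov.subset {I J : Finitary cs} (h : Cov I J) : I.carrier ⊆ J.carrier := by
  obtain ⟨s, -, h⟩ := h
  rw [h]
  exact Set.subset_insert _ _

/-- `L \ {u}`. -/
def hat (L : Finitary cs) (u : S) : Finitary cs := L.restrict (L.carrier \ {u}) Set.sdiff_subset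

/-- `L \ {u, v}`. -/
def hat₂ (L : Finitary cs) (u v : S) : Finitary cs :=
  L.restrict (L.carrier \ {u, v}) Set.sdiff_subset

theorem hat_cov {L : Finitary cs} {u : S} (hu : u ∈ L.carrier) : Cov (L.hat u) L :=
  ⟨u, fun h => h.2 rfl, (Set.insert_sdiff_self_of_mem hu).symm⟩

theorem hat₂_cov_left {L : Finitary cs} {u v : S} (hv : v ∈ L.carrier) (h : u ≠ v) :
    Cov (L.hat₂ u v) (L.hat u) := by
  refine ⟨v, fun h => h.2 (Or.inr rfl), ?_⟩
  ext x
  simp only [hat, hat₂, restrict, Set.mem_sdiff, Set.mem_singleton_iff, Set.mem_insert_iff]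
  grind

theorem hat₂_cov_right {L : Finitary cs} {u v : S} (hu : u ∈ L.carrier) (h : u ≠ v) :
    Cov (L.hat₂ u v) (L.hat v) := by
  refine ⟨u, fun h => h.2 (Or.inl rfl), ?_⟩
  ext x
  simp only [hat, hat₂, restrict, Set.mem_sdiff, Set.mem_singleton_iff, Set.mem_insert_iff]
  grind

end Finitary

open Finitary

/-! ## Singlestep expressions -/

/-- Singlestep expressions `[I_0, I_1, ..., I_d]` from `I = I_0` to `K = I_d`: sequences of finitary
subsets in which consecutive entries differ by one simple reflection. `up h e` prepends a step
`I ⊂ J = Is` to the expression `e` starting at `J`, `down h e` prepends a step `Is = I ⊃ J`. -/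
inductive Expression (cs : CoxeterSystem M W) : Finitary cs → Finitary cs → Type _
  | nil (I : Finitary cs) : Expression cs I I
  | up {I J K : Finitary cs} (h : Cov I J) (e : Expression cs J K) : Expression cs I K
  | down {I J K : Finitary cs} (h : Cov J I) (e : Expression cs J K) : Expression cs I K

namespace Expression

/-- The product of `w_I⁻¹ w_{Is}` over the steps `I ⊂ Is`, in order. -/
def upProd : {I K : Finitary cs} → Expression cs I K → W
  | _, _, nil _ => 1
  | _, _, up (I := I) (J := J) _ e => I.longest⁻¹ * J.longest * e.upProd
  | _, _, down _ e => e.upProd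

/-- The sum of `ℓ(Is) - ℓ(I)` over the steps `I ⊂ Is`. -/
def upLen : {I K : Finitary cs} → Expression cs I K → ℤ
  | _, _, nil _ => 0
  | _, _, up (I := I) (J := J) _ e => J.len - I.len + e.upLen
  | _, _, down _ e => e.upLen

/-- For an expression with associated multistep expression
`[[I_0 ⊂ K_1 ⊃ I_1 ⊂ ... ⊂ K_m ⊃ I_m]]`, the element
`w_{K_1} w_{I_1}⁻¹ w_{K_2} ⋯ w_{I_{m-1}}⁻¹ w_{K_m}`. -/
def elt {I K : Finitary cs} (e : Expression cs I K) : W := I.longest * e.upProd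

/-- The expression is reduced:
`ℓ(w_{K_1} w_{I_1}⁻¹ w_{K_2} ⋯ w_{K_m}) = ℓ(K_1) - ℓ(I_1) + ℓ(K_2) - ⋯ + ℓ(K_m)`. -/
def IsReduced {I K : Finitary cs} (e : Expression cs I K) : Prop :=
  (cs.length e.elt : ℤ) = I.len + e.upLen

/-- `e ⇌ e'`: both are reduced expressions for the same `(I, K)`-coset. (A reduced expression `e`
is an expression for the coset whose longest element is `e.elt`.) -/
def RexRelated {I K : Finitary cs} (e e' : Expression cs I K) : Prop :=
  e.IsReduced ∧ e'.IsReduced ∧ e.elt = e'.elt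

end Expression

/-! ## Realizations and Demazure operators -/

/-- The two-coloured quantum number `[n]_x` (and `[n]_y = qnum n y x`):
`[0]_x = 0`, `[1]_x = 1`, `[n + 2]_x = x [n + 1]_y - [n]_x`. -/
def qnum {k : Type*} [Field k] : ℕ → k → k → k
  | 0, _, _ => 0
  | 1, _, _ => 1
  | n + 2, x, y => x * qnum (n + 1) y x - qnum n x y

/-- A realization of `(W, S)` on the vector space `V` over the field `k`: roots `α_s ∈ V` and
coroots `α_s^∨ ∈ V^*` with `⟨α_s^∨, α_s⟩ = 2`, such that `s(v) = v - ⟨α_s^∨, v⟩ α_s` defines a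
representation of `W`, and such that `[m_st]_x = [m_st]_y = 0` whenever `m_st < ∞`, where
`x = -⟨α_s^∨, α_t⟩` and `y = -⟨α_t^∨, α_s⟩`. (In `CoxeterMatrix`, `M s t = 0` encodes `m_st = ∞`.) -/
structure Realization (cs : CoxeterSystem M W) (k V : Type*) [Field k] [AddCommGroup V]
    [Module k V] where
  root : S → V
  coroot : S → Module.Dual k V
  coroot_root : ∀ s, coroot s (root s) = 2
  liftable : M.IsLiftable fun s => (LinearMap.id - (coroot s).smulRight (root s) : Module.End k V)
  technical : ∀ s t, s ≠ t → M s t ≠ 0 →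
    qnum (M s t) (-coroot s (root t)) (-coroot t (root s)) = 0

/-- The degree `n` part of `R = Sym(V)`, where `deg V = 2`. -/
def symDeg (k V : Type*) [Field k] [AddCommGroup V] [Module k V] (n : ℤ) :
    Submodule k (SymmetricAlgebra k V) :=
  ⨆ (m : ℕ) (_ : 2 * (m : ℤ) = n), (LinearMap.range (SymmetricAlgebra.ι k V)) ^ m

namespace Realization

variable {k V : Type*} [Field k] [AddCommGroup V] [Module k V] (ρ : Realization cs k V)

/-- The representation of `W` on `V`. -/
def rep : W →* Module.End k V := cs.lift ⟨_, ρ.liftable⟩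

/-- The action of `W` on `R = Sym(V)`. -/
def act (w : W) : SymmetricAlgebra k V →ₐ[k] SymmetricAlgebra k V :=
  SymmetricAlgebra.lift (SymmetricAlgebra.ι k V ∘ₗ ρ.rep w)

theorem act_simple_ι (s : S) (v : V) : ρ.act (cs.simple s) (SymmetricAlgebra.ι k V v)
    = SymmetricAlgebra.ι k V (v - ρ.coroot s v • ρ.root s) := by
  simp [act, rep]

theorem root_dvd (s : S) (f : SymmetricAlgebra k V) :
    SymmetricAlgebra.ι k V (ρ.root s) ∣ f - ρ.act (cs.simple s) f := by
  induction f using SymmetricAlgebra.induction with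
  | algebraMap r => simp
  | ι v =>
    rw [act_simple_ι]
    exact ⟨algebraMap k _ (ρ.coroot s v), by simp [Algebra.smul_def, mul_comm]⟩
  | mul a b ha hb =>
    have : a * b - ρ.act (cs.simple s) (a * b)
        = (a - ρ.act (cs.simple s) a) * b
          + ρ.act (cs.simple s) a * (b - ρ.act (cs.simple s) b) := by
      rw [map_mul]
      ring
    rw [this]
    exact dvd_add (ha.mul_right _) (hb.mul_left _)
  | add a b ha hb =>
    have : a + b - ρ.act (cs.simple s) (a + b)
        = (a - ρ.act (cs.simple s) a) + (b - ρ.act (cs.simple s) b) := by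
      rw [map_add]
      ring
    rw [this]
    exact dvd_add ha hb

/-- The Demazure operator `∂_s(f) = (f - s(f)) / α_s`. -/
def demazure (s : S) (f : SymmetricAlgebra k V) : SymmetricAlgebra k V :=
  (ρ.root_dvd s f).choose

/-- `∂_{s_1} ∘ ⋯ ∘ ∂_{s_n}`. -/
def demazureWord (ω : List S) (f : SymmetricAlgebra k V) : SymmetricAlgebra k V :=
  ω.foldr ρ.demazure f

/-- The Demazure operator `∂_w = ∂_{s_1} ∘ ⋯ ∘ ∂_{s_n}` for a reduced expression
`w = s_1 ⋯ s_n`. -/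
def demazureOp (w : W) : SymmetricAlgebra k V → SymmetricAlgebra k V :=
  ρ.demazureWord (cs.exists_isReduced w).choose

/-- The ring of invariants `R^I`. -/
def inv (I : Finitary cs) : Subalgebra k (SymmetricAlgebra k V) where
  carrier := {f | ∀ w ∈ parabolic cs I.carrier, ρ.act w f = f}
  mul_mem' ha hb w hw := by rw [map_mul, ha w hw, hb w hw]
  add_mem' ha hb w hw := by rw [map_add, ha w hw, hb w hw]
  algebraMap_mem' r w _ := (ρ.act w).commutes r

theorem inv_le {I J : Finitary cs} (h : Cov I J) : ρ.inv J ≤ ρ.inv I :=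
  fun _ hf w hw => hf w (parabolic_mono h.subset hw)

/-- The inclusion `ι : R^J → R^I` for `J = Is`. -/
def incl {I J : Finitary cs} (h : Cov I J) : ρ.inv J →+* ρ.inv I :=
  (Subalgebra.inclusion (ρ.inv_le h)).toRingHom

/-- The technical standing assumptions on a realization: it is faithful, balanced, satisfies
generalized Demazure surjectivity, and is reflection faithful. -/
structure IsAdmissible : Prop where
  faithful : Function.Injective ρ.rep
  balanced : ∀ s t, s ≠ t → M s t ≠ 0 →
    qnum (M s t - 1) (-ρ.coroot s (ρ.root t)) (-ρ.coroot t (ρ.root s)) = 1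
  demazure_surjective : ∀ I : Finitary cs, ∀ f ∈ ρ.inv I, ∃ g, ρ.demazureOp I.longest g = f
  reflection_faithful : ∀ w : W,
    Module.finrank k (V ⧸ LinearMap.ker (ρ.rep w - 1)) = 1 ↔ cs.IsReflection w

open Classical in
/-- The trace map `∂^I_J : R^I → R^J` for `J = Is`, i.e. the `R^J`-linear map obtained from the
Demazure operator `∂_{w_J w_I⁻¹}` by restriction. (For an admissible realization the Demazure
operator does restrict to such a map, and the default value `0` is not used.) -/
def traceMap {I J : Finitary cs} (h : Cov I J) : Bimod.LinForm (ρ.incl h) :=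
  if H : ∃ T : Bimod.LinForm (ρ.incl h), ∀ f : ρ.inv I,
      (T f : SymmetricAlgebra k V) = ρ.demazureOp (J.longest * I.longest⁻¹) f
  then H.choose else 0

/-! ## Bott--Samelson bimodules -/

/-- The Bott--Samelson bimodule of a singlestep expression, as an (ungraded)
`(R^I, R^K)`-bimodule: an iterated tensor product of the induction bimodules `R^I ⊗[R^{Is}] -` for
the steps `I ⊂ Is` and the restriction bimodules for the steps `Is ⊃ I`, so that for the
associated multistep expression one gets
`R^{I_0} ⊗[R^{K_1}] (R^{I_1} ⊗[R^{K_2}] ⋯ R^{I_m})`. -/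
def BS : {I K : Finitary cs} → Expression cs I K → Bimod (ρ.inv I) (ρ.inv K)
  | _, _, .nil I => Bimod.self (ρ.inv I)
  | _, _, .up h e => Bimod.ind (ρ.incl h) (BS e)
  | _, _, .down h e => Bimod.res (ρ.incl h) (BS e)

/-- The 1-tensor `1 ⊗ 1 ⊗ ⋯ ⊗ 1`. -/
def oneTensor : {I K : Finitary cs} → (e : Expression cs I K) → (ρ.BS e).carrier
  | _, _, .nil I => (1 : ρ.inv I)
  | _, _, .up h e => Bimod.tmul (ρ.incl h) (ρ.BS e) 1 (oneTensor e)
  | _, _, .down h e => Bimod.toRes (ρ.incl h) (ρ.BS e) (oneTensor e)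

/-- The grading of the Bott--Samelson bimodule: polynomials have their usual degree, degrees add
up in tensor products, and a step `I ⊃ J` carries the grading shift `(ℓ(I) - ℓ(J))`, where the
degree `n` part of `N(m)` is the degree `n + m` part of `N`. -/
def grading : {I K : Finitary cs} → (e : Expression cs I K) → ℤ → AddSubgroup (ρ.BS e).carrier
  | _, _, .nil I, n => AddSubgroup.comap (ρ.inv I).val.toAddMonoidHom (symDeg k V n).toAddSubgroup
  | _, _, .up h e, n => AddSubgroup.closure
      {y | ∃ (a b : ℤ) (f : ρ.inv _) (x : (ρ.BS e).carrier),
        (f : SymmetricAlgebra k V) ∈ symDeg k V a ∧ x ∈ grading e b ∧ a + b = n ∧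
          y = Bimod.tmul (ρ.incl h) (ρ.BS e) f x}
  | _, _, .down (I := I) (J := J) _ e, n => grading e (n + (I.len - J.len))

theorem incl_comp {I J J' L : Finitary cs} (h₁ : Cov I J) (h₂ : Cov J L) (h₃ : Cov I J')
    (h₄ : Cov J' L) :
    (ρ.incl h₁).comp (ρ.incl h₂) = (ρ.incl h₃).comp (ρ.incl h₄) := rfl

end Realization

/-! ## String diagrams and the evaluation functor -/

section Diagrams

variable {k V : Type*} [Field k] [AddCommGroup V] [Module k V]

/-- String diagrams, representing the 2-morphisms of `Frob`, from a singlestep expression (the bottom boundary)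
to another one (the top boundary). They are vertical composites of layers, and a layer is a
generator with identity strands to its left (`whiskerUp`, `whiskerDown`) and to its right (the
expression `e`). The generators are: polynomials; the four oriented cups and caps attached to
`I ⊂ J = Is`; the crossing `[I, It, Ist] → [I, Is, Ist]` of two upward strands of different
colours. -/
inductive Diagram (ρ : Realization cs k V) : {I K : Finitary cs} →
    Expression cs I K → Expression cs I K → Type _
  | id {I K : Finitary cs} (e : Expression cs I K) : Diagram ρ e e
  | comp {I K : Finitary cs} {e e' e'' : Expression cs I K} (D : Diagram ρ e e')
      (D' : Diagram ρ e' e'') : Diagram ρ e e''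
  | whiskerUp {I J K : Finitary cs} (h : Cov I J) {e e' : Expression cs J K}
      (D : Diagram ρ e e') : Diagram ρ (.up h e) (.up h e')
  | whiskerDown {I J K : Finitary cs} (h : Cov J I) {e e' : Expression cs J K}
      (D : Diagram ρ e e') : Diagram ρ (.down h e) (.down h e')
  | box {I K : Finitary cs} (e : Expression cs I K) (n : ℤ) (f : ρ.inv I)
      (hf : (f : SymmetricAlgebra k V) ∈ symDeg k V n) : Diagram ρ e e
  | cwCap {I J K : Finitary cs} (h : Cov I J) (e : Expression cs I K) :
      Diagram ρ (.up h (.down h e)) e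
  | cwCup {I J K : Finitary cs} (h : Cov I J) (e : Expression cs I K) :
      Diagram ρ e (.up h (.down h e))
  | ccwCap {I J K : Finitary cs} (h : Cov I J) (e : Expression cs J K) :
      Diagram ρ (.down h (.up h e)) e
  | ccwCup {I J K : Finitary cs} (h : Cov I J) (e : Expression cs J K) :
      Diagram ρ e (.down h (.up h e))
  | cross {I J J' L K : Finitary cs} (h₁ : Cov I J) (h₂ : Cov J L) (h₃ : Cov I J')
      (h₄ : Cov J' L) (hne : J.carrier ≠ J'.carrier) (e : Expression cs L K) :
      Diagram ρ (.up h₁ (.up h₂ e)) (.up h₃ (.up h₄ e))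

namespace Diagram

variable {ρ : Realization cs k V}

/-- The degree of a diagram: `ℓ(Is) - ℓ(I)` for clockwise cups and caps, `ℓ(I) - ℓ(Is)` for
counterclockwise cups and caps, `0` for (upward) crossings, `deg f` for a polynomial `f`. -/
def degree : {I K : Finitary cs} → {e e' : Expression cs I K} → Diagram ρ e e' → ℤ
  | _, _, _, _, id _ => 0
  | _, _, _, _, comp D D' => D.degree + D'.degree
  | _, _, _, _, whiskerUp _ D => D.degree
  | _, _, _, _, whiskerDown _ D => D.degree
  | _, _, _, _, box _ n _ _ => n
  | _, _, _, _, cwCap (I := I) (J := J) _ _ => J.len - I.len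
  | _, _, _, _, cwCup (I := I) (J := J) _ _ => J.len - I.len
  | _, _, _, _, ccwCap (I := I) (J := J) _ _ => I.len - J.len
  | _, _, _, _, ccwCup (I := I) (J := J) _ _ => I.len - J.len
  | _, _, _, _, cross _ _ _ _ _ _ => 0

/-- The evaluation functor `F` on 2-morphisms, with values in bimodule homomorphisms: cups and caps
are sent to the structure maps `m`, `Δ`, `∂`, `ι` of the Frobenius extension `R^{Is} ⊂ R^I`, and
crossings to the natural isomorphism preserving 1-tensors. -/
def eval : {I K : Finitary cs} → {e e' : Expression cs I K} → Diagram ρ e e' →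
    Bimod.Hom (ρ.BS e) (ρ.BS e')
  | _, _, _, _, id e => Bimod.Hom.id (ρ.BS e)
  | _, _, _, _, comp D D' => D.eval.comp D'.eval
  | _, _, _, _, whiskerUp h D => Bimod.Hom.ind (ρ.incl h) D.eval
  | _, _, _, _, whiskerDown h D => Bimod.Hom.res (ρ.incl h) D.eval
  | _, _, _, _, box e _ f _ => Bimod.Hom.lmul (ρ.BS e) f
  | _, _, _, _, cwCap h e => Bimod.Hom.mult (ρ.incl h) (ρ.BS e)
  | _, _, _, _, cwCup h e => Bimod.Hom.coprod (ρ.incl h) (ρ.traceMap h) (ρ.BS e)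
  | _, _, _, _, ccwCap h e => Bimod.Hom.trace (ρ.incl h) (ρ.traceMap h) (ρ.BS e)
  | _, _, _, _, ccwCup h e => Bimod.Hom.unit (ρ.incl h) (ρ.BS e)
  | _, _, _, _, cross h₁ h₂ h₃ h₄ _ e =>
      Bimod.Hom.cross (ρ.incl h₂) (ρ.incl h₁) (ρ.incl h₄) (ρ.incl h₃)
        (ρ.incl_comp h₁ h₂ h₃ h₄) (ρ.BS e)

/-! ### Sideways and downward crossings, obtained from the upward one by rotation -/

section Crossings

variable {I J J' L K : Finitary cs} (h₁ : Cov I J) (h₂ : Cov J L) (h₃ : Cov I J') (h₄ : Cov J' L)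
  (hne : J.carrier ≠ J'.carrier)

/-- The right-facing crossing `[Is, Ist, It] → [Is, I, It]`, where `J = Is`, `J' = It`,
`L = Ist`. -/
def rightCross (e : Expression cs J' K) :
    Diagram ρ (.up h₂ (.down h₄ e)) (.down h₁ (.up h₃ e)) :=
  (ccwCup h₁ _).comp <|
    (whiskerDown h₁ (cross h₁ h₂ h₃ h₄ hne _)).comp <|
      whiskerDown h₁ (whiskerUp h₃ (cwCap h₄ e))

/-- The left-facing crossing `[Is, I, It] → [Is, Ist, It]`. -/
def leftCross (e : Expression cs J' K) :
    Diagram ρ (.down h₁ (.up h₃ e)) (.up h₂ (.down h₄ e)) :=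
  (whiskerDown h₁ (whiskerUp h₃ (cwCup h₄ e))).comp <|
    (whiskerDown h₁ (cross h₃ h₄ h₁ h₂ hne.symm _)).comp <|
      ccwCap h₁ _

/-- The down-facing crossing `[Ist, Is, I] → [Ist, It, I]`. -/
def downCross (e : Expression cs I K) :
    Diagram ρ (.down h₂ (.down h₁ e)) (.down h₄ (.down h₃ e)) :=
  (ccwCup h₄ _).comp <|
    (whiskerDown h₄ (ccwCup h₃ _)).comp <|
      (whiskerDown h₄ (whiskerDown h₃ (cross h₃ h₄ h₁ h₂ hne.symm _))).comp <|
        (whiskerDown h₄ (whiskerDown h₃ (whiskerUp h₁ (cwCap h₂ _)))).comp <|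
          whiskerDown h₄ (whiskerDown h₃ (cwCap h₁ e))

end Crossings

end Diagram

/-! ## Rex moves -/

theorem hat_carrier_ne {L : Finitary cs} {u v : S} (hv : v ∈ L.carrier) (h : u ≠ v) :
    (L.hat u).carrier ≠ (L.hat v).carrier := fun heq => by
  have hmem : v ∈ (L.hat u).carrier := ⟨hv, fun hvu => h hvu.symm⟩
  rw [heq] at hmem
  exact hmem.2 rfl

/-- Sequences `(u_0, ..., u_d)`, `d ≥ 1`, of elements of `L` with `u_i ≠ u_{i+1}` for all `i`. -/
inductive StepSeq (L : Finitary cs) : S → S → Type _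
  | pair {u v : S} (hu : u ∈ L.carrier) (hv : v ∈ L.carrier) (hne : u ≠ v) : StepSeq L u v
  | cons {u v x : S} (hu : u ∈ L.carrier) (hv : v ∈ L.carrier) (hne : u ≠ v)
      (r : StepSeq L v x) : StepSeq L u x

namespace StepSeq

variable {L K : Finitary cs}

theorem fst_mem : {u x : S} → StepSeq L u x → u ∈ L.carrier
  | _, _, pair hu _ _ => hu
  | _, _, cons hu _ _ _ => hu

theorem last_mem : {u x : S} → StepSeq L u x → x ∈ L.carrier
  | _, _, pair _ hv _ => hv
  | _, _, cons _ _ _ r => r.last_mem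

/-- `[I + u_0 - u_d]`, where `L = I u_0`, followed by the expression `e`. -/
abbrev short {u x : S} (r : StepSeq L u x) (e : Expression cs (L.hat x) K) :
    Expression cs (L.hat u) K :=
  .up (hat_cov r.fst_mem) (.down (hat_cov r.last_mem) e)

/-- `[I - u_1 + u_0 - u_2 + u_1 ⋯ - u_d + u_{d-1}]`, where `L = I u_0`, followed by the
expression `e`. -/
def long : {u x : S} → StepSeq L u x → Expression cs (L.hat x) K → Expression cs (L.hat u) K
  | _, _, pair hu hv hne, e => .down (hat₂_cov_left hv hne) (.up (hat₂_cov_right hu hne) e)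
  | _, _, cons hu hv hne r, e =>
      .down (hat₂_cov_left hv hne) (.up (hat₂_cov_right hu hne) (r.long e))

/-- `(u_0, ..., u_d)` gives a switchback relation
`[I + u_0 - u_d] ⇌ [I - u_1 + u_0 - u_2 + u_1 ⋯ - u_d + u_{d-1}]`. -/
def IsSwitchback {u x : S} (r : StepSeq L u x) : Prop :=
  (r.short (.nil _)).RexRelated (r.long (.nil _))

variable (ρ : Realization cs k V)

/-- The diagram `[I + u_0 - u_d] → [I - u_1 + u_0 ⋯ - u_d + u_{d-1}]`: the strands `+u_0` and
`-u_d` run from bottom to top, and for `0 < i < d` the strands `-u_i` and `+u_i` are joined by a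
counterclockwise cup. The resulting crossings are all right-facing. -/
def expand : {u x : S} → (r : StepSeq L u x) → (e : Expression cs (L.hat x) K) →
    Diagram ρ (r.short e) (r.long e)
  | _, _, pair hu hv hne, e =>
      .rightCross (hat₂_cov_left hv hne) (hat_cov hu) (hat₂_cov_right hu hne) (hat_cov hv)
        (hat_carrier_ne hv hne) e
  | _, _, cons hu hv hne r, e =>
      (Diagram.whiskerUp (hat_cov hu) (.ccwCup (hat_cov hv) _)).comp <|
        (Diagram.rightCross (hat₂_cov_left hv hne) (hat_cov hu) (hat₂_cov_right hu hne)
          (hat_cov hv) (hat_carrier_ne hv hne) _).comp <|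
          .whiskerDown _ (.whiskerUp _ (r.expand e))

/-- The diagram `[I - u_1 + u_0 ⋯ - u_d + u_{d-1}] → [I + u_0 - u_d]`: the previous one flipped
upside-down with orientations reversed, consisting of left-facing crossings and counterclockwise
caps. -/
def contract : {u x : S} → (r : StepSeq L u x) → (e : Expression cs (L.hat x) K) →
    Diagram ρ (r.long e) (r.short e)
  | _, _, pair hu hv hne, e =>
      .leftCross (hat₂_cov_left hv hne) (hat_cov hu) (hat₂_cov_right hu hne) (hat_cov hv)
        (hat_carrier_ne hv hne) e
  | _, _, cons hu hv hne r, e =>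
      (Diagram.whiskerDown _ (.whiskerUp _ (r.contract e))).comp <|
        (Diagram.leftCross (hat₂_cov_left hv hne) (hat_cov hu) (hat₂_cov_right hu hne)
          (hat_cov hv) (hat_carrier_ne hv hne) _).comp <|
          .whiskerUp (hat_cov hu) (.ccwCap (hat_cov hv) _)

end StepSeq

/-- Elementary rex moves: the diagrams attached to one up-up, down-down or switchback relation, in
either direction, applied inside an expression. -/
inductive IsElementaryRexMove (ρ : Realization cs k V) : {I K : Finitary cs} →
    {e e' : Expression cs I K} → Diagram ρ e e' → Prop
  | upUp {I J J' L K : Finitary cs} (h₁ : Cov I J) (h₂ : Cov J L) (h₃ : Cov I J')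
      (h₄ : Cov J' L) (hne : J.carrier ≠ J'.carrier) (e : Expression cs L K) :
      IsElementaryRexMove ρ (.cross h₁ h₂ h₃ h₄ hne e)
  | downDown {I J J' L K : Finitary cs} (h₁ : Cov I J) (h₂ : Cov J L) (h₃ : Cov I J')
      (h₄ : Cov J' L) (hne : J.carrier ≠ J'.carrier) (e : Expression cs I K) :
      IsElementaryRexMove ρ (.downCross h₁ h₂ h₃ h₄ hne e)
  | expand {L K : Finitary cs} {u x : S} (r : StepSeq L u x) (hr : r.IsSwitchback)
      (e : Expression cs (L.hat x) K) : IsElementaryRexMove ρ (r.expand ρ e)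
  | contract {L K : Finitary cs} {u x : S} (r : StepSeq L u x) (hr : r.IsSwitchback)
      (e : Expression cs (L.hat x) K) : IsElementaryRexMove ρ (r.contract ρ e)
  | whiskerUp {I J K : Finitary cs} (h : Cov I J) {e e' : Expression cs J K}
      (D : Diagram ρ e e') (hD : IsElementaryRexMove ρ D) :
      IsElementaryRexMove ρ (.whiskerUp h D)
  | whiskerDown {I J K : Finitary cs} (h : Cov J I) {e e' : Expression cs J K}
      (D : Diagram ρ e e') (hD : IsElementaryRexMove ρ D) :
      IsElementaryRexMove ρ (.whiskerDown h D)

/-- Rex moves: composites of finitely many elementary rex moves. -/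
inductive IsRexMove (ρ : Realization cs k V) : {I K : Finitary cs} →
    {e e' : Expression cs I K} → Diagram ρ e e' → Prop
  | id {I K : Finitary cs} (e : Expression cs I K) : IsRexMove ρ (.id e)
  | comp {I K : Finitary cs} {e e' e'' : Expression cs I K} (D : Diagram ρ e e')
      (D' : Diagram ρ e' e'') (hD : IsRexMove ρ D) (hD' : IsElementaryRexMove ρ D') :
      IsRexMove ρ (.comp D D')

end Diagrams

end Coxeter

end SingularSoergel

/-! ## Strong exchange -/

namespace CoxeterSystem

variable {B W : Type*} [Group W] {M : CoxeterMatrix B} (cs : CoxeterSystem M W)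

/-! A rex move is a composite of elementary ones, so each elementary move must be shown to fix the
1-tensor and to have degree zero. That a diagram of degree `d` raises the grading by `d` is checked
generator by generator (`Diagram.eval_mem_grading`).

Crossings, inclusions and multiplications send 1-tensors to 1-tensors. This settles the up-up and
down-down moves and the switchback read from left to right, since these involve neither a coproduct
nor a trace. The degree of a switchback diagram telescopes to `ℓ(L) - ℓ(L \ u_0)` minus the sum of
the lengths gained along the long expression, and this difference vanishes because that expression
is reduced.

The hard case is the switchback read from right to left, whose left-facing crossings contain a
coproduct and a trace. Its target has the form `R^{L \ u_0} ⊗ N` over `R^L`, and by the Frobenius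
property an element there is determined by the traces of its multiples by all `b`. Tracing a
left-facing crossing cancels the coproduct against the trace, by transitivity of traces around the
square of subsets (`Diagram.traceAdd_leftCross_eval`). Inductively the whole contraction becomes an
iterated trace, a composite of Demazure operators. As the long expression is reduced, lengths add
and the composite is one operator, `∂` of the inverse of `w_{L \ u_0}⁻¹ w_L`. This is the trace from
`R^{L \ u_0}` to `R^L`, which is also what the 1-tensor gives (`StepSeq.contract_eval_oneTensor`).

Two foundations are needed. First, `∂_w` must not depend on the reduced word: this is Matsumoto's
theorem, obtained from strong exchange and the exact order of a product of two simple reflections,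
together with the braid relations for Demazure operators, which use balancedness and the vanishing
of `[m_st]`. Second, `R^L ⊆ R^I` must be Frobenius: if `∂_{w_L} P = 1`, the families `∂_{w_I} ∂_x P`
and `∂_{x w_L} P`, over minimal representatives `x` of `W_I \ W_L`, have a unitriangular Gram
matrix. Taking `P` homogeneous makes the coproduct element homogeneous, as the grading statement
requires. -/

theorem end_mul_apply {α : Type*} (f g : Function.End α) (x : α) : (f * g) x = f (g x) := rfl

theorem end_one_apply {α : Type*} (x : α) : (1 : Function.End α) x = x := rfl

open Classical in
/-- The action of the simple reflection `s` on pairs (reflection, sign):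
`(r, ε) ↦ (s r s, ε + [r = s])`. -/
def signStep (i : B) : Function.End (W × ZMod 2) := fun p =>
  (cs.simple i * p.1 * cs.simple i, p.2 + if p.1 = cs.simple i then 1 else 0)

open Classical in
theorem signStep_apply (i : B) (r : W) (ε : ZMod 2) : cs.signStep i (r, ε) =
    (cs.simple i * r * cs.simple i, ε + if r = cs.simple i then 1 else 0) := rfl

open Classical in
-- The sign records how often `r` occurs among the `2k` successive reflections `(s_j s_i)^l s_j`
-- crossed by the alternating word; each further pair of letters adds the terms `l = 2k` and `l = 2k
-- + 1`.
theorem signStep_mul_pow (i j : B) (k : ℕ) (r : W) (ε : ZMod 2) :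
    ((cs.signStep i * cs.signStep j) ^ k) (r, ε) =
      ((cs.simple i * cs.simple j) ^ k * r * ((cs.simple i * cs.simple j) ^ k)⁻¹,
        ε + ∑ l ∈ Finset.range (2 * k),
          if r = (cs.simple j * cs.simple i) ^ l * cs.simple j then 1 else 0) := by
  induction k with
  | zero => simp [end_one_apply]
  | succ k ih =>
    have hinv : (cs.simple i * cs.simple j)⁻¹ = cs.simple j * cs.simple i := by simp
    rw [pow_succ', end_mul_apply, ih, mul_add, mul_one,
      Finset.sum_range_succ, Finset.sum_range_succ]
    have hc : ∀ n : ℕ, cs.simple j * (cs.simple i * cs.simple j) ^ n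
        = (cs.simple j * cs.simple i) ^ n * cs.simple j := by
      intro n
      induction n with
      | zero => simp
      | succ n ihn => rw [pow_succ, ← mul_assoc, ihn, pow_succ]; simp only [mul_assoc]
    set g := (cs.simple i * cs.simple j) ^ k with hg
    have hg' : g⁻¹ = (cs.simple j * cs.simple i) ^ k := by rw [hg, ← inv_pow, hinv]
    have e1 : (g * r * g⁻¹ = cs.simple j)
        ↔ r = (cs.simple j * cs.simple i) ^ (2 * k) * cs.simple j := by
      rw [two_mul, pow_add, mul_assoc _ _ (cs.simple j), ← hc k, ← hg, ← hg', ← mul_assoc]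
      constructor
      · intro h; rw [← h]; group
      · intro h; rw [h]; group
    have e2 : (cs.simple j * (g * r * g⁻¹) * cs.simple j = cs.simple i)
        ↔ r = (cs.simple j * cs.simple i) ^ (2 * k + 1) * cs.simple j := by
      have : (cs.simple j * cs.simple i) ^ (2 * k + 1) * cs.simple j
          = g⁻¹ * (cs.simple j * cs.simple i * cs.simple j) * g := by
        rw [mul_assoc g⁻¹, mul_assoc (cs.simple j * cs.simple i), hg, hc k, ← hg, hg',
          ← mul_assoc, ← mul_assoc, ← pow_succ, ← pow_add]
        congr 2
        omega
      rw [this]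
      constructor
      · intro h; rw [← h]; simp [mul_assoc]
      · intro h; rw [h]; simp [mul_assoc]
    rw [end_mul_apply, signStep_apply, signStep_apply, if_congr e1 rfl rfl, if_congr e2 rfl rfl]
    refine Prod.ext ?_ ?_
    · simp only
      rw [pow_succ', mul_inv_rev, hinv, ← hg]
      simp only [mul_assoc]
    · simp only
      ring

theorem signStep_isLiftable : M.IsLiftable cs.signStep := by
  classical
  intro i j
  funext ⟨r, ε⟩
  rw [signStep_mul_pow, cs.simple_mul_simple_pow, two_mul, Finset.sum_range_add]
  -- The reflections have period `m_ij` in `l`, so over `2 m_ij` values of `l` each is counted an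
  -- even number of times.
  have : ∀ l, (cs.simple j * cs.simple i) ^ (M i j + l) = (cs.simple j * cs.simple i) ^ l := by
    intro l
    rw [pow_add, cs.simple_mul_simple_pow', one_mul]
  simp only [this, ← two_mul]
  have h2 : (2 : ZMod 2) = 0 := rfl
  simp [h2, end_one_apply]

/-- The action of `W` on pairs (reflection, sign). -/
def signAction : W →* Function.End (W × ZMod 2) := cs.lift ⟨_, cs.signStep_isLiftable⟩

open Classical in
-- The left side depends only on the group element, so the parity of the number of occurrences of
-- `r` in the right inversion sequence is independent of the word.
theorem signAction_wordProd (ω : List B) (r : W) (ε : ZMod 2) :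
    cs.signAction (cs.wordProd ω) (r, ε) =
      (cs.wordProd ω * r * (cs.wordProd ω)⁻¹, ε + ((cs.rightInvSeq ω).count r : ℕ)) := by
  induction ω with
  | nil => simp [end_one_apply]
  | cons i ω ih =>
    rw [cs.wordProd_cons, map_mul, end_mul_apply, ih]
    have e : cs.wordProd ω * r * (cs.wordProd ω)⁻¹ = cs.simple i
        ↔ (cs.wordProd ω)⁻¹ * cs.simple i * cs.wordProd ω = r := by
      constructor
      · intro h; rw [← h]; group
      · intro h; rw [← h]; group
    simp only [signAction, lift_apply_simple, signStep, rightInvSeq, List.count_cons, beq_iff_eq]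
    rw [if_congr e rfl rfl]
    refine Prod.ext (by simp [mul_assoc]) ?_
    push_cast
    ring

theorem signAction_snd_add (w r : W) (ε : ZMod 2) :
    cs.signAction w (r, ε) = (w * r * w⁻¹, ε + (cs.signAction w (r, 0)).2) := by
  classical
  obtain ⟨ω, rfl⟩ := cs.wordProd_surjective w
  rw [signAction_wordProd, signAction_wordProd, zero_add]

/-- For `t = u s u⁻¹`, moving by `u⁻¹` and back by `u` contributes signs that cancel, and `s` itself
flips the sign once. -/
theorem signAction_reflection {t : W} (ht : cs.IsReflection t) :
    cs.signAction t (t, 0) = (t, 1) := by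
  classical
  obtain ⟨u, i, rfl⟩ := ht
  set t := u * cs.simple i * u⁻¹ with htd
  have h1 : cs.signAction u⁻¹ (t, 0) = (cs.simple i, (cs.signAction u⁻¹ (t, 0)).2) := by
    refine Prod.ext ?_ rfl
    rw [signAction_snd_add]
    simp [htd, mul_assoc]
  have h2 : ∀ ε, cs.signAction (cs.simple i) (cs.simple i, ε) = (cs.simple i, ε + 1) := by
    intro ε
    simp only [signAction, lift_apply_simple, signStep]
    simp
  have h3 : cs.signAction u (cs.signAction u⁻¹ (t, 0)) = (t, 0) := by
    rw [← end_mul_apply (cs.signAction u), ← map_mul]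
    simp [end_one_apply]
  have h4 : cs.signAction t (t, 0)
      = cs.signAction u (cs.signAction (cs.simple i) (cs.signAction u⁻¹ (t, 0))) := by
    have : ∀ t', t' = u * cs.simple i * u⁻¹ → ∀ p, cs.signAction t' p
        = cs.signAction u (cs.signAction (cs.simple i) (cs.signAction u⁻¹ p)) := by
      rintro _ rfl p
      rw [map_mul, map_mul]
      rfl
    exact this t htd _
  rw [h4, h1, h2, signAction_snd_add]
  rw [h1, signAction_snd_add] at h3
  have h5 := congrArg Prod.snd h3
  simp only at h5
  refine Prod.ext (by simp [htd]) ?_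
  simp only
  rw [add_right_comm, h5, zero_add]

/-- The strong exchange property. -/
theorem mem_rightInvSeq_of_isRightInversion {ω : List B} {t : W}
    (h : cs.IsRightInversion (cs.wordProd ω) t) : t ∈ cs.rightInvSeq ω := by
  classical
  by_contra hmem
  obtain ⟨ht, hlt⟩ := h
  obtain ⟨ν, hν, hw⟩ := cs.exists_isReduced (cs.wordProd ω * t)
  -- If `t` were absent from the sequence, the word `ω` would contribute no sign and `t` would
  -- contribute `1`. Then `t` occurs in the inversion sequence of a reduced word of `w t`, so `ℓ(w)
  -- < ℓ(w t)`, against the hypothesis.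
  have h1 : cs.signAction (cs.wordProd ν) (t, 0) = (cs.wordProd ω * t * (cs.wordProd ω)⁻¹, 1) := by
    rw [← hw, map_mul, end_mul_apply, signAction_reflection _ ht,
      signAction_wordProd, List.count_eq_zero.mpr hmem]
    simp
  rw [signAction_wordProd] at h1
  have hmem' : t ∈ cs.rightInvSeq ν := by
    by_contra hn
    rw [List.count_eq_zero.mpr hn] at h1
    simpa using congrArg Prod.snd h1
  have := (cs.isRightInversion_of_mem_rightInvSeq hν hmem').2
  rw [← hw, mul_assoc, ht.mul_self, mul_one] at this
  omega

theorem mem_leftInvSeq_of_isLeftInversion {ω : List B} {t : W}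
    (h : cs.IsLeftInversion (cs.wordProd ω) t) : t ∈ cs.leftInvSeq ω := by
  rw [← cs.isRightInversion_inv_iff, ← cs.wordProd_reverse] at h
  have := cs.mem_rightInvSeq_of_isRightInversion h
  rwa [cs.rightInvSeq_reverse, List.mem_reverse] at this

theorem exists_eraseIdx_of_isLeftInversion {ω : List B} {t : W}
    (h : cs.IsLeftInversion (cs.wordProd ω) t) :
    ∃ j < ω.length, t * cs.wordProd ω = cs.wordProd (ω.eraseIdx j) := by
  obtain ⟨j, hj, rfl⟩ := List.mem_iff_getElem.mp (cs.mem_leftInvSeq_of_isLeftInversion h)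
  refine ⟨j, by simpa using hj, ?_⟩
  rw [← cs.getD_leftInvSeq_mul_wordProd, List.getD_eq_getElem _ _ hj]

/-! ## The order of a product of two simple reflections -/

section Order

variable (M)

/-- `2 cos (π / m)`, where `m = M i j`, and `2` if `m = ∞`. -/
def cosWeight (i j : B) : ℝ := if M i j = 0 then 2 else 2 * Real.cos (Real.pi / M i j)

theorem cosWeight_self (i : B) : cosWeight M i i = -2 := by simp [cosWeight]

theorem cosWeight_comm (i j : B) : cosWeight M i j = cosWeight M j i := by
  simp only [cosWeight, M.symmetric i j]

/-- The reflections `f ↦ f + f(i) (2 cos (π / M i j))_j` on functions, which define a geometric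
representation. -/
def geomStep (i : B) : Function.End (B → ℝ) := fun f j => f j + cosWeight M i j * f i

variable {M}

/-- A closed formula for the powers of a product of two reflections, in terms of quantum numbers
`u`. -/
theorem geomStep_mul_pow {i j : B} (u : ℕ → ℝ) (h0 : u 0 = 0) (h1 : u 1 = 1)
    (hu : ∀ n, u (n + 2) = cosWeight M i j * u (n + 1) - u n) (k : ℕ) (f : B → ℝ) (a : B) :
    ((geomStep M i * geomStep M j) ^ (k + 1)) f a
      = f a + (u (k + 1) ^ 2 * f i + u (k + 1) * u (k + 2) * f j) * cosWeight M i a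
        + (u (k + 1) * u k * f i + u (k + 1) ^ 2 * f j) * cosWeight M j a := by
  -- A conserved quantity of the recursion, replacing `sin² + cos² = 1`; it is the only relation
  -- that the induction step needs.
  have hc : ∀ n, u (n + 1) ^ 2 - cosWeight M i j * u (n + 1) * u n + u n ^ 2 = 1 := by
    intro n
    induction n with
    | zero => simp [h0, h1]
    | succ n ih => rw [hu n]; linear_combination ih
  induction k generalizing a with
  | zero =>
    simp only [zero_add, pow_one, end_mul_apply, geomStep, h0, h1, hu 0,
      cosWeight_comm M j i]
    ring
  | succ k ih =>
    rw [pow_succ', end_mul_apply]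
    simp only [end_mul_apply, geomStep, ih, cosWeight_self,
      cosWeight_comm M j i]
    rw [hu (k + 1), hu k]
    generalize cosWeight M i a = A
    generalize cosWeight M j a = C
    have := hc k
    generalize cosWeight M i j = x at *
    generalize u (k + 1) = p at *
    generalize u k = q at *
    generalize f i = F at *
    generalize f j = G at *
    linear_combination (-(A * F + C * G + x * A * G) ) * this

theorem geomStep_mul_self (i : B) : geomStep M i * geomStep M i = 1 := by
  funext f a
  simp only [end_mul_apply, geomStep, cosWeight_self,
    end_one_apply]
  ring

theorem sin_quantum (θ : ℝ) (n : ℕ) : Real.sin ((n + 2 : ℕ) * θ) / Real.sin θ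
    = 2 * Real.cos θ * (Real.sin ((n + 1 : ℕ) * θ) / Real.sin θ) - Real.sin (n * θ) / Real.sin θ := by
  have h1 : ((n + 2 : ℕ) : ℝ) * θ = (n + 1 : ℕ) * θ + θ := by push_cast; ring
  have h2 : (n : ℝ) * θ = (n + 1 : ℕ) * θ - θ := by push_cast; ring
  rw [h1, h2, Real.sin_add, Real.sin_sub]
  ring

theorem sin_pi_div_pos {m : ℕ} (hm : 2 ≤ m) {k : ℕ} (hk : 0 < k) (hkm : k < m) :
    0 < Real.sin (k * (Real.pi / m)) := by
  have hm0 : (0 : ℝ) < m := by positivity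
  apply Real.sin_pos_of_pos_of_lt_pi
  · have := Real.pi_pos
    positivity
  · rw [mul_div_assoc', div_lt_iff₀ hm0, mul_comm]
    have : (k : ℝ) < m := by exact_mod_cast hkm
    exact mul_lt_mul_of_pos_left this Real.pi_pos

/-- With `u n = sin (nθ) / sin θ` and `θ = π / m`, the closed formula for the `m`-th power has every
correction term divisible by `u m = 0`. -/
theorem geomStep_isLiftable : M.IsLiftable (geomStep M) := by
  intro i j
  rcases eq_or_ne i j with rfl | hij
  · rw [geomStep_mul_self, one_pow]
  rcases Nat.eq_zero_or_pos (M i j) with hm | hm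
  · rw [hm, pow_zero]
  have hm1 : M i j ≠ 1 := M.off_diagonal i j hij
  have hm2 : 2 ≤ M i j := by omega
  set θ := Real.pi / M i j with hθ
  have hs : Real.sin θ ≠ 0 := by
    have := sin_pi_div_pos hm2 one_pos (by omega)
    rw [Nat.cast_one, one_mul] at this
    exact this.ne'
  funext f a
  obtain ⟨k, hk⟩ : ∃ k, M i j = k + 1 := ⟨M i j - 1, by omega⟩
  have := geomStep_mul_pow (M := M) (i := i) (j := j) (fun n => Real.sin (n * θ) / Real.sin θ)
    (by simp) (by simp [hs])
    (fun n => by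
      simp only [cosWeight, hm.ne', if_false]
      exact sin_quantum θ n) k f a
  rw [hk, this, ← hk]
  have hz : Real.sin ((M i j : ℕ) * θ) = 0 := by
    rw [hθ, mul_div_cancel₀ _ (by positivity)]
    simp
  simp [hz, end_one_apply]

/-- The order of `s_i s_j` is not smaller than `m_ij`: the geometric representation already
separates the lower powers from `1`. Exactness of the order is what makes alternating words reduced.
-/
theorem pow_ne_one_of_lt {i j : B} (hij : i ≠ j) {k : ℕ} (hk : 0 < k)
    (hkm : M i j = 0 ∨ k < M i j) : (cs.simple i * cs.simple j) ^ k ≠ 1 := by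
  classical
  intro h
  have h1 : (geomStep M i * geomStep M j) ^ k = 1 := by
    have := congrArg (cs.lift ⟨_, geomStep_isLiftable (M := M)⟩) h
    simpa using this
  obtain ⟨k, rfl⟩ : ∃ l, k = l + 1 := ⟨k - 1, by omega⟩
  have h2 : ∀ a, ((geomStep M i * geomStep M j) ^ (k + 1)) (Pi.single i 1) a
      = (Pi.single i 1 : B → ℝ) a := by
    intro a; rw [h1]; rfl
  have hj := h2 j
  have hi := h2 i
  rcases Nat.eq_zero_or_pos (M i j) with hm | hm
  -- For `m = ∞` the weight is `2` and the quantum numbers are `u n = n`; the `j`-th coordinate of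
  -- the image of the test function is `2 (k + 1)` instead of `0`.
  · rw [geomStep_mul_pow (M := M) (i := i) (j := j) (fun n => (n : ℝ)) (by simp) (by simp)
      (fun n => by simp only [cosWeight, hm, if_true]; push_cast; ring)] at hj
    simp only [Pi.single_apply, hij.symm, cosWeight_self, if_false, if_true] at hj
    simp only [cosWeight, hm, if_true] at hj
    push_cast at hj
    have : (0 : ℝ) < k + 1 := by positivity
    nlinarith
  · have hm1 : M i j ≠ 1 := M.off_diagonal i j hij
    have hm2 : 2 ≤ M i j := by omega
    set θ := Real.pi / M i j with hθ
    have hs : 0 < Real.sin θ := by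
      have := sin_pi_div_pos hm2 one_pos (by omega)
      rwa [Nat.cast_one, one_mul] at this
    have hrec := geomStep_mul_pow (M := M) (i := i) (j := j) (fun n => Real.sin (n * θ) / Real.sin θ)
      (by simp) (by simp [hs.ne'])
      (fun n => by
        simp only [cosWeight, hm.ne', if_false]
        exact sin_quantum θ n) k
    rw [hrec] at hi hj
    have hp : 0 < Real.sin ((k + 1 : ℕ) * θ) / Real.sin θ :=
      div_pos (sin_pi_div_pos hm2 hk (by omega)) hs
    have hx : cosWeight M i j = 2 * Real.cos θ := by simp [cosWeight, hm.ne', hθ]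
    simp only [Pi.single_apply, hij.symm, cosWeight_self, if_false, if_true, hx,
      cosWeight_comm M j i] at hi hj
    generalize Real.sin ((k + 1 : ℕ) * θ) / Real.sin θ = p at *
    generalize Real.sin ((k : ℕ) * θ) / Real.sin θ = q at *
    have hcs := Real.sin_sq_add_cos_sq θ
    -- Eliminating `q = u k` from the equations at coordinates `i` and `j` leaves `p² sin² θ = 0`,
    -- although `p` and `sin θ` are positive for `0 < k + 1 < m`.
    have : p ^ 2 * (Real.sin θ) ^ 2 = 0 := by
      linear_combination (-1 / 2) * hi - (1 / 2) * Real.cos θ * hj + p ^ 2 * hcs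
    have : 0 < p ^ 2 * (Real.sin θ) ^ 2 := by positivity
    linarith

end Order

end CoxeterSystem

namespace CoxeterSystem

variable {B W : Type*} [Group W] {M : CoxeterMatrix B} (cs : CoxeterSystem M W)

/-! ## Matsumoto's theorem -/

/-- The word `i j i ⋯` of length `n`. -/
def altWord : B → B → ℕ → List B
  | _, _, 0 => []
  | i, j, n + 1 => i :: altWord j i n

@[simp] theorem length_altWord (i j : B) (n : ℕ) : (altWord i j n).length = n := by
  induction n generalizing i j with
  | zero => rfl
  | succ n ih => simp [altWord, ih]

theorem simple_mul_pow_comm (i j : B) (n : ℕ) : cs.simple i * (cs.simple j * cs.simple i) ^ n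
    = (cs.simple i * cs.simple j) ^ n * cs.simple i := by
  induction n with
  | zero => simp
  | succ n ihn => rw [pow_succ, ← mul_assoc, ihn, pow_succ]; simp only [mul_assoc]

theorem wordProd_altWord_eq_pow_mul (i j : B) (n : ℕ) : cs.wordProd (altWord i j n)
    = (cs.simple i * cs.simple j) ^ n * cs.wordProd (altWord j i n) := by
  induction n generalizing i j with
  | zero => simp [altWord]
  | succ n ih =>
    simp only [altWord, cs.wordProd_cons]
    rw [ih j i]
    rw [← mul_assoc, simple_mul_pow_comm, pow_succ]
    simp [mul_assoc]

theorem wordProd_altWord_comm (i j : B) :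
    cs.wordProd (altWord i j (M i j)) = cs.wordProd (altWord j i (M i j)) := by
  rw [wordProd_altWord_eq_pow_mul, cs.simple_mul_simple_pow, one_mul]

theorem leftInvSeq_altWord (i j : B) (n : ℕ) : cs.leftInvSeq (altWord i j n)
    = (List.range n).map fun l => (cs.simple i * cs.simple j) ^ l * cs.simple i := by
  induction n generalizing i j with
  | zero => rfl
  | succ n ih =>
    rw [altWord, leftInvSeq, ih, List.range_succ_eq_map]
    simp only [List.map_cons, pow_zero, one_mul, List.map_map]
    congr 1
    refine List.map_congr_left fun l _ => ?_
    simp only [Function.comp_apply, MulAut.conj_apply, inv_simple]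
    rw [pow_succ]
    rw [← mul_assoc, simple_mul_pow_comm]
    simp only [mul_assoc]

/-- If prepending `i` shortened the alternating word, strong exchange would put `s_i` among its left
inversions `(s_j s_i)^l s_j`, whence `(s_j s_i)^(l+1) = 1` below the order. -/
theorem isReduced_altWord {i j : B} (hij : i ≠ j) {n : ℕ} (hn : M i j = 0 ∨ n ≤ M i j) :
    cs.IsReduced (altWord i j n) := by
  induction n generalizing i j with
  | zero => simp [altWord, IsReduced]
  | succ n ih =>
    have ih' : cs.IsReduced (altWord j i n) := ih hij.symm (by rw [M.symmetric]; omega)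
    rcases cs.length_simple_mul (cs.wordProd (altWord j i n)) i with h | h
    · rw [IsReduced, altWord, cs.wordProd_cons, h, ih']
      simp
    · have hinv : cs.IsLeftInversion (cs.wordProd (altWord j i n)) (cs.simple i) :=
        ⟨cs.isReflection_simple i, by omega⟩
      have hmem := cs.mem_leftInvSeq_of_isLeftInversion hinv
      rw [leftInvSeq_altWord] at hmem
      obtain ⟨l, hl, hl'⟩ := List.mem_map.mp hmem
      rw [List.mem_range] at hl
      exfalso
      refine cs.pow_ne_one_of_lt hij.symm (k := l + 1) (by omega) (by rw [M.symmetric]; omega) ?_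
      rw [pow_succ, ← mul_assoc, hl', cs.simple_mul_simple_self]

/-- Exchange for the descent `j` deletes a letter of `w`. It cannot lie in the alternating prefix,
for then a reduced alternating word of length `n + 1` would equal a word of length `n - 1`; so it
lies in `u`, and `j` can be put in front of the prefix. -/
theorem exists_altWord_succ {w u : W} {i j : B} (hij : i ≠ j) {n : ℕ}
    (hn : M i j = 0 ∨ n + 1 ≤ M i j) (hw : w = cs.wordProd (altWord i j n) * u)
    (hl : cs.length w = n + cs.length u) (hj : cs.IsLeftDescent w j) :
    ∃ u', w = cs.wordProd (altWord j i (n + 1)) * u' ∧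
      cs.length w = (n + 1) + cs.length u' := by
  obtain ⟨ν, hν, rfl⟩ := cs.exists_isReduced u
  rw [← cs.wordProd_append] at hw
  subst hw
  rw [← cs.isLeftInversion_simple_iff_isLeftDescent] at hj
  obtain ⟨k, hk, he⟩ := cs.exists_eraseIdx_of_isLeftInversion hj
  rw [List.length_append, length_altWord] at hk
  rw [hν] at hl
  rcases lt_or_ge k n with hkn | hkn
  · rw [List.eraseIdx_append_of_lt_length (by simpa using hkn), cs.wordProd_append,
      cs.wordProd_append, ← mul_assoc, mul_left_inj] at he
    have h1 := cs.isReduced_altWord hij.symm (n := n + 1) (by rw [M.symmetric]; omega)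
    rw [IsReduced, altWord, cs.wordProd_cons, he, List.length_cons, length_altWord] at h1
    have h2 := cs.length_wordProd_le ((altWord i j n).eraseIdx k)
    rw [List.length_eraseIdx, length_altWord, if_pos hkn] at h2
    omega
  · rw [List.eraseIdx_append_of_length_le (by simpa using hkn), length_altWord] at he
    have hw : cs.wordProd (altWord i j n ++ ν)
        = cs.wordProd (altWord j i (n + 1)) * cs.wordProd (ν.eraseIdx (k - n)) := by
      rw [altWord, cs.wordProd_cons, mul_assoc, ← cs.wordProd_append, ← he, cs.simple_mul_simple_cancel_left]
    refine ⟨_, hw, ?_⟩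
    have h1 := cs.length_mul_le (cs.wordProd (altWord j i (n + 1)))
      (cs.wordProd (ν.eraseIdx (k - n)))
    rw [← hw] at h1
    have h2 := cs.length_wordProd_le (ν.eraseIdx (k - n))
    rw [List.length_eraseIdx, if_pos (by omega)] at h2
    have h3 := cs.length_wordProd_le (altWord j i (n + 1))
    rw [length_altWord] at h3
    omega

theorem exists_altWord_of_isLeftDescent {w : W} {i j : B} (hij : i ≠ j)
    (hi : cs.IsLeftDescent w i) (hj : cs.IsLeftDescent w j) (n : ℕ)
    (hn : M i j = 0 ∨ n ≤ M i j) :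
    (∃ u, w = cs.wordProd (altWord i j n) * u ∧ cs.length w = n + cs.length u) ∧
      ∃ u, w = cs.wordProd (altWord j i n) * u ∧ cs.length w = n + cs.length u := by
  induction n with
  | zero => exact ⟨⟨w, by simp [altWord]⟩, ⟨w, by simp [altWord]⟩⟩
  | succ n ih =>
    obtain ⟨⟨u, hu, hul⟩, ⟨v, hv, hvl⟩⟩ := ih (by omega)
    exact ⟨cs.exists_altWord_succ hij.symm (by rw [M.symmetric]; exact hn) hv hvl hi,
      cs.exists_altWord_succ hij hn hu hul hj⟩

/-- If `m_ij = ∞`, two descents would force alternating prefixes of every length, in particular one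
longer than `w`. -/
theorem weight_ne_zero_of_isLeftDescent {w : W} {i j : B} (hij : i ≠ j)
    (hi : cs.IsLeftDescent w i) (hj : cs.IsLeftDescent w j) : M i j ≠ 0 := by
  intro h
  obtain ⟨⟨u, -, hu⟩, -⟩ := cs.exists_altWord_of_isLeftDescent hij hi hj (cs.length w + 1) (Or.inl h)
  omega

theorem isReduced_cons {i : B} {ω : List B} (h : cs.IsReduced (i :: ω)) : cs.IsReduced ω := by
  simpa using h.drop 1

theorem isLeftDescent_of_isReduced_cons {i : B} {ω : List B} (h : cs.IsReduced (i :: ω)) :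
    cs.IsLeftDescent (cs.wordProd (i :: ω)) i := by
  have h1 : cs.length _ = _ := cs.isReduced_cons h
  rw [IsLeftDescent, h, cs.wordProd_cons, cs.simple_mul_simple_cancel_left, h1]
  simp

/-- Matsumoto's theorem: a function on words that is compatible with prepending letters and with
the braid relations takes the same value on all reduced words of a group element. -/
theorem eq_of_isReduced {α : Type*} (F : List B → α)
    (hcons : ∀ i ω ω', F ω = F ω' → F (i :: ω) = F (i :: ω'))
    (hbraid : ∀ i j ν, i ≠ j → M i j ≠ 0 →
      F (altWord i j (M i j) ++ ν) = F (altWord j i (M i j) ++ ν))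
    {ω ω' : List B} (hω : cs.IsReduced ω) (hω' : cs.IsReduced ω')
    (h : cs.wordProd ω = cs.wordProd ω') : F ω = F ω' := by
  generalize hn : ω.length = n
  induction n generalizing ω ω' with
  | zero =>
    have h1 : cs.length _ = _ := hω
    have h2 : cs.length _ = _ := hω'
    rw [h, h2, hn] at h1
    rw [List.length_eq_zero_iff.mp hn, List.length_eq_zero_iff.mp h1]
  | succ n ih =>
    have hlen : ω.length = ω'.length := by
      have h1 : cs.length _ = _ := hω
      have h2 : cs.length _ = _ := hω'
      rw [← h1, h, h2]
    have same : ∀ (i : B) (a b : List B), cs.IsReduced (i :: a) → cs.IsReduced (i :: b) →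
        cs.wordProd (i :: a) = cs.wordProd (i :: b) → (i :: a).length = n + 1 →
        F (i :: a) = F (i :: b) := by
      intro i a b ha hb hab hl
      refine hcons i a b (ih (cs.isReduced_cons ha) (cs.isReduced_cons hb) ?_ (by simpa using hl))
      rwa [cs.wordProd_cons, cs.wordProd_cons, mul_right_inj] at hab
    cases ω with
    | nil => simp at hn
    | cons i a =>
      cases ω' with
      | nil => simp at hlen
      | cons j b =>
        rcases eq_or_ne i j with rfl | hij
        · exact same i a b hω hω' h hn
        have hi := cs.isLeftDescent_of_isReduced_cons hω
        have hj := cs.isLeftDescent_of_isReduced_cons hω'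
        rw [← h] at hj
        have hM := cs.weight_ne_zero_of_isLeftDescent hij hi hj
        -- Both first letters are descents, so `w` has a reduced word starting with the full braid
        -- word. The two forms of that braid word share a first letter with `i :: a` and `j :: b`
        -- respectively, and induction applies to the tails.
        obtain ⟨⟨u, hu, hul⟩, -⟩ := cs.exists_altWord_of_isLeftDescent hij hi hj _ (Or.inr le_rfl)
        obtain ⟨ν, hν, rfl⟩ := cs.exists_isReduced u
        have hw1 : cs.wordProd (i :: a) = cs.wordProd (altWord i j (M i j) ++ ν) := by
          rw [cs.wordProd_append, hu]
        have hw2 : cs.wordProd (i :: a) = cs.wordProd (altWord j i (M i j) ++ ν) := by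
          rw [cs.wordProd_append, hu, cs.wordProd_altWord_comm]
        have hr1 : cs.IsReduced (altWord i j (M i j) ++ ν) := by
          rw [IsReduced, ← hw1, hul, hν]; simp
        have hr2 : cs.IsReduced (altWord j i (M i j) ++ ν) := by
          rw [IsReduced, ← hw2, hul, hν]; simp
        have e1 := hbraid i j ν hij hM
        obtain ⟨m, hm⟩ : ∃ m, M i j = m + 1 := ⟨M i j - 1, by omega⟩
        rw [hm] at e1 hw1 hw2 hr1 hr2
        simp only [altWord, List.cons_append] at e1 hw1 hw2 hr1 hr2
        rw [same i _ _ hω hr1 hw1 hn, e1]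
        refine (same j _ _ hω' hr2 ?_ (by rw [← hlen, hn])).symm
        rw [← h, hw2]

end CoxeterSystem

/-! ## Parabolic subgroups and their longest elements -/

namespace SingularSoergel

variable {S W : Type*} [Group W] {M : CoxeterMatrix S} {cs : CoxeterSystem M W}

theorem simple_mem_parabolic {I : Set S} {s : S} (hs : s ∈ I) : cs.simple s ∈ parabolic cs I :=
  Subgroup.subset_closure ⟨s, hs, rfl⟩

theorem wordProd_mem_parabolic {I : Set S} {ω : List S} (h : ∀ s ∈ ω, s ∈ I) :
    cs.wordProd ω ∈ parabolic cs I := by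
  induction ω with
  | nil => exact one_mem _
  | cons s ω ih =>
    rw [cs.wordProd_cons]
    exact mul_mem (simple_mem_parabolic (h s (by simp))) (ih fun t ht => h t (by simp [ht]))

/-- Either the new letter lengthens the reduced word, or exchange deletes one of the old letters; in
both cases no letter outside `I` appears. -/
theorem exists_isReduced_of_letters {I : Set S} (ω : List S) (h : ∀ s ∈ ω, s ∈ I) :
    ∃ ν : List S, (∀ s ∈ ν, s ∈ I) ∧ cs.IsReduced ν ∧ cs.wordProd ω = cs.wordProd ν := by
  induction ω with
  | nil => exact ⟨[], by simp, by simp [CoxeterSystem.IsReduced], rfl⟩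
  | cons s ω ih =>
    obtain ⟨ν, hν, hr, he⟩ := ih fun t ht => h t (by simp [ht])
    have hr' : cs.length _ = _ := hr
    rcases cs.length_simple_mul (cs.wordProd ν) s with hl | hl
    · refine ⟨s :: ν, ?_, ?_, by rw [cs.wordProd_cons, cs.wordProd_cons, he]⟩
      · intro t ht
        rcases List.mem_cons.mp ht with rfl | ht
        · exact h _ (by simp)
        · exact hν t ht
      · rw [CoxeterSystem.IsReduced, cs.wordProd_cons, hl, hr']
        simp
    · have hinv : cs.IsLeftInversion (cs.wordProd ν) (cs.simple s) :=
        ⟨cs.isReflection_simple s, by omega⟩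
      obtain ⟨j, hj, hjj⟩ := cs.exists_eraseIdx_of_isLeftInversion hinv
      refine ⟨ν.eraseIdx j, fun t ht => hν t (List.mem_of_mem_eraseIdx ht), ?_, by
        rw [cs.wordProd_cons, he, hjj]⟩
      rw [CoxeterSystem.IsReduced, ← hjj, List.length_eraseIdx, if_pos hj]
      omega

theorem exists_isReduced_of_mem_parabolic {I : Set S} {w : W} (hw : w ∈ parabolic cs I) :
    ∃ ν : List S, (∀ s ∈ ν, s ∈ I) ∧ cs.IsReduced ν ∧ w = cs.wordProd ν := by
  obtain ⟨ω, hω, rfl⟩ : ∃ ω : List S, (∀ s ∈ ω, s ∈ I) ∧ w = cs.wordProd ω := by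
    refine Subgroup.closure_induction (p := fun w _ => ∃ ω : List S, (∀ s ∈ ω, s ∈ I) ∧
      w = cs.wordProd ω) ?_ ?_ ?_ ?_ hw
    · rintro _ ⟨s, hs, rfl⟩
      exact ⟨[s], by simpa using hs, by simp⟩
    · exact ⟨[], by simp, by simp⟩
    · rintro _ _ _ _ ⟨a, ha, rfl⟩ ⟨b, hb, rfl⟩
      refine ⟨a ++ b, ?_, by rw [cs.wordProd_append]⟩
      intro s hs
      rcases List.mem_append.mp hs with h | h
      · exact ha s h
      · exact hb s h
    · rintro _ _ ⟨a, ha, rfl⟩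
      exact ⟨a.reverse, by simpa using ha, by rw [cs.wordProd_reverse]⟩
  exact exists_isReduced_of_letters ω hω

namespace Finitary

variable (L : Finitary cs)

theorem longest_mem : L.longest ∈ parabolic cs L.carrier := L.exists_longest.choose_spec.1

theorem length_le_longest {v : W} (hv : v ∈ parabolic cs L.carrier) :
    cs.length v ≤ cs.length L.longest := L.exists_longest.choose_spec.2 v hv

/-- Multiplying `w_L` by a reduced word of `v` must lower the length at every letter: an increase
would contradict either the reducedness of that word or the maximality of `w_L`. -/
theorem length_mul_longest {v : W} (hv : v ∈ parabolic cs L.carrier) :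
    cs.length (v * L.longest) + cs.length v = cs.length L.longest := by
  obtain ⟨ω, hω, hr, rfl⟩ := exists_isReduced_of_mem_parabolic hv
  clear hv
  induction ω with
  | nil => simp
  | cons s ω ih =>
    have hr1 : cs.length _ = _ := cs.isReduced_cons hr
    have hr2 : cs.length _ = _ := hr
    have ih := ih (fun t ht => hω t (by simp [ht])) (cs.isReduced_cons hr)
    have hmem : cs.wordProd ω ∈ parabolic cs L.carrier :=
      wordProd_mem_parabolic fun t ht => hω t (by simp [ht])
    have hs : cs.simple s ∈ parabolic cs L.carrier := simple_mem_parabolic (hω s (by simp))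
    rw [cs.wordProd_cons, List.length_cons] at hr2
    rw [cs.wordProd_cons, hr2, mul_assoc]
    rcases cs.length_simple_mul (cs.wordProd ω * L.longest) s with hl | hl
    swap
    · omega
    exfalso
    obtain ⟨ν, hν, hνe⟩ := cs.exists_isReduced (cs.wordProd ω * L.longest)
    have hν' : cs.length _ = _ := hν
    -- The reflection `t = ω⁻¹ s ω` lies in `W_L`, so by maximality it is a left inversion of `w_L =
    -- ω⁻¹ ν`. Deleting a letter from `ω⁻¹` gives `ℓ(s ω) < ℓ(ω)`; deleting one from `ν` gives `ℓ(s
    -- ω w_L) < ℓ(ω w_L)`. Both are excluded.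
    set t := (cs.wordProd ω)⁻¹ * cs.simple s * (cs.wordProd ω)⁻¹⁻¹ with ht
    have htr : cs.IsReflection t := ⟨(cs.wordProd ω)⁻¹, s, rfl⟩
    have hw : L.longest = cs.wordProd (ω.reverse ++ ν) := by
      rw [cs.wordProd_append, cs.wordProd_reverse, ← hνe]; group
    have htm : t * L.longest ∈ parabolic cs L.carrier := by
      refine mul_mem ?_ L.longest_mem
      exact mul_mem (mul_mem (inv_mem hmem) hs) (inv_mem (inv_mem hmem))
    have hinv : cs.IsLeftInversion (cs.wordProd (ω.reverse ++ ν)) t := by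
      rw [← hw]
      exact ⟨htr, lt_of_le_of_ne (L.length_le_longest htm) (htr.length_mul_right_ne _)⟩
    obtain ⟨j, hj, he⟩ := cs.exists_eraseIdx_of_isLeftInversion hinv
    rw [List.length_append, List.length_reverse] at hj
    rcases lt_or_ge j ω.length with hjn | hjn
    · rw [List.eraseIdx_append_of_lt_length (by simpa using hjn), cs.wordProd_append,
        cs.wordProd_append, ← mul_assoc, mul_left_inj, cs.wordProd_reverse, ht] at he
      have h1 := cs.length_wordProd_le (ω.reverse.eraseIdx j)
      rw [List.length_eraseIdx, List.length_reverse, if_pos hjn, ← he, ← cs.length_inv] at h1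
      have : ((cs.wordProd ω)⁻¹ * cs.simple s * (cs.wordProd ω)⁻¹⁻¹ * (cs.wordProd ω)⁻¹)⁻¹
          = cs.simple s * cs.wordProd ω := by simp [mul_assoc]
      rw [this] at h1
      omega
    · rw [List.eraseIdx_append_of_length_le (by simpa using hjn), cs.wordProd_append,
        List.length_reverse, cs.wordProd_append, cs.wordProd_reverse, ht] at he
      have : cs.simple s * (cs.wordProd ω * L.longest)
          = cs.wordProd (ν.eraseIdx (j - ω.length)) := by
        rw [hνe, ← mul_right_inj (cs.wordProd ω)⁻¹, ← he]
        simp [mul_assoc]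
      have h1 := cs.length_wordProd_le (ν.eraseIdx (j - ω.length))
      rw [List.length_eraseIdx, if_pos (by omega), ← this] at h1
      rw [← hνe] at hν'
      omega

theorem eq_longest {v : W} (hv : v ∈ parabolic cs L.carrier)
    (h : cs.length L.longest ≤ cs.length v) : v = L.longest := by
  have h1 := L.length_mul_longest (mul_mem hv (inv_mem L.longest_mem))
  rw [inv_mul_cancel_right] at h1
  have h2 : cs.length (v * L.longest⁻¹) = 0 := by omega
  rwa [cs.length_eq_zero_iff, mul_inv_eq_one] at h2

@[simp] theorem inv_longest : L.longest⁻¹ = L.longest :=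
  L.eq_longest (inv_mem L.longest_mem) (by rw [cs.length_inv])

theorem length_longest_mul {v : W} (hv : v ∈ parabolic cs L.carrier) :
    cs.length (L.longest * v) + cs.length v = cs.length L.longest := by
  have h := L.length_mul_longest (inv_mem hv)
  rwa [cs.length_inv, ← cs.length_inv, mul_inv_rev, inv_inv, inv_longest] at h

end Finitary

end SingularSoergel

namespace SingularSoergel

open CoxeterSystem

variable {S W : Type*} [Group W] {M : CoxeterMatrix S} {cs : CoxeterSystem M W}
  {k V : Type*} [Field k] [AddCommGroup V] [Module k V]

/-- A linear form not vanishing at `v` extends to an algebra homomorphism `Sym(V) → k`. -/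
theorem ι_ne_zero {v : V} (hv : v ≠ 0) : SymmetricAlgebra.ι k V v ≠ 0 := by
  intro h
  refine hv ((Module.forall_dual_apply_eq_zero_iff k v).mp fun φ => ?_)
  have := congrArg (SymmetricAlgebra.lift φ) h
  simpa using this

namespace Realization

variable (ρ : Realization cs k V)

/-! ## Demazure operators -/

theorem act_one (f : SymmetricAlgebra k V) : ρ.act 1 f = f := by
  have : ρ.act 1 = AlgHom.id k _ := by
    apply SymmetricAlgebra.algHom_ext
    ext v
    simp [act]
  rw [this, AlgHom.id_apply]

theorem act_mul (u v : W) (f : SymmetricAlgebra k V) : ρ.act (u * v) f = ρ.act u (ρ.act v f) := by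
  have : ρ.act (u * v) = (ρ.act u).comp (ρ.act v) := by
    apply SymmetricAlgebra.algHom_ext
    ext v
    simp [act]
  rw [this, AlgHom.comp_apply]

theorem act_ι (w : W) (v : V) :
    ρ.act w (SymmetricAlgebra.ι k V v) = SymmetricAlgebra.ι k V (ρ.rep w v) := by
  simp [act]

theorem rep_simple (s : S) (v : V) : ρ.rep (cs.simple s) v = v - ρ.coroot s v • ρ.root s := by
  simp [rep]

variable {ρ}

theorem IsAdmissible.root_ne_zero (hρ : ρ.IsAdmissible) (s : S) : ρ.root s ≠ 0 := by
  intro h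
  have h1 : ρ.rep (cs.simple s) = ρ.rep 1 := by
    ext v
    rw [rep_simple, h, smul_zero, sub_zero, map_one, Module.End.one_apply]
  have h2 := congrArg cs.length (hρ.faithful h1)
  simp at h2

variable (ρ)

theorem root_mul_demazure (s : S) (f : SymmetricAlgebra k V) :
    SymmetricAlgebra.ι k V (ρ.root s) * ρ.demazure s f = f - ρ.act (cs.simple s) f :=
  (ρ.root_dvd s f).choose_spec.symm

theorem act_simple_root (s : S) : ρ.act (cs.simple s) (SymmetricAlgebra.ι k V (ρ.root s))
    = -SymmetricAlgebra.ι k V (ρ.root s) := by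
  rw [act_simple_ι, coroot_root, two_smul, sub_add_cancel_left, map_neg]

theorem act_simple_act_simple (s : S) (f : SymmetricAlgebra k V) :
    ρ.act (cs.simple s) (ρ.act (cs.simple s) f) = f := by
  rw [← act_mul, cs.simple_mul_simple_self, act_one]

variable {ρ} (hρ : ρ.IsAdmissible)
include hρ

/-- `Sym(V)` is a domain and `α_s ≠ 0`, so the quotient is unique; this turns the arbitrary choice
in the definition of `∂_s` into a computable operator. -/
theorem demazure_eq_of_mul_eq {s : S} {f g : SymmetricAlgebra k V}
    (h : SymmetricAlgebra.ι k V (ρ.root s) * g = f - ρ.act (cs.simple s) f) :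
    ρ.demazure s f = g :=
  mul_left_cancel₀ (ι_ne_zero (hρ.root_ne_zero s)) ((ρ.root_mul_demazure s f).trans h.symm)

theorem demazure_add (s : S) (f g : SymmetricAlgebra k V) :
    ρ.demazure s (f + g) = ρ.demazure s f + ρ.demazure s g := by
  apply demazure_eq_of_mul_eq hρ
  rw [mul_add, root_mul_demazure, root_mul_demazure, map_add]
  ring

theorem demazure_eq_zero_iff (s : S) (f : SymmetricAlgebra k V) :
    ρ.demazure s f = 0 ↔ ρ.act (cs.simple s) f = f := by
  constructor
  · intro h
    have := ρ.root_mul_demazure s f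
    rw [h, mul_zero, eq_comm, sub_eq_zero] at this
    exact this.symm
  · intro h
    apply demazure_eq_of_mul_eq hρ
    rw [h, mul_zero, sub_self]

/-- The twisted Leibniz rule. -/
theorem demazure_mul (s : S) (f g : SymmetricAlgebra k V) :
    ρ.demazure s (f * g) = ρ.demazure s f * g + ρ.act (cs.simple s) f * ρ.demazure s g := by
  apply demazure_eq_of_mul_eq hρ
  have h1 := ρ.root_mul_demazure s f
  have h2 := ρ.root_mul_demazure s g
  rw [map_mul]
  linear_combination g * h1 + ρ.act (cs.simple s) f * h2

theorem demazure_mul_of_act_eq {s : S} {f : SymmetricAlgebra k V}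
    (hf : ρ.act (cs.simple s) f = f) (g : SymmetricAlgebra k V) :
    ρ.demazure s (f * g) = f * ρ.demazure s g := by
  rw [demazure_mul hρ, (demazure_eq_zero_iff hρ s f).mpr hf, hf, zero_mul, zero_add]

theorem demazure_algebraMap (s : S) (r : k) : ρ.demazure s (algebraMap k _ r) = 0 := by
  rw [demazure_eq_zero_iff hρ, AlgHom.commutes]

theorem demazure_ι (s : S) (v : V) :
    ρ.demazure s (SymmetricAlgebra.ι k V v) = algebraMap k _ (ρ.coroot s v) := by
  apply demazure_eq_of_mul_eq hρ
  rw [act_simple_ι, map_sub, sub_sub_cancel, map_smul, Algebra.smul_def, mul_comm]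

/-- Both `f - s(f)` and `α_s` change sign under `s`, so their quotient is fixed. -/
theorem act_demazure (s : S) (f : SymmetricAlgebra k V) :
    ρ.act (cs.simple s) (ρ.demazure s f) = ρ.demazure s f := by
  apply mul_left_cancel₀ (ι_ne_zero (hρ.root_ne_zero s))
  have h1 := congrArg (ρ.act (cs.simple s)) (ρ.root_mul_demazure s f)
  rw [map_mul, act_simple_root, map_sub, act_simple_act_simple] at h1
  have h2 := ρ.root_mul_demazure s f
  linear_combination -h1 - h2

theorem demazure_demazure (s : S) (f : SymmetricAlgebra k V) :
    ρ.demazure s (ρ.demazure s f) = 0 :=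
  (demazure_eq_zero_iff hρ _ _).mpr (act_demazure hρ s f)

omit hρ in
theorem demazureWord_nil (f : SymmetricAlgebra k V) : ρ.demazureWord [] f = f := rfl

omit hρ in
theorem demazureWord_cons (s : S) (ω : List S) (f : SymmetricAlgebra k V) :
    ρ.demazureWord (s :: ω) f = ρ.demazure s (ρ.demazureWord ω f) := rfl

omit hρ in
theorem demazureWord_append (ω ν : List S) (f : SymmetricAlgebra k V) :
    ρ.demazureWord (ω ++ ν) f = ρ.demazureWord ω (ρ.demazureWord ν f) := by
  simp [demazureWord]

theorem demazureWord_add (ω : List S) (f g : SymmetricAlgebra k V) :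
    ρ.demazureWord ω (f + g) = ρ.demazureWord ω f + ρ.demazureWord ω g := by
  induction ω with
  | nil => rfl
  | cons s ω ih => simp only [demazureWord_cons, ih, demazure_add hρ]

theorem demazureWord_mul_of_act_eq {ω : List S} {f : SymmetricAlgebra k V}
    (hf : ∀ s ∈ ω, ρ.act (cs.simple s) f = f) (g : SymmetricAlgebra k V) :
    ρ.demazureWord ω (f * g) = f * ρ.demazureWord ω g := by
  induction ω with
  | nil => rfl
  | cons s ω ih =>
    simp only [demazureWord_cons, ih fun t ht => hf t (by simp [ht]),
      demazure_mul_of_act_eq hρ (hf s (by simp))]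

theorem demazureWord_zero (ω : List S) : ρ.demazureWord ω 0 = 0 := by
  simpa using demazureWord_mul_of_act_eq hρ (ω := ω) (f := 0) (by simp) 0

/-! ### The braid relations -/

omit hρ in
/-- The `n`-th letter of `i j i j ⋯`. -/
def altLetter : S → S → ℕ → S
  | i, _, 0 => i
  | i, j, n + 1 => altLetter j i n

omit hρ in
theorem altLetter_add_two (i j : S) (n : ℕ) : altLetter i j (n + 2) = altLetter i j n := rfl

omit hρ in
-- The pairing obeys the same two-step recursion as the two-coloured quantum numbers. At `n = m - 1`
-- the coefficients become `[m] = 0` and `[m - 1] = 1`, leaving a single coroot.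
theorem coroot_rep_altWord (i j : S) (v : V) (n : ℕ) :
    ρ.coroot i (ρ.rep (cs.wordProd (altWord j i n)) v)
      = qnum (n + 1) (-ρ.coroot i (ρ.root j)) (-ρ.coroot j (ρ.root i))
          * ρ.coroot (altLetter i j n) v
        + qnum n (-ρ.coroot i (ρ.root j)) (-ρ.coroot j (ρ.root i))
          * ρ.coroot (altLetter j i n) v := by
  induction n using Nat.strong_induction_on generalizing i j with
  | _ n ih =>
    match n with
    | 0 => simp [altWord, qnum, altLetter]
    | 1 => simp [altWord, qnum, altLetter, rep_simple]; ring
    | n + 2 =>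
      have e1 : ρ.coroot i (ρ.rep (cs.wordProd (altWord j i (n + 2))) v)
          = -ρ.coroot i (ρ.root j) * ρ.coroot j (ρ.rep (cs.wordProd (altWord i j (n + 1))) v)
            - ρ.coroot i (ρ.rep (cs.wordProd (altWord j i n)) v) := by
        simp only [altWord, cs.wordProd_cons, map_mul, Module.End.mul_apply, rep_simple, map_sub,
          map_smul, smul_eq_mul, coroot_root]
        ring
      rw [e1, ih n (by omega), ih (n + 1) (by omega)]
      have q1 : ∀ x y : k, qnum (n + 2 + 1) x y = x * qnum (n + 2) y x - qnum (n + 1) x y :=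
        fun _ _ => rfl
      have q2 : ∀ x y : k, qnum (n + 2) x y = x * qnum (n + 1) y x - qnum n x y :=
        fun _ _ => rfl
      rw [q1, q2 (-ρ.coroot i (ρ.root j)), altLetter_add_two, altLetter_add_two]
      simp only [altLetter]
      ring

/-- In the Leibniz expansion each correction term omits one letter of the alternating word. Omitting
an interior letter creates two equal neighbours, and `∂_s ∂_s = 0`, so only the terms omitting the
last or the first letter survive. -/
theorem demazureWord_altWord_ι_mul (i j : S) (n : ℕ) (v : V) (f : SymmetricAlgebra k V) :
    ρ.demazureWord (altWord i j (n + 2)) (SymmetricAlgebra.ι k V v * f)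
      = SymmetricAlgebra.ι k V (ρ.rep (cs.wordProd (altWord i j (n + 2))) v)
          * ρ.demazureWord (altWord i j (n + 2)) f
        + algebraMap k _ (ρ.coroot (altLetter i j (n + 1)) v)
          * ρ.demazureWord (altWord i j (n + 1)) f
        + algebraMap k _ (ρ.coroot i (ρ.rep (cs.wordProd (altWord j i (n + 1))) v))
          * ρ.demazureWord (altWord j i (n + 1)) f := by
  have hc : ∀ (s : S) (r : k) (g : SymmetricAlgebra k V),
      ρ.demazure s (algebraMap k _ r * g) = algebraMap k _ r * ρ.demazure s g :=
    fun s r g => demazure_mul_of_act_eq hρ (AlgHom.commutes _ _) g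
  have hv : ∀ (s : S) (u : V) (g : SymmetricAlgebra k V),
      ρ.demazure s (SymmetricAlgebra.ι k V u * g) = algebraMap k _ (ρ.coroot s u) * g
        + SymmetricAlgebra.ι k V (ρ.rep (cs.simple s) u) * ρ.demazure s g :=
    fun s u g => by rw [demazure_mul hρ, demazure_ι hρ, act_ι]
  induction n generalizing i j with
  | zero =>
    simp only [altWord, demazureWord_cons, cs.wordProd_cons, hv, hc, demazure_add hρ, map_mul,
      Module.End.mul_apply, altLetter, demazureWord_nil, cs.wordProd_nil, map_one,
      Module.End.one_apply]
    ring
  | succ n ih =>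
    rw [altWord, demazureWord_cons, ih j i, demazure_add hρ, demazure_add hρ, hv, hc, hc,
      cs.wordProd_cons, map_mul, Module.End.mul_apply]
    have : ρ.demazure i (ρ.demazureWord (altWord i j (n + 1)) f) = 0 := by
      rw [altWord, demazureWord_cons, demazure_demazure hρ]
    rw [this]
    simp only [altWord, demazureWord_cons, altLetter]
    ring

theorem demazureWord_altWord_one (i j : S) (n : ℕ) : ρ.demazureWord (altWord i j (n + 1)) 1 = 0 := by
  induction n generalizing i j with
  | zero =>
    rw [altWord, demazureWord_cons, altWord, demazureWord_nil]
    simpa using demazure_algebraMap hρ i 1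
  | succ n ih =>
    rw [altWord, demazureWord_cons, ih]
    simpa using demazure_algebraMap hρ i 0

theorem demazureWord_braid {i j : S} (hij : i ≠ j) (hM : M i j ≠ 0) (f : SymmetricAlgebra k V) :
    ρ.demazureWord (altWord i j (M i j)) f = ρ.demazureWord (altWord j i (M i j)) f := by
  have hM1 : M i j ≠ 1 := M.off_diagonal i j hij
  have hw := cs.wordProd_altWord_comm i j
  have t1 := ρ.technical i j hij hM
  have t2 := ρ.technical j i hij.symm (by rwa [M.symmetric])
  have b1 := hρ.balanced i j hij hM
  have b2 := hρ.balanced j i hij.symm (by rwa [M.symmetric])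
  rw [M.symmetric j i] at t2 b2
  obtain ⟨n, hn⟩ : ∃ n, M i j = n + 2 := ⟨M i j - 2, by omega⟩
  rw [hn] at hw t1 t2 b1 b2 ⊢
  simp only [Nat.add_succ_sub_one] at b1 b2
  -- The set of `f` for which agreement at `g` implies agreement at `f g`, for all `g`, is a
  -- subalgebra; it contains `V`, because there the two boundary terms are merely exchanged by `i ↔
  -- j`. One then starts at `g = 1`, which both operators kill.
  have key : ∀ f g : SymmetricAlgebra k V,
      ρ.demazureWord (altWord i j (n + 2)) g = ρ.demazureWord (altWord j i (n + 2)) g →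
      ρ.demazureWord (altWord i j (n + 2)) (f * g)
        = ρ.demazureWord (altWord j i (n + 2)) (f * g) := by
    intro f
    induction f using SymmetricAlgebra.induction with
    | algebraMap r =>
      intro g hg
      rw [demazureWord_mul_of_act_eq hρ (fun _ _ => AlgHom.commutes _ _),
        demazureWord_mul_of_act_eq hρ (fun _ _ => AlgHom.commutes _ _), hg]
    | ι v =>
      intro g hg
      rw [demazureWord_altWord_ι_mul hρ, demazureWord_altWord_ι_mul hρ, hg, hw,
        coroot_rep_altWord, coroot_rep_altWord, t1, t2, b1, b2]
      simp only [altLetter]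
      ring_nf
    | mul a b ha hb =>
      intro g hg
      rw [mul_assoc]
      exact ha _ (hb _ hg)
    | add a b ha hb =>
      intro g hg
      rw [add_mul, demazureWord_add hρ, demazureWord_add hρ, ha _ hg, hb _ hg]
  have := key f 1 (by rw [demazureWord_altWord_one hρ, demazureWord_altWord_one hρ])
  rwa [mul_one] at this

/-! ### The operators attached to group elements -/

/-- Matsumoto's theorem for the function `ω ↦ ∂_ω`: the reduced word chosen in the definition may be
replaced by any other. -/
theorem demazureOp_wordProd {ω : List S} (hω : cs.IsReduced ω) (f : SymmetricAlgebra k V) :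
    ρ.demazureOp (cs.wordProd ω) f = ρ.demazureWord ω f := by
  have h := (cs.exists_isReduced (cs.wordProd ω)).choose_spec
  refine congrFun (cs.eq_of_isReduced ρ.demazureWord ?_ ?_ h.1 hω h.2.symm) f
  · intro i ω ω' h
    funext g
    rw [demazureWord_cons, demazureWord_cons, h]
  · intro i j ν hij hM
    funext g
    rw [demazureWord_append, demazureWord_append, demazureWord_braid hρ hij hM]

theorem demazureOp_one (f : SymmetricAlgebra k V) : ρ.demazureOp 1 f = f := by
  have := demazureOp_wordProd hρ (ω := []) (by simp [CoxeterSystem.IsReduced]) f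
  simpa [demazureWord] using this

theorem demazureOp_add (w : W) (f g : SymmetricAlgebra k V) :
    ρ.demazureOp w (f + g) = ρ.demazureOp w f + ρ.demazureOp w g := demazureWord_add hρ _ f g

theorem demazureOp_zero (w : W) : ρ.demazureOp w 0 = 0 := demazureWord_zero hρ _

theorem demazureOp_mul_eq {u v : W} (h : cs.length (u * v) = cs.length u + cs.length v)
    (f : SymmetricAlgebra k V) : ρ.demazureOp (u * v) f = ρ.demazureOp u (ρ.demazureOp v f) := by
  obtain ⟨ω, hω, rfl⟩ := cs.exists_isReduced u
  obtain ⟨ν, hν, rfl⟩ := cs.exists_isReduced v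
  rw [demazureOp_wordProd hρ hω, demazureOp_wordProd hρ hν, ← demazureWord_append,
    ← cs.wordProd_append, demazureOp_wordProd hρ]
  rw [CoxeterSystem.IsReduced, cs.wordProd_append, h, hω, hν, List.length_append]

theorem demazureOp_simple (s : S) (f : SymmetricAlgebra k V) :
    ρ.demazureOp (cs.simple s) f = ρ.demazure s f := by
  have := demazureOp_wordProd hρ (ω := [s]) (by simp [CoxeterSystem.IsReduced]) f
  simpa [demazureWord] using this

theorem demazureOp_simple_mul {s : S} {w : W} (h : ¬cs.IsLeftDescent w s)
    (f : SymmetricAlgebra k V) :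
    ρ.demazureOp (cs.simple s * w) f = ρ.demazure s (ρ.demazureOp w f) := by
  rw [demazureOp_mul_eq hρ, demazureOp_simple hρ]
  rw [cs.not_isLeftDescent_iff.mp h, cs.length_simple, add_comm]

theorem demazureOp_mul_simple {s : S} {w : W} (h : ¬cs.IsRightDescent w s)
    (f : SymmetricAlgebra k V) :
    ρ.demazureOp (w * cs.simple s) f = ρ.demazureOp w (ρ.demazure s f) := by
  rw [demazureOp_mul_eq hρ, demazureOp_simple hρ]
  rw [cs.not_isRightDescent_iff.mp h, cs.length_simple]

theorem demazure_demazureOp_of_isLeftDescent {s : S} {w : W} (h : cs.IsLeftDescent w s)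
    (f : SymmetricAlgebra k V) : ρ.demazure s (ρ.demazureOp w f) = 0 := by
  have h1 := demazureOp_simple_mul hρ (cs.isLeftDescent_iff_not_isLeftDescent_mul.mp h) f
  rw [cs.simple_mul_simple_cancel_left] at h1
  rw [h1, demazure_demazure hρ]

/-- The nil-Coxeter relation. Letters at the end of `u` are moved onto `v` while they lengthen it;
since lengths fail to add, some letter meets a left descent and `∂_s ∂_v = 0`. -/
theorem demazureOp_demazureOp_of_ne {u v : W} (h : cs.length (u * v) ≠ cs.length u + cs.length v)
    (f : SymmetricAlgebra k V) : ρ.demazureOp u (ρ.demazureOp v f) = 0 := by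
  obtain ⟨ω, hω, rfl⟩ := cs.exists_isReduced u
  induction ω using List.reverseRecOn generalizing v with
  | nil => simp at h
  | append_singleton ω s ih =>
    have hr : cs.IsReduced ω := by simpa using hω.take ω.length
    have e : cs.wordProd (ω ++ [s]) = cs.wordProd ω * cs.simple s := by
      rw [cs.wordProd_append, cs.wordProd_singleton]
    have hd : ¬cs.IsRightDescent (cs.wordProd ω) s := by
      rw [cs.not_isRightDescent_iff, ← e, hω, hr]; simp
    rw [e] at h
    rw [e, demazureOp_mul_simple hρ hd]
    by_cases hs : cs.IsLeftDescent v s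
    · rw [demazure_demazureOp_of_isLeftDescent hρ hs, demazureOp_zero hρ]
    · rw [← demazureOp_simple_mul hρ hs]
      refine ih hr ?_
      rw [← mul_assoc, cs.not_isLeftDescent_iff.mp hs]
      rw [cs.not_isRightDescent_iff.mp hd] at h
      omega

theorem mem_inv_iff {I : Finitary cs} {f : SymmetricAlgebra k V} :
    f ∈ ρ.inv I ↔ ∀ s ∈ I.carrier, ρ.demazure s f = 0 := by
  simp only [demazure_eq_zero_iff hρ]
  constructor
  · exact fun h s hs => h _ (simple_mem_parabolic hs)
  · intro h w hw
    obtain ⟨ω, hω, -, rfl⟩ := exists_isReduced_of_mem_parabolic hw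
    clear hw
    induction ω with
    | nil => rw [cs.wordProd_nil, act_one]
    | cons s ω ih =>
      rw [cs.wordProd_cons, act_mul, ih fun t ht => hω t (by simp [ht]), h s (hω s (by simp))]

theorem demazureOp_mul_of_mem_inv {I : Finitary cs} {w : W} (hw : w ∈ parabolic cs I.carrier)
    {f : SymmetricAlgebra k V} (hf : f ∈ ρ.inv I) (g : SymmetricAlgebra k V) :
    ρ.demazureOp w (f * g) = f * ρ.demazureOp w g := by
  obtain ⟨ω, hω, hr, rfl⟩ := exists_isReduced_of_mem_parabolic hw
  rw [demazureOp_wordProd hρ hr, demazureOp_wordProd hρ hr]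
  exact demazureWord_mul_of_act_eq hρ (fun s hs => hf _ (simple_mem_parabolic (hω s hs))) g

theorem demazureOp_eq_zero_of_mem_inv {I : Finitary cs} {w : W} {s : S} (hs : s ∈ I.carrier)
    (hw : cs.IsRightDescent w s) {f : SymmetricAlgebra k V} (hf : f ∈ ρ.inv I) :
    ρ.demazureOp w f = 0 := by
  have h1 := demazureOp_mul_simple hρ (cs.isRightDescent_iff_not_isRightDescent_mul.mp hw) f
  rw [cs.simple_mul_simple_cancel_right] at h1
  rw [h1, (mem_inv_iff hρ).mp hf s hs, demazureOp_zero hρ]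

omit hρ in
theorem isLeftDescent_longest_mul {L : Finitary cs} {s : S} (hs : s ∈ L.carrier) :
    cs.IsLeftDescent L.longest s := by
  have := L.length_mul_longest (simple_mem_parabolic hs)
  rw [cs.length_simple] at this
  rw [CoxeterSystem.IsLeftDescent]
  omega

omit hρ in
theorem isRightDescent_longest {L : Finitary cs} {s : S} (hs : s ∈ L.carrier) :
    cs.IsRightDescent L.longest s := by
  have := L.length_longest_mul (simple_mem_parabolic hs)
  rw [cs.length_simple] at this
  rw [CoxeterSystem.IsRightDescent]
  omega

theorem demazureOp_longest_mem (L : Finitary cs) (f : SymmetricAlgebra k V) :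
    ρ.demazureOp L.longest f ∈ ρ.inv L :=
  (mem_inv_iff hρ).mpr fun _ hs =>
    demazure_demazureOp_of_isLeftDescent hρ (isLeftDescent_longest_mul hs) f

/-- `∂_{w_L}` factors as `∂_{w_L s} ∂_s`, and `∂_s` sends both `∂_s(f) g` and `f ∂_s(g)` to `∂_s(f)
∂_s(g)`. -/
theorem demazureOp_longest_demazure_mul {L : Finitary cs} {s : S} (hs : s ∈ L.carrier)
    (f g : SymmetricAlgebra k V) :
    ρ.demazureOp L.longest (ρ.demazure s f * g) = ρ.demazureOp L.longest (f * ρ.demazure s g) := by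
  have h : ∀ x, ρ.demazureOp L.longest x
      = ρ.demazureOp (L.longest * cs.simple s) (ρ.demazure s x) := by
    intro x
    have h1 := demazureOp_mul_simple hρ
      (cs.isRightDescent_iff_not_isRightDescent_mul.mp (isRightDescent_longest hs)) x
    rwa [cs.simple_mul_simple_cancel_right] at h1
  rw [h, h (f * _), demazure_mul_of_act_eq hρ (act_demazure hρ s f), mul_comm f,
    demazure_mul_of_act_eq hρ (act_demazure hρ s g), mul_comm]

/-- Adjointness of `∂_w` and `∂_{w⁻¹}` for the trace form of `R` over `R^L`. -/
theorem demazureOp_longest_demazureOp_mul {L : Finitary cs} {w : W}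
    (hw : w ∈ parabolic cs L.carrier) (f g : SymmetricAlgebra k V) :
    ρ.demazureOp L.longest (ρ.demazureOp w f * g)
      = ρ.demazureOp L.longest (f * ρ.demazureOp w⁻¹ g) := by
  obtain ⟨ω, hω, hr, rfl⟩ := exists_isReduced_of_mem_parabolic hw
  rw [← cs.wordProd_reverse, demazureOp_wordProd hρ hr, demazureOp_wordProd hρ hr.reverse]
  clear hw hr
  induction ω generalizing g with
  | nil => rfl
  | cons s ω ih =>
    rw [demazureWord_cons, demazureOp_longest_demazure_mul hρ (hω s (by simp)),
      ih _ fun t ht => hω t (by simp [ht]), List.reverse_cons, demazureWord_append]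
    rfl

end Realization

end SingularSoergel

namespace SingularSoergel

/-! ## Coproduct elements from dual families -/

section DualFamilies

variable {A B N X : Type*} [CommRing A] [CommRing B] [Algebra A B] [AddCommGroup N] [Module A N]
  [Fintype X] [DecidableEq X]

/-- The inverse of the Gram matrix corrects `e` to the family dual to `b`. -/
theorem exists_dual_family (T : B →ₗ[A] A) (b e : X → B)
    (h : IsUnit (Matrix.of fun x y => T (b x * e y)).det) :
    ∃ d : X → B, ∀ x y, T (b x * d y) = if x = y then 1 else 0 := by
  set H : Matrix X X A := Matrix.of fun x y => T (b x * e y) with hH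
  refine ⟨fun y => ∑ z, H⁻¹ z y • e z, fun x y => ?_⟩
  have h1 : H * H⁻¹ = 1 := Matrix.mul_nonsing_inv _ h
  have h2 := congrFun (congrFun h1 x) y
  rw [Matrix.mul_apply, Matrix.one_apply] at h2
  rw [← h2, Finset.mul_sum, map_sum]
  refine Finset.sum_congr rfl fun z _ => ?_
  rw [mul_smul_comm, map_smul, smul_eq_mul, mul_comm]
  rfl

/-- Duality alone gives linear independence. Spanning comes from nondegeneracy: the difference
between `f` and its expected expansion pairs to zero with every `b x`. -/
theorem isCoproduct_of_dual_families (T : B →ₗ[A] A) (b d : X → B)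
    (hbd : ∀ x y, T (b x * d y) = if x = y then 1 else 0)
    (hb : ∀ f, (∀ x, T (b x * f) = 0) → f = 0) :
    IsCoproduct T (∑ x, b x ⊗ₜ[A] d x) := by
  have hdb : ∀ x y, T (d x * b y) = if x = y then 1 else 0 := fun x y => by
    rw [mul_comm, hbd]; simp only [eq_comm]
  have hd : ∀ f, f = ∑ x, T (b x * f) • d x := by
    intro f
    rw [← sub_eq_zero]
    refine hb _ fun y => ?_
    rw [mul_sub, map_sub, Finset.mul_sum, map_sum]
    simp [hbd]
  have hb' : ∀ f, f = ∑ x, T (d x * f) • b x := by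
    intro f
    rw [← sub_eq_zero]
    refine hb _ fun y => ?_
    rw [hd (b y), Finset.sum_mul, map_sum]
    refine Finset.sum_eq_zero fun z _ => ?_
    rw [smul_mul_assoc, map_smul, mul_sub, map_sub, Finset.mul_sum, map_sum]
    simp [hdb]
  have hli : ∀ u v : X → B, (∀ x y, T (u x * v y) = if x = y then 1 else 0) →
      LinearIndependent A u := by
    intro u v huv
    refine Fintype.linearIndependent_iff.mpr fun g hg y => ?_
    have := congrArg (fun f => T (f * v y)) hg
    simpa [Finset.sum_mul, smul_mul_assoc, huv] using this
  have hspan : ∀ (u : X → B) (c : B → X → A), (∀ f, f = ∑ x, c f x • u x) →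
      ⊤ ≤ Submodule.span A (Set.range u) := by
    intro u c hc f _
    rw [hc f]
    exact Submodule.sum_mem _ fun x _ => Submodule.smul_mem _ _ (Submodule.subset_span ⟨x, rfl⟩)
  let σ := Fintype.equivFin X
  refine ⟨Fintype.card X, (Module.Basis.mk (hli b d hbd) (hspan b _ hb')).reindex σ,
    (Module.Basis.mk (hli d b hdb) (hspan d _ hd)).reindex σ, fun i j => ?_, ?_⟩
  · simp [hbd]
  · rw [← Equiv.sum_comp σ]
    simp

/-- If `T` admits a coproduct element, then `T` is nondegenerate on `B ⊗[A] N`. -/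
theorem eq_of_traceLin_eq {T : B →ₗ[A] A} {Δ : B ⊗[A] B} (hΔ : IsCoproduct T Δ)
    {y y' : B ⊗[A] N} (h : ∀ b : B, traceLin N T (b • y) = traceLin N T (b • y')) : y = y' := by
  obtain ⟨n, c, d, hcd, -⟩ := hΔ
  have hd : ∀ f : B, f = ∑ i, T (c i * f) • d i := by
    intro f
    have hf := d.sum_repr f
    have hT : ∀ i, T (c i * f) = d.repr f i := fun i => by
      conv_lhs => rw [← hf, Finset.mul_sum]
      simp [hcd]
    simp only [hT, hf]
  -- Any tensor is recovered from traces of its multiples by a dual basis.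
  have key : ∀ z : B ⊗[A] N, z = ∑ i, d i ⊗ₜ[A] traceLin N T (c i • z) := by
    intro z
    induction z using TensorProduct.induction_on with
    | zero => simp
    | tmul b x =>
      simp only [TensorProduct.smul_tmul', smul_eq_mul, traceLin, TensorProduct.lift.tmul,
        LinearMap.comp_apply, LinearMap.lsmul_apply, ← TensorProduct.smul_tmul]
      rw [← TensorProduct.sum_tmul, ← hd]
    | add u v hu hv =>
      simp only [smul_add, map_add, TensorProduct.tmul_add, Finset.sum_add_distrib]
      rw [← hu, ← hv]
  rw [key y, key y']
  simp only [h]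

/-- Together with nondegeneracy this characterizes `Δ`, hence its independence of the dual bases in
`coproduct_eq`. -/
theorem traceLin_smul_isCoproduct {T : B →ₗ[A] A} {Δ : B ⊗[A] B} (hΔ : IsCoproduct T Δ) (f : B) :
    traceLin B T (f • Δ) = f := by
  obtain ⟨n, c, d, hcd, rfl⟩ := hΔ
  rw [Finset.smul_sum, map_sum]
  have hf := d.sum_repr f
  have hT : ∀ i, T (f * c i) = d.repr f i := fun i => by
    conv_lhs => rw [← hf, Finset.sum_mul]
    have : ∀ j, T (d j * c i) = if i = j then 1 else 0 := fun j => by rw [mul_comm, hcd]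
    simp [this]
  conv_rhs => rw [← hf]
  simp [TensorProduct.smul_tmul', traceLin, hT]

theorem coproduct_eq {T : B →ₗ[A] A} {Δ : B ⊗[A] B} (hΔ : IsCoproduct T Δ) : coproduct T = Δ := by
  have h : ∃ Δ, IsCoproduct T Δ := ⟨Δ, hΔ⟩
  have h1 : coproduct T = h.choose := dif_pos h
  rw [h1]
  refine eq_of_traceLin_eq hΔ fun b => ?_
  rw [traceLin_smul_isCoproduct h.choose_spec, traceLin_smul_isCoproduct hΔ]

end DualFamilies

variable {S W : Type*} [Group W] {M : CoxeterMatrix S} {cs : CoxeterSystem M W}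
  {k V : Type*} [Field k] [AddCommGroup V] [Module k V]

theorem Finitary.length_longest_mul_inv {I J : Finitary cs} (h : I.carrier ⊆ J.carrier) :
    cs.length (J.longest * I.longest⁻¹) + cs.length I.longest = cs.length J.longest := by
  rw [I.inv_longest]
  exact J.length_longest_mul (parabolic_mono h I.longest_mem)

theorem Finitary.longest_mul_inv_mem {I J : Finitary cs} (h : I.carrier ⊆ J.carrier) :
    J.longest * I.longest⁻¹ ∈ parabolic cs J.carrier :=
  mul_mem J.longest_mem (inv_mem (parabolic_mono h I.longest_mem))

namespace Realization

variable {ρ : Realization cs k V} (hρ : ρ.IsAdmissible)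
include hρ

/-! ## The trace maps -/

theorem demazureOp_longest_mul_inv {I J : Finitary cs} (h : I.carrier ⊆ J.carrier)
    (f : SymmetricAlgebra k V) :
    ρ.demazureOp (J.longest * I.longest⁻¹) (ρ.demazureOp I.longest f)
      = ρ.demazureOp J.longest f := by
  have h1 := demazureOp_mul_eq hρ (u := J.longest * I.longest⁻¹) (v := I.longest)
    (by rw [inv_mul_cancel_right, Finitary.length_longest_mul_inv h]) f
  rw [← h1, inv_mul_cancel_right]

theorem exists_demazureOp_longest_eq {I : Finitary cs} {f : SymmetricAlgebra k V}
    (hf : f ∈ ρ.inv I) : ∃ g, ρ.demazureOp I.longest g = f :=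
  hρ.demazure_surjective I f hf

/-- Generalized Demazure surjectivity writes `f` as `∂_{w_I} g`, and then the value is `∂_{w_J} g`,
which is invariant under `W_J`. -/
theorem demazureOp_longest_mul_inv_mem {I J : Finitary cs} (h : I.carrier ⊆ J.carrier)
    {f : SymmetricAlgebra k V} (hf : f ∈ ρ.inv I) :
    ρ.demazureOp (J.longest * I.longest⁻¹) f ∈ ρ.inv J := by
  obtain ⟨g, rfl⟩ := exists_demazureOp_longest_eq hρ hf
  rw [demazureOp_longest_mul_inv hρ h]
  exact demazureOp_longest_mem hρ J g

/-- The Demazure operator does restrict to an `R^J`-linear map `R^I → R^J`, so the default value `0`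
of `traceMap` never occurs. -/
theorem traceMap_apply {I J : Finitary cs} (h : Finitary.Cov I J) (f : ρ.inv I) :
    ((ρ.traceMap h : _ → _) f : SymmetricAlgebra k V)
      = ρ.demazureOp (J.longest * I.longest⁻¹) f := by
  have H : ∃ T : Bimod.LinForm (ρ.incl h), ∀ f : ρ.inv I,
      ((T : _ → _) f : SymmetricAlgebra k V) = ρ.demazureOp (J.longest * I.longest⁻¹) f :=
    letI := (ρ.incl h).toAlgebra
    ⟨{ toFun := fun f => ⟨_, demazureOp_longest_mul_inv_mem hρ h.subset f.2⟩
       map_add' := fun f g => Subtype.ext (demazureOp_add hρ _ _ _)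
       map_smul' := fun a f => Subtype.ext
        (demazureOp_mul_of_mem_inv hρ (Finitary.longest_mul_inv_mem h.subset) a.2 _) },
      fun f => rfl⟩
  rw [traceMap, dif_pos H]
  exact H.choose_spec f

/-! ## The Frobenius structure of `R^I` over `R^L` -/

omit hρ in
/-- Elements of `W_L` that are minimal in their coset `W_I x`. -/
def CosetRep (I L : Finitary cs) : Type _ :=
  {x : W // x ∈ parabolic cs L.carrier ∧ ∀ s ∈ I.carrier, ¬cs.IsLeftDescent x s}

omit hρ in
instance (I L : Finitary cs) : Finite (CosetRep I L) :=
  (L.finite.subset fun _ hx => hx.1 : {x : W | x ∈ parabolic cs L.carrier ∧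
    ∀ s ∈ I.carrier, ¬cs.IsLeftDescent x s}.Finite).to_subtype

variable {I L : Finitary cs} (P : SymmetricAlgebra k V)

/-- The family `∂_{w_I} ∂_x P` of elements of `R^I`. -/
def frobFamily (x : CosetRep I L) : ρ.inv I :=
  ⟨ρ.demazureOp I.longest (ρ.demazureOp x.1 P), demazureOp_longest_mem hρ _ _⟩

omit hρ in
theorem isLeftDescent_mul_longest {x : W} (hx : x ∈ parabolic cs L.carrier) {s : S}
    (hs : s ∈ L.carrier) (h : ¬cs.IsLeftDescent x s) : cs.IsLeftDescent (x * L.longest) s := by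
  have h1 := L.length_mul_longest hx
  have h2 := L.length_mul_longest (mul_mem (simple_mem_parabolic hs) hx)
  rw [cs.not_isLeftDescent_iff] at h
  rw [CoxeterSystem.IsLeftDescent, ← mul_assoc]
  omega

/-- The family `∂_{x w_L} P` of elements of `R^I`. -/
def coFrobFamily (hI : I.carrier ⊆ L.carrier) (x : CosetRep I L) : ρ.inv I :=
  ⟨ρ.demazureOp (x.1 * L.longest) P, (mem_inv_iff hρ).mpr fun s hs =>
    demazure_demazureOp_of_isLeftDescent hρ
      (isLeftDescent_mul_longest x.2.1 (hI hs) (x.2.2 s hs)) P⟩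

/-- The factor `f ∈ R^I` passes inside `∂_{w_I}`, the operators combine to `∂_{w_L}`, and
adjointness moves `∂_x` from `P` to `f` as `∂_{x⁻¹}`. -/
theorem traceMap_frobFamily_mul (h : Finitary.Cov I L) (x : CosetRep I L) (f : ρ.inv I) :
    ((ρ.traceMap h : _ → _) (frobFamily hρ P x * f) : SymmetricAlgebra k V)
      = ρ.demazureOp L.longest (P * ρ.demazureOp x.1⁻¹ f) := by
  rw [traceMap_apply hρ]
  have h1 : ((frobFamily hρ P x * f : ρ.inv I) : SymmetricAlgebra k V)
      = ρ.demazureOp I.longest (f * ρ.demazureOp x.1 P) := by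
    rw [demazureOp_mul_of_mem_inv hρ I.longest_mem f.2, mul_comm]
    rfl
  rw [h1, demazureOp_longest_mul_inv hρ h.subset, mul_comm,
    demazureOp_longest_demazureOp_mul hρ x.2.1]

open Classical in
-- The pairing is `∂_{w_L}(P ∂_{x⁻¹} ∂_{y w_L} P)`. If lengths do not add it vanishes. If they do,
-- `x⁻¹ y w_L` has length `ℓ(x) + ℓ(w_L) - ℓ(y) ≥ ℓ(w_L)`, so it is `w_L`, whence `x = y` and the
-- value is `∂_{w_L} P = 1`.
theorem traceMap_frobFamily_mul_coFrobFamily (h : Finitary.Cov I L)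
    (hP : ρ.demazureOp L.longest P = 1) {x y : CosetRep I L}
    (hxy : cs.length y.1 ≤ cs.length x.1) :
    (ρ.traceMap h : _ → _) (frobFamily hρ P x * coFrobFamily hρ P h.subset y)
      = if x = y then 1 else 0 := by
  apply Subtype.ext
  rw [traceMap_frobFamily_mul]
  change ρ.demazureOp L.longest (P * ρ.demazureOp x.1⁻¹ (ρ.demazureOp (y.1 * L.longest) P)) = _
  have hy := L.length_mul_longest y.2.1
  by_cases hl : cs.length (x.1⁻¹ * (y.1 * L.longest))
      = cs.length x.1⁻¹ + cs.length (y.1 * L.longest)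
  · have hmem : x.1⁻¹ * (y.1 * L.longest) ∈ parabolic cs L.carrier :=
      mul_mem (inv_mem x.2.1) (mul_mem y.2.1 L.longest_mem)
    have he := L.eq_longest hmem (by rw [hl, cs.length_inv]; omega)
    have hxy : x = y := by
      apply Subtype.ext
      rw [← mul_assoc, mul_eq_right, inv_mul_eq_one] at he
      exact he
    rw [if_pos hxy, ← demazureOp_mul_eq hρ hl, he, hP, mul_one, hP]
    rfl
  · rw [demazureOp_demazureOp_of_ne hρ hl, mul_zero, demazureOp_zero hρ, if_neg]
    · rfl
    · rintro rfl
      apply hl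
      rw [inv_mul_cancel_left, cs.length_inv]
      omega

/-- Ordered by length of the representatives, the Gram matrix is block triangular with identity
diagonal blocks. -/
theorem isUnit_det_frobFamily (h : Finitary.Cov I L) (hP : ρ.demazureOp L.longest P = 1)
    [Fintype (CosetRep I L)] [DecidableEq (CosetRep I L)] :
    IsUnit (Matrix.of fun x y =>
      (ρ.traceMap h : _ → _) (frobFamily hρ P x * coFrobFamily hρ P h.subset y)).det := by
  set H := Matrix.of fun x y =>
      (ρ.traceMap h : _ → _) (frobFamily hρ P x * coFrobFamily hρ P h.subset y) with hH
  have hent : ∀ x y : CosetRep I L, cs.length y.1 ≤ cs.length x.1 →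
      H x y = if x = y then 1 else 0 := by
    intro x y hxy
    rw [hH, Matrix.of_apply, traceMap_frobFamily_mul_coFrobFamily hρ P h hP hxy]
    congr
  have htri : H.BlockTriangular fun x : CosetRep I L => cs.length x.1 := by
    intro x y hxy
    rw [hent x y hxy.le, if_neg]
    rintro rfl
    exact lt_irrefl _ hxy
  rw [htri.det, Finset.prod_eq_one]
  · exact isUnit_one
  · intro l _
    have : H.toSquareBlock (fun x : CosetRep I L => cs.length x.1) l = 1 := by
      ext1 x y
      rw [Matrix.toSquareBlock_def, Matrix.of_apply, hent _ _ (by rw [x.2, y.2]),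
        Matrix.one_apply]
      simp only [Subtype.ext_iff]
    rw [this, Matrix.det_one]

/-- Downward induction on `ℓ(x)`, with `n` bounding `ℓ(w_L) - ℓ(x)`. Once the longer representatives
are done, every `∂_s` with `s ∈ L` kills `∂_{x⁻¹} f`; so it lies in `R^L` and comes out of
`∂_{w_L}(P · -)` as the trace that vanishes by hypothesis. The case `x = 1` is nondegeneracy. -/
theorem demazureOp_inv_eq_zero (h : Finitary.Cov I L) (hP : ρ.demazureOp L.longest P = 1)
    (f : ρ.inv I) (hf : ∀ x : CosetRep I L, (ρ.traceMap h : _ → _) (frobFamily hρ P x * f) = 0)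
    (n : ℕ) (x : CosetRep I L) (hx : cs.length L.longest ≤ cs.length x.1 + n) :
    ρ.demazureOp x.1⁻¹ f = 0 := by
  induction n generalizing x with
  | zero =>
    have hmem : ρ.demazureOp x.1⁻¹ f ∈ ρ.inv L := by
      rw [L.eq_longest (inv_mem x.2.1) (by rw [cs.length_inv]; omega)]
      exact demazureOp_longest_mem hρ _ _
    have := congrArg Subtype.val (hf x)
    rw [traceMap_frobFamily_mul, mul_comm, demazureOp_mul_of_mem_inv hρ L.longest_mem hmem, hP,
      mul_one] at this
    exact this
  | succ n ih =>
    have hmem : ρ.demazureOp x.1⁻¹ f ∈ ρ.inv L := by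
      refine (mem_inv_iff hρ).mpr fun s hs => ?_
      by_cases hd : cs.IsLeftDescent x.1⁻¹ s
      · exact demazure_demazureOp_of_isLeftDescent hρ hd f
      rw [← demazureOp_simple_mul hρ hd]
      have hlen : cs.length (x.1 * cs.simple s) = cs.length x.1 + 1 := by
        rw [← cs.not_isRightDescent_iff, ← cs.isLeftDescent_inv_iff]
        exact hd
      have hinv : cs.simple s * x.1⁻¹ = (x.1 * cs.simple s)⁻¹ := by simp
      rw [hinv]
      have hxs : x.1 * cs.simple s ∈ parabolic cs L.carrier :=
        mul_mem x.2.1 (simple_mem_parabolic hs)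
      by_cases hX : ∀ t ∈ I.carrier, ¬cs.IsLeftDescent (x.1 * cs.simple s) t
      · exact ih ⟨_, hxs, hX⟩ (by simp only [hlen]; omega)
      · push Not at hX
        obtain ⟨t, ht, htd⟩ := hX
        -- When `x s` is not minimal in its coset, its inverse has a right descent in `I`, so its
        -- Demazure operator kills `R^I`.
        exact demazureOp_eq_zero_of_mem_inv hρ ht (cs.isRightDescent_inv_iff.mpr htd) f.2
    have := congrArg Subtype.val (hf x)
    rw [traceMap_frobFamily_mul, mul_comm, demazureOp_mul_of_mem_inv hρ L.longest_mem hmem, hP,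
      mul_one] at this
    exact this

theorem eq_zero_of_traceMap_frobFamily_mul (h : Finitary.Cov I L)
    (hP : ρ.demazureOp L.longest P = 1) (f : ρ.inv I)
    (hf : ∀ x : CosetRep I L, (ρ.traceMap h : _ → _) (frobFamily hρ P x * f) = 0) : f = 0 := by
  have := demazureOp_inv_eq_zero hρ P h hP f hf (cs.length L.longest)
    ⟨1, one_mem _, fun s _ => cs.not_isLeftDescent_one s⟩ (by simp)
  rw [inv_one, demazureOp_one hρ] at this
  exact Subtype.ext this

open Classical in
theorem exists_dual_frobFamily (h : Finitary.Cov I L) (hP : ρ.demazureOp L.longest P = 1) :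
    ∃ d : CosetRep I L → ρ.inv I, ∀ x y,
      (ρ.traceMap h : _ → _) (frobFamily hρ P x * d y) = if x = y then 1 else 0 := by
  let := (ρ.incl h).toAlgebra
  have := Fintype.ofFinite (CosetRep I L)
  exact exists_dual_family (ρ.traceMap h) (frobFamily hρ P) (coFrobFamily hρ P h.subset)
    (isUnit_det_frobFamily hρ P h hP)

end Realization

end SingularSoergel

namespace SingularSoergel

/-! ## The grading of the symmetric algebra -/

section SymDeg

variable {k V : Type*} [Field k] [AddCommGroup V] [Module k V]

theorem symDeg_two_mul (m : ℕ) :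
    symDeg k V (2 * m) = LinearMap.range (SymmetricAlgebra.ι k V) ^ m := by
  refine le_antisymm (iSup₂_le fun m' h => ?_) (le_iSup₂_of_le m rfl le_rfl)
  obtain rfl : m' = m := by omega
  exact le_rfl

theorem mem_symDeg_iff {n : ℤ} {f : SymmetricAlgebra k V} : f ∈ symDeg k V n ↔
    f = 0 ∨ ∃ m : ℕ, 2 * (m : ℤ) = n ∧ f ∈ LinearMap.range (SymmetricAlgebra.ι k V) ^ m := by
  constructor
  · intro h
    by_cases hn : ∃ m : ℕ, 2 * (m : ℤ) = n
    · obtain ⟨m, rfl⟩ := hn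
      rw [symDeg_two_mul] at h
      exact Or.inr ⟨m, rfl, h⟩
    · left
      have : symDeg k V n = ⊥ := by
        refine le_bot_iff.mp (iSup₂_le fun m' h => ?_)
        exact absurd ⟨m', h⟩ hn
      rwa [this, Submodule.mem_bot] at h
  · rintro (rfl | ⟨m, rfl, h⟩)
    · exact zero_mem _
    · rwa [symDeg_two_mul]

theorem algebraMap_mem_symDeg (r : k) : algebraMap k (SymmetricAlgebra k V) r ∈ symDeg k V 0 :=
  mem_symDeg_iff.mpr (Or.inr ⟨0, by simp, by
    rw [pow_zero]; exact Submodule.mem_one.mpr ⟨r, rfl⟩⟩)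

theorem one_mem_symDeg : (1 : SymmetricAlgebra k V) ∈ symDeg k V 0 := by
  simpa using algebraMap_mem_symDeg (V := V) (1 : k)

theorem ι_mem_symDeg (v : V) : SymmetricAlgebra.ι k V v ∈ symDeg k V 2 :=
  mem_symDeg_iff.mpr (Or.inr ⟨1, by simp, by rw [pow_one]; exact ⟨v, rfl⟩⟩)

theorem mul_mem_symDeg {a b : ℤ} {f g : SymmetricAlgebra k V} (hf : f ∈ symDeg k V a)
    (hg : g ∈ symDeg k V b) : f * g ∈ symDeg k V (a + b) := by
  rcases mem_symDeg_iff.mp hf with rfl | ⟨m, rfl, hf'⟩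
  · rw [zero_mul]; exact zero_mem _
  rcases mem_symDeg_iff.mp hg with rfl | ⟨n, rfl, hg'⟩
  · rw [mul_zero]; exact zero_mem _
  refine mem_symDeg_iff.mpr (Or.inr ⟨m + n, by push_cast; ring, ?_⟩)
  rw [pow_add]
  exact Submodule.mul_mem_mul hf' hg'

theorem mem_iSup_symDeg (f : SymmetricAlgebra k V) : f ∈ ⨆ n, symDeg k V n := by
  induction f using SymmetricAlgebra.induction with
  | algebraMap r => exact Submodule.mem_iSup_of_mem 0 (algebraMap_mem_symDeg r)
  | ι v => exact Submodule.mem_iSup_of_mem 2 (ι_mem_symDeg v)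
  | mul a b ha hb =>
    refine Submodule.iSup_induction (symDeg k V)
      (motive := fun a => a * b ∈ ⨆ n, symDeg k V n) ha (fun m x hx => ?_) ?_ ?_
    · refine Submodule.iSup_induction (symDeg k V)
        (motive := fun b => x * b ∈ ⨆ n, symDeg k V n) hb
        (fun n y hy => Submodule.mem_iSup_of_mem _ (mul_mem_symDeg hx hy)) ?_ ?_
      · rw [mul_zero]; exact zero_mem _
      · intro y z hy hz
        rw [mul_add]; exact add_mem hy hz
    · rw [zero_mul]; exact zero_mem _
    · intro y z hy hz
      rw [add_mul]; exact add_mem hy hz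
  | add a b ha hb => exact add_mem ha hb

/-- The homomorphism `v ↦ v X`, which records the degree. -/
def degHom (k V : Type*) [Field k] [AddCommGroup V] [Module k V] :
    SymmetricAlgebra k V →ₐ[k] Polynomial (SymmetricAlgebra k V) :=
  SymmetricAlgebra.lift
    (((Polynomial.monomial 1).restrictScalars k).comp (SymmetricAlgebra.ι k V))

theorem degHom_of_mem {m : ℕ} {f : SymmetricAlgebra k V}
    (hf : f ∈ LinearMap.range (SymmetricAlgebra.ι k V) ^ m) :
    degHom k V f = Polynomial.monomial m f := by
  induction hf using Submodule.pow_induction_on_left' with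
  | algebraMap r => rw [AlgHom.commutes]; rfl
  | add x y i _ _ hx hy => rw [map_add, map_add, hx, hy]
  | mem_mul m hm i x _ hx =>
    obtain ⟨v, rfl⟩ := hm
    rw [map_mul, hx]
    simp [degHom, Polynomial.monomial_mul_monomial, add_comm]

/-- The homogeneous component of degree `n`, where `deg V = 2`. -/
def homComp (n : ℤ) : SymmetricAlgebra k V →+ SymmetricAlgebra k V where
  -- The guard discards odd and negative `n`, for which `(n / 2).toNat` would pick out a wrong
  -- coefficient.
  toFun f := if 2 * ((n / 2).toNat : ℤ) = n then (degHom k V f).coeff (n / 2).toNat else 0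
  map_zero' := by simp
  map_add' f g := by split_ifs <;> simp

theorem homComp_of_mem {m : ℤ} {f : SymmetricAlgebra k V} (hf : f ∈ symDeg k V m) (n : ℤ) :
    homComp n f = if m = n then f else 0 := by
  rcases mem_symDeg_iff.mp hf with rfl | ⟨l, rfl, hf'⟩
  · simp
  · simp only [homComp, AddMonoidHom.coe_mk, ZeroHom.coe_mk, degHom_of_mem hf',
      Polynomial.coeff_monomial]
    split_ifs <;> first | rfl | omega

theorem addMonoidHom_ext_symDeg {A : Type*} [AddCommGroup A] {F G : SymmetricAlgebra k V →+ A}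
    (h : ∀ n, ∀ f ∈ symDeg k V n, F f = G f) (f : SymmetricAlgebra k V) : F f = G f := by
  refine Submodule.iSup_induction (symDeg k V) (motive := fun f => F f = G f) (mem_iSup_symDeg f)
    h ?_ ?_
  · rw [map_zero, map_zero]
  · intro x y hx hy
    rw [map_add, map_add, hx, hy]

theorem homComp_mem (n : ℤ) (f : SymmetricAlgebra k V) : homComp n f ∈ symDeg k V n := by
  refine Submodule.iSup_induction (symDeg k V) (motive := fun f => homComp n f ∈ symDeg k V n)
    (mem_iSup_symDeg f) ?_ ?_ ?_
  · intro m x hx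
    rw [homComp_of_mem hx]
    split_ifs with h
    · rwa [← h]
    · exact zero_mem _
  · rw [map_zero]; exact zero_mem _
  · intro x y hx hy
    rw [map_add]; exact add_mem hx hy

theorem map_homComp (F : SymmetricAlgebra k V →+ SymmetricAlgebra k V) (c : ℤ)
    (hF : ∀ n, ∀ f ∈ symDeg k V n, F f ∈ symDeg k V (n + c)) (n : ℤ) (f : SymmetricAlgebra k V) :
    F (homComp n f) = homComp (n + c) (F f) := by
  refine addMonoidHom_ext_symDeg (F := F.comp (homComp n)) (G := (homComp (n + c)).comp F) ?_ f
  intro m g hg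
  simp only [AddMonoidHom.comp_apply]
  rw [homComp_of_mem hg, homComp_of_mem (hF m g hg)]
  by_cases h : m = n
  · rw [if_pos h, if_pos (by omega)]
  · rw [if_neg h, if_neg (by omega), map_zero]

end SymDeg

variable {S W : Type*} [Group W] {M : CoxeterMatrix S} {cs : CoxeterSystem M W}
  {k V : Type*} [Field k] [AddCommGroup V] [Module k V]

/-! ### Homogeneity of Demazure operators, traces and dual families -/

namespace Realization

variable {ρ : Realization cs k V} (hρ : ρ.IsAdmissible)
include hρ

omit hρ in
theorem act_mem_symDeg (w : W) {n : ℤ} {f : SymmetricAlgebra k V} (hf : f ∈ symDeg k V n) :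
    ρ.act w f ∈ symDeg k V n := by
  rcases mem_symDeg_iff.mp hf with rfl | ⟨m, rfl, hf'⟩
  · rw [map_zero]; exact zero_mem _
  rw [symDeg_two_mul]
  have h1 : Submodule.map (ρ.act w).toLinearMap (LinearMap.range (SymmetricAlgebra.ι k V))
      ≤ LinearMap.range (SymmetricAlgebra.ι k V) := by
    rintro _ ⟨_, ⟨v, rfl⟩, rfl⟩
    exact ⟨ρ.rep w v, (ρ.act_ι w v).symm⟩
  have h2 := pow_le_pow_left' h1 m
  rw [← Submodule.map_pow] at h2
  exact h2 ⟨f, hf', rfl⟩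

theorem demazure_mem_symDeg (s : S) {n : ℤ} {f : SymmetricAlgebra k V} (hf : f ∈ symDeg k V n) :
    ρ.demazure s f ∈ symDeg k V (n - 2) := by
  rcases mem_symDeg_iff.mp hf with rfl | ⟨m, rfl, hf'⟩
  · rw [show ρ.demazure s 0 = 0 by simpa using demazure_algebraMap hρ s 0]
    exact zero_mem _
  clear hf
  induction hf' using Submodule.pow_induction_on_left' with
  | algebraMap r => rw [demazure_algebraMap hρ]; exact zero_mem _
  | add x y i _ _ hx hy => rw [demazure_add hρ]; exact add_mem hx hy
  | mem_mul m hm i x hx' hx =>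
    obtain ⟨v, rfl⟩ := hm
    rw [demazure_mul hρ, demazure_ι hρ, act_ι]
    have hx' : x ∈ symDeg k V (2 * i) := by rwa [symDeg_two_mul]
    refine add_mem ?_ ?_
    · convert mul_mem_symDeg (algebraMap_mem_symDeg _) hx' using 2
      push_cast; ring
    · convert mul_mem_symDeg (ι_mem_symDeg _) hx using 2
      push_cast; ring

theorem demazureOp_mem_symDeg (w : W) {n : ℤ} {f : SymmetricAlgebra k V}
    (hf : f ∈ symDeg k V n) : ρ.demazureOp w f ∈ symDeg k V (n - 2 * cs.length w) := by
  obtain ⟨ω, hω, rfl⟩ := cs.exists_isReduced w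
  rw [demazureOp_wordProd hρ hω, hω]
  clear hω
  induction ω with
  | nil => simpa [demazureWord_nil] using hf
  | cons s ω ih =>
    rw [demazureWord_cons]
    convert demazure_mem_symDeg hρ s ih using 2
    push_cast [List.length_cons]; ring

theorem demazureOp_homComp (w : W) (n : ℤ) (f : SymmetricAlgebra k V) :
    ρ.demazureOp w (homComp n f) = homComp (n - 2 * cs.length w) (ρ.demazureOp w f) :=
  map_homComp ⟨⟨ρ.demazureOp w, demazureOp_zero hρ w⟩, demazureOp_add hρ w⟩ (-(2 * cs.length w))
    (fun _ _ hf => demazureOp_mem_symDeg hρ w hf) n f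

omit hρ in
theorem homComp_mem_inv {I : Finitary cs} {f : SymmetricAlgebra k V} (hf : f ∈ ρ.inv I) (n : ℤ) :
    homComp n f ∈ ρ.inv I := by
  intro w hw
  have := map_homComp (ρ.act w : SymmetricAlgebra k V →+ SymmetricAlgebra k V) 0
    (fun n f hf => by rw [add_zero]; exact act_mem_symDeg w hf) n f
  rw [add_zero] at this
  refine this.trans ?_
  congr 1
  exact hf w hw

/-- `∂_{w_L}` lowers degree by `2 ℓ(w_L)` and `1` has degree zero, so the component of degree `2
ℓ(w_L)` of any preimage of `1` is again a preimage. -/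
theorem exists_homogeneous_demazureOp_longest_eq_one (L : Finitary cs) :
    ∃ P ∈ symDeg k V (2 * L.len), ρ.demazureOp L.longest P = 1 := by
  obtain ⟨P, hP⟩ := hρ.demazure_surjective L 1 (one_mem _)
  refine ⟨homComp (2 * L.len) P, homComp_mem _ _, ?_⟩
  rw [demazureOp_homComp hρ, hP, homComp_of_mem one_mem_symDeg, if_pos]
  rw [Finitary.len, sub_self]

theorem traceMap_mem_symDeg {I L : Finitary cs} (h : Finitary.Cov I L) {n : ℤ} {f : ρ.inv I}
    (hf : (f : SymmetricAlgebra k V) ∈ symDeg k V n) :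
    ((ρ.traceMap h : _ → _) f : SymmetricAlgebra k V)
      ∈ symDeg k V (n - 2 * (L.len - I.len)) := by
  rw [traceMap_apply hρ]
  have h1 := Finitary.length_longest_mul_inv h.subset
  convert demazureOp_mem_symDeg hρ (L.longest * I.longest⁻¹) hf using 2
  rw [Finitary.len, Finitary.len]
  omega

open Classical in
/-- The extension `R^L ⊆ R^I` has homogeneous dual families. -/
theorem exists_homogeneous_dual_families {I L : Finitary cs} (h : Finitary.Cov I L) :
    ∃ (b d : CosetRep I L → ρ.inv I) (p : CosetRep I L → ℤ),
      (∀ x, (b x : SymmetricAlgebra k V) ∈ symDeg k V (p x)) ∧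
      (∀ x, (d x : SymmetricAlgebra k V) ∈ symDeg k V (2 * (L.len - I.len) - p x)) ∧
      (∀ x y, (ρ.traceMap h : _ → _) (b x * d y) = if x = y then 1 else 0) ∧
      ∀ f, (∀ x, (ρ.traceMap h : _ → _) (b x * f) = 0) → f = 0 := by
  obtain ⟨P, hPdeg, hP⟩ := exists_homogeneous_demazureOp_longest_eq_one hρ L
  obtain ⟨d, hd⟩ := exists_dual_frobFamily hρ P h hP
  -- The degree of `∂_{w_I} ∂_x P`, as `P` has degree `2 ℓ(w_L)`.
  let p : CosetRep I L → ℤ := fun x => 2 * L.len - 2 * cs.length x.1 - 2 * I.len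
  have hb : ∀ x, (frobFamily hρ P x : SymmetricAlgebra k V) ∈ symDeg k V (p x) := fun x =>
    demazureOp_mem_symDeg hρ _ (demazureOp_mem_symDeg hρ _ hPdeg)
  refine ⟨frobFamily hρ P, fun x => ⟨homComp (2 * (L.len - I.len) - p x) (d x),
    homComp_mem_inv (d x).2 _⟩, p, hb, fun x => homComp_mem _ _, fun x y => ?_,
    eq_zero_of_traceMap_frobFamily_mul hρ P h hP⟩
  have h1 := Finitary.length_longest_mul_inv h.subset
  set w := L.longest * I.longest⁻¹ with hw
  -- Replacing the dual family by its components of complementary degree keeps it dual: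
  -- multiplication by the homogeneous `b x` and the trace commute with taking components, and the
  -- pairings are `0` or `1`, the latter read off in degree zero.
  have h2 := map_homComp (AddMonoidHom.mulLeft (frobFamily hρ P x : SymmetricAlgebra k V)) (p x)
    (fun n f hf => by
      rw [add_comm]
      exact mul_mem_symDeg (hb x) hf) (2 * (L.len - I.len) - p y) (d y)
  simp only [AddMonoidHom.coe_mulLeft] at h2
  have h3 := congrArg Subtype.val (hd x y)
  rw [traceMap_apply hρ] at h3
  apply Subtype.ext
  rw [traceMap_apply hρ]
  change ρ.demazureOp w ((frobFamily hρ P x : SymmetricAlgebra k V) * homComp _ _) = _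
  rw [h2, demazureOp_homComp hρ]
  change homComp _ (ρ.demazureOp w
    ((frobFamily hρ P x * d y : ρ.inv I) : SymmetricAlgebra k V)) = _
  rw [h3]
  split_ifs with hxy
  · subst hxy
    change homComp _ (1 : SymmetricAlgebra k V) = 1
    rw [homComp_of_mem one_mem_symDeg, if_pos]
    rw [Finitary.len, Finitary.len]
    omega
  · change homComp _ (0 : SymmetricAlgebra k V) = 0
    rw [map_zero]

end Realization

end SingularSoergel

namespace SingularSoergel

universe w

/-! ## Bimodule maps on pure tensors -/

namespace Bimod

variable {A A' B C D : Type w} [CommRing A] [CommRing A'] [CommRing B] [CommRing C] [CommRing D]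

theorem ind_induction {f : A →+* B} {N : Bimod A C} {motive : (ind f N).carrier → Prop}
    (tmul : ∀ b n, motive (tmul f N b n)) (add : ∀ x y, motive x → motive y → motive (x + y))
    (x : (ind f N).carrier) : motive x := by
  let := f.toAlgebra
  change B ⊗[A] N.carrier at x
  induction x using TensorProduct.induction_on with
  | zero =>
    have := tmul 0 0
    rwa [show Bimod.tmul f N 0 0 = (0 : B ⊗[A] N.carrier) from TensorProduct.zero_tmul _ _] at this
  | tmul b n => exact tmul b n
  | add x y hx hy => exact add x y hx hy

theorem smul_tmul (f : A →+* B) (N : Bimod A C) (b' b : B) (n : N.carrier) :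
    b' • tmul f N b n = tmul f N (b' * b) n := rfl

theorem tmul_sum {X : Type*} (s : Finset X) (f : A →+* B) (N : Bimod A C) (b : B)
    (n : X → N.carrier) : tmul f N b (∑ x ∈ s, n x) = ∑ x ∈ s, tmul f N b (n x) := by
  let := f.toAlgebra
  exact TensorProduct.tmul_sum b s n

namespace Hom

theorem ind_tmul (f : A →+* B) {M N : Bimod A C} (φ : Hom M N) (b : B) (n : M.carrier) :
    (ind f φ).toLin (tmul f M b n) = tmul f N b (φ.toLin n) := rfl

/-- The map `b ⊗ n ↦ T(b) n`, as a homomorphism of abelian groups. -/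
def traceAdd (f : A →+* B) (T : LinForm f) (N : Bimod A C) : (Bimod.ind f N).carrier →+ N.carrier :=
  (trace f T N).toLin.toAddMonoidHom

theorem traceAdd_tmul (f : A →+* B) (T : LinForm f) (N : Bimod A C) (b : B) (n : N.carrier) :
    traceAdd f T N (tmul f N b n) = (T : _ → _) b • n := by
  let := f.toAlgebra
  exact TensorProduct.lift.tmul (R := A) (f' := LinearMap.lsmul A N.carrier ∘ₗ T) b n

theorem traceAdd_ind (f : A →+* B) (T : LinForm f) {M N : Bimod A C} (φ : Hom M N)
    (x : (Bimod.ind f M).carrier) :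
    traceAdd f T N ((ind f φ).toLin x) = φ.toLin (traceAdd f T M x) := by
  induction x using ind_induction with
  | tmul b n => rw [ind_tmul, traceAdd_tmul, traceAdd_tmul, map_smul]
  | add x y hx hy => simp only [map_add, hx, hy]

theorem mult_tmul (f : A →+* B) (N : Bimod B C) (b : B) (n : N.carrier) :
    (mult f N).toLin (tmul f (Bimod.res f N) b (toRes f N n)) = b • n := by
  let := f.toAlgebra
  let : Module A N.carrier := Module.compHom N.carrier f
  have : IsScalarTower A B N.carrier := ⟨fun a b x => mul_smul (f a) b x⟩
  exact LinearMap.liftBaseChange_tmul B _ _ _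

theorem cross_tmul (g : D →+* A) (f : A →+* B) (g' : D →+* A') (f' : A' →+* B)
    (h : f.comp g = f'.comp g') (N : Bimod D C) (b : B) (a : A) (n : N.carrier) :
    (cross g f g' f' h N).toLin (tmul f _ b (tmul g N a n))
      = tmul f' _ (b * f a) (tmul g' N 1 n) := by
  let := f.toAlgebra
  let := g.toAlgebra
  let := f'.toAlgebra
  let := g'.toAlgebra
  let := (f.comp g).toAlgebra
  have : IsScalarTower D A B := IsScalarTower.of_algebraMap_eq fun _ => rfl
  have : IsScalarTower D A' B := IsScalarTower.of_algebraMap_eq fun d => DFunLike.congr_fun h d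
  change crossLin D A A' B N.carrier (b ⊗ₜ[A] (a ⊗ₜ[D] n)) = (b * f a) ⊗ₜ[A'] (1 ⊗ₜ[D] n)
  simp [crossLin, Algebra.smul_def, mul_comm]
  rfl

theorem coprod_apply (f : A →+* B) (T : LinForm f) (N : Bimod B C) {X : Type*} [Fintype X]
    (b d : X → B)
    (h : letI := f.toAlgebra; IsCoproduct T (∑ x, b x ⊗ₜ[A] d x)) (n : N.carrier) :
    (coprod f T N).toLin n = ∑ x, tmul f (Bimod.res f N) (b x) (toRes f N (d x • n)) := by
  let := f.toAlgebra
  let : Module A N.carrier := Module.compHom N.carrier f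
  have : IsScalarTower A B N.carrier := ⟨fun a b x => mul_smul (f a) b x⟩
  have h1 : (coprod f T N).toLin n = coproductLin N.carrier T n := rfl
  rw [h1]
  simp only [coproductLin, LinearMap.coe_mk, AddHom.coe_mk]
  rw [coproduct_eq h, map_sum]
  rfl

theorem eq_of_traceAdd_eq (f : A →+* B) (T : LinForm f) (N : Bimod A C)
    (h : letI := f.toAlgebra; ∃ Δ, IsCoproduct T Δ) {y y' : (Bimod.ind f N).carrier}
    (hy : ∀ b : B, traceAdd f T N (b • y) = traceAdd f T N (b • y')) : y = y' := by
  let := f.toAlgebra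
  obtain ⟨Δ, hΔ⟩ := h
  exact eq_of_traceLin_eq (N := N.carrier) hΔ hy

end Hom

end Bimod

variable {S W : Type*} [Group W] {M : CoxeterMatrix S} {cs : CoxeterSystem M W}
  {k V : Type*} [Field k] [AddCommGroup V] [Module k V]

open Finitary

/-! ### Homogeneous coproduct elements and transitivity of traces -/

namespace Realization

variable {ρ : Realization cs k V} (hρ : ρ.IsAdmissible)
include hρ

omit hρ in
instance (I L : Finitary cs) : Fintype (CosetRep I L) := Fintype.ofFinite _

/-- The coproduct element of `R^L ⊆ R^I`, and its homogeneity. -/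
theorem exists_homogeneous_coproduct {I L : Finitary cs} (h : Cov I L) :
    ∃ (b d : CosetRep I L → ρ.inv I) (p : CosetRep I L → ℤ),
      (∀ x, (b x : SymmetricAlgebra k V) ∈ symDeg k V (p x)) ∧
      (∀ x, (d x : SymmetricAlgebra k V) ∈ symDeg k V (2 * (L.len - I.len) - p x)) ∧
      (letI := (ρ.incl h).toAlgebra;
        IsCoproduct (ρ.traceMap h) (∑ x, b x ⊗ₜ[ρ.inv L] d x)) ∧
      ∀ f : ρ.inv I, ∑ x, ρ.incl h ((ρ.traceMap h : _ → _) (f * b x)) * d x = f := by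
  classical
  obtain ⟨b, d, p, hb, hd, hbd, h0⟩ := exists_homogeneous_dual_families hρ h
  let := (ρ.incl h).toAlgebra
  have hco := isCoproduct_of_dual_families (ρ.traceMap h) b d
    hbd h0
  refine ⟨b, d, p, hb, hd, hco, fun f => ?_⟩
  have := traceLin_smul_isCoproduct hco f
  rw [Finset.smul_sum, map_sum] at this
  simp only [TensorProduct.smul_tmul', traceLin, TensorProduct.lift.tmul, LinearMap.comp_apply,
    LinearMap.lsmul_apply, smul_eq_mul] at this
  exact this

theorem exists_isCoproduct_traceMap {I L : Finitary cs} (h : Cov I L) :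
    letI := (ρ.incl h).toAlgebra
    ∃ Δ, IsCoproduct (ρ.traceMap h) Δ := by
  obtain ⟨b, d, p, -, -, hco, -⟩ := exists_homogeneous_coproduct hρ h
  exact ⟨_, hco⟩

theorem traceMap_incl_mul {I L : Finitary cs} (h : Cov I L) (a : ρ.inv L) (f : ρ.inv I) :
    (ρ.traceMap h : _ → _) (ρ.incl h a * f) = a * (ρ.traceMap h : _ → _) f := by
  apply Subtype.ext
  rw [traceMap_apply hρ]
  change _ = (a : SymmetricAlgebra k V) * ((ρ.traceMap h : _ → _) f : SymmetricAlgebra k V)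
  rw [traceMap_apply hρ]
  exact demazureOp_mul_of_mem_inv hρ (longest_mul_inv_mem h.subset) a.2 _

/-- The right-hand side does not mention `J`, so the two ways of tracing around a square `I ⊂ J, J'
⊂ L` agree. -/
theorem traceMap_traceMap {I J L : Finitary cs} (h₁ : Cov I J) (h₂ : Cov J L) (f : ρ.inv I) :
    ((ρ.traceMap h₂ : _ → _) ((ρ.traceMap h₁ : _ → _) f) : SymmetricAlgebra k V)
      = ρ.demazureOp (L.longest * I.longest⁻¹) f := by
  rw [traceMap_apply hρ, traceMap_apply hρ]
  obtain ⟨g, hg⟩ := exists_demazureOp_longest_eq hρ f.2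
  rw [← hg, demazureOp_longest_mul_inv hρ h₁.subset, demazureOp_longest_mul_inv hρ h₂.subset,
    demazureOp_longest_mul_inv hρ (h₁.subset.trans h₂.subset)]

end Realization

namespace Diagram

variable {ρ : Realization cs k V}

/-! ## Crossings on tensors -/

section Crossings

variable {I J J' L K : Finitary cs} (h₁ : Cov I J) (h₂ : Cov J L) (h₃ : Cov I J') (h₄ : Cov J' L)
  (hne : J.carrier ≠ J'.carrier)

open SingularSoergel.Bimod

theorem rightCross_eval_tmul (e : Expression cs J' K) (n : (ρ.BS e).carrier) :
    (rightCross (ρ := ρ) h₁ h₂ h₃ h₄ hne e).eval.toLin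
        (tmul (ρ.incl h₂) _ 1 (toRes (ρ.incl h₄) _ n))
      = toRes (ρ.incl h₁) _ (tmul (ρ.incl h₃) (ρ.BS e) 1 n) := by
  change (Bimod.Hom.ind (ρ.incl h₃) (Bimod.Hom.mult (ρ.incl h₄) (ρ.BS e))).toLin
    ((Bimod.Hom.cross (ρ.incl h₂) (ρ.incl h₁) (ρ.incl h₄) (ρ.incl h₃)
        (ρ.incl_comp h₁ h₂ h₃ h₄) (Bimod.res (ρ.incl h₄) (ρ.BS e))).toLin
      (tmul (ρ.incl h₁) _ 1 (tmul (ρ.incl h₂) _ 1 (toRes (ρ.incl h₄) _ n))))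
    = tmul (ρ.incl h₃) (ρ.BS e) 1 n
  rw [Hom.cross_tmul, Hom.ind_tmul, Hom.mult_tmul, one_smul, map_one, one_mul]

theorem downCross_eval (e : Expression cs I K) (x : (ρ.BS e).carrier) :
    (downCross (ρ := ρ) h₁ h₂ h₃ h₄ hne e).eval.toLin
        (toRes (ρ.incl h₂) _ (toRes (ρ.incl h₁) _ x))
      = toRes (ρ.incl h₄) _ (toRes (ρ.incl h₃) (ρ.BS e) x) := by
  change (Bimod.Hom.mult (ρ.incl h₁) (ρ.BS e)).toLin
    ((Bimod.Hom.ind (ρ.incl h₁) (Bimod.Hom.mult (ρ.incl h₂) (Bimod.res (ρ.incl h₁) (ρ.BS e)))).toLin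
      ((Bimod.Hom.cross (ρ.incl h₄) (ρ.incl h₃) (ρ.incl h₂) (ρ.incl h₁)
        (ρ.incl_comp h₃ h₄ h₁ h₂) (Bimod.res (ρ.incl h₂) (Bimod.res (ρ.incl h₁) (ρ.BS e)))).toLin
        (tmul (ρ.incl h₃) _ 1 (tmul (ρ.incl h₄) _ 1
          (toRes (ρ.incl h₂) _ (toRes (ρ.incl h₁) _ x))))))
    = x
  rw [Hom.cross_tmul, Hom.ind_tmul, Hom.mult_tmul, one_smul, map_one, one_mul, Hom.mult_tmul,
    one_smul]

/-- On `a ⊗ n` the crossing followed by the trace gives the sum of `∂^J_L ∂^I_J(a b_y) d_y n`, where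
`∑ b_y ⊗ d_y` is the coproduct element of `R^L ⊆ R^{J'}`. Transitivity lets the trace go through
`J'` instead, where `b_y` is a scalar, and the dual basis identity collapses the sum to `∂^I_{J'}(a)
n`. -/
theorem traceAdd_leftCross_eval (hρ : ρ.IsAdmissible) (e : Expression cs J' K)
    (x : (Bimod.ind (ρ.incl h₃) (ρ.BS e)).carrier) :
    Hom.traceAdd (ρ.incl h₂) (ρ.traceMap h₂) (Bimod.res (ρ.incl h₄) (ρ.BS e))
        ((leftCross (ρ := ρ) h₁ h₂ h₃ h₄ hne e).eval.toLin x)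
      = toRes (ρ.incl h₄) _ (Hom.traceAdd (ρ.incl h₃) (ρ.traceMap h₃) (ρ.BS e) x) := by
  obtain ⟨b, d, -, -, -, hco, hbd⟩ := Realization.exists_homogeneous_coproduct hρ h₄
  change Hom.traceAdd (ρ.incl h₂) (ρ.traceMap h₂) (Bimod.res (ρ.incl h₄) (ρ.BS e))
    (Hom.traceAdd (ρ.incl h₁) (ρ.traceMap h₁) _
      ((Bimod.Hom.cross (ρ.incl h₄) (ρ.incl h₃) (ρ.incl h₂) (ρ.incl h₁)
        (ρ.incl_comp h₃ h₄ h₁ h₂) (Bimod.res (ρ.incl h₄) (ρ.BS e))).toLin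
        ((Bimod.Hom.ind (ρ.incl h₃)
          (Bimod.Hom.coprod (ρ.incl h₄) (ρ.traceMap h₄) (ρ.BS e))).toLin x))) = _
  induction x using ind_induction with
  | add x y hx hy =>
    simp only [map_add, hx, hy]
    rfl
  | tmul a n =>
    rw [Hom.ind_tmul, Hom.coprod_apply _ _ _ b d hco, tmul_sum, map_sum, map_sum, map_sum,
      Hom.traceAdd_tmul]
    simp only [Hom.cross_tmul, Hom.traceAdd_tmul, Bimod.smul_tmul]
    conv_rhs => rw [← hbd ((ρ.traceMap h₃ : _ → _) a), Finset.sum_smul]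
    refine Finset.sum_congr rfl fun y _ => ?_
    change ρ.incl h₄ _ • (d y • n) = _
    rw [smul_smul]
    congr 3
    apply Subtype.ext
    rw [mul_one, Realization.traceMap_traceMap hρ, ← Realization.traceMap_traceMap hρ h₃ h₄,
      mul_comm a, Realization.traceMap_incl_mul hρ, mul_comm]

end Crossings

end Diagram

end SingularSoergel

namespace SingularSoergel

variable {S W : Type*} [Group W] {M : CoxeterMatrix S} {cs : CoxeterSystem M W}
  {k V : Type*} [Field k] [AddCommGroup V] [Module k V]

open Finitary SingularSoergel.Bimod

namespace StepSeq

variable {L K : Finitary cs}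

/-! ## Switchback moves -/

/-- The product of `w_{L \ {u_i, u_{i+1}}}⁻¹ w_{L \ {u_{i+1}}}`. -/
def weight : {u x : S} → StepSeq L u x → W
  | u, x, pair _ _ _ => (L.hat₂ u x).longest⁻¹ * (L.hat x).longest
  | u, _, cons (v := v) _ _ _ r => (L.hat₂ u v).longest⁻¹ * (L.hat v).longest * r.weight

/-- The sum of `ℓ(L \ {u_{i+1}}) - ℓ(L \ {u_i, u_{i+1}})`. -/
def weightLen : {u x : S} → StepSeq L u x → ℤ
  | u, x, pair _ _ _ => (L.hat x).len - (L.hat₂ u x).len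
  | u, _, cons (v := v) _ _ _ r => (L.hat v).len - (L.hat₂ u v).len + r.weightLen

theorem upProd_long {u x : S} (r : StepSeq L u x) (e : Expression cs (L.hat x) K) :
    (r.long e).upProd = r.weight * e.upProd := by
  induction r with
  | pair hu hv hne => rfl
  | cons hu hv hne r ih => simp only [long, weight, Expression.upProd, ih, mul_assoc]

theorem upLen_long {u x : S} (r : StepSeq L u x) (e : Expression cs (L.hat x) K) :
    (r.long e).upLen = r.weightLen + e.upLen := by
  induction r with
  | pair hu hv hne => rfl
  | cons hu hv hne r ih => simp only [long, weightLen, Expression.upLen, ih, add_assoc]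

/-- Both expressions represent the same double coset, so their longest elements agree; the common
factor `w_{L \ u_0}` is cancelled. -/
theorem IsSwitchback.weight_eq {u x : S} {r : StepSeq L u x} (hr : r.IsSwitchback) :
    r.weight = (L.hat u).longest⁻¹ * L.longest := by
  have h := hr.2.2
  rw [Expression.elt, Expression.elt, upProd_long, mul_right_inj] at h
  simpa [Expression.upProd] using h.symm

theorem length_longest_inv_mul {I J : Finitary cs} (h : I.carrier ⊆ J.carrier) :
    (cs.length (I.longest⁻¹ * J.longest) : ℤ) = J.len - I.len := by
  have h1 := length_longest_mul_inv h
  rw [← cs.length_inv, mul_inv_rev, inv_inv, J.inv_longest] at h1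
  rw [I.inv_longest, len, len, ← h1]
  push_cast
  ring

theorem IsSwitchback.weightLen_eq {u x : S} {r : StepSeq L u x} (hr : r.IsSwitchback) :
    r.weightLen = L.len - (L.hat u).len := by
  have h : (cs.length _ : ℤ) = _ := hr.2.1
  rw [Expression.elt, upLen_long, upProd_long, hr.weight_eq] at h
  simp only [Expression.upProd, Expression.upLen, mul_one, add_zero, mul_inv_cancel_left] at h
  have h1 : L.len = cs.length L.longest := rfl
  linarith

/-- Subadditivity of length. If equality holds for the whole sequence it must hold for every tail,
which lets `iterTraceRing_eq` proceed by induction. -/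
theorem length_weight_le {u x : S} (r : StepSeq L u x) : cs.length r.weight ≤ r.weightLen := by
  induction r with
  | pair hu hv hne => exact (length_longest_inv_mul (hat₂_cov_right hu hne).subset).le
  | @cons u v x hu hv hne r ih =>
    have h1 := length_longest_inv_mul (hat₂_cov_right hu hne).subset
    have h2 := cs.length_mul_le ((L.hat₂ u v).longest⁻¹ * (L.hat v).longest) r.weight
    rw [weight, weightLen]
    omega

variable {ρ : Realization cs k V}

/-- The iterated trace `f ↦ ∂ (⋯ ∂ f)` along a sequence of steps. -/
def iterTraceRing (ρ : Realization cs k V) : {u x : S} → StepSeq L u x →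
    ρ.inv (L.hat u) → ρ.inv (L.hat x)
  | _, _, pair hu hv hne, f =>
      (ρ.traceMap (hat₂_cov_right hu hne) : _ → _) (ρ.incl (hat₂_cov_left hv hne) f)
  | _, _, cons hu hv hne r, f =>
      r.iterTraceRing ρ
        ((ρ.traceMap (hat₂_cov_right hu hne) : _ → _) (ρ.incl (hat₂_cov_left hv hne) f))

/-- When lengths add along the sequence, the Demazure operators of the steps compose to the operator
of the product. The steps are applied from left to right, hence the inverse. -/
theorem iterTraceRing_eq (hρ : ρ.IsAdmissible) {u x : S} (r : StepSeq L u x)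
    (hr : (cs.length r.weight : ℤ) = r.weightLen) (f : ρ.inv (L.hat u)) :
    (r.iterTraceRing ρ f : SymmetricAlgebra k V) = ρ.demazureOp r.weight⁻¹ f := by
  have hstep : ∀ {u v : S} (hu : u ∈ L.carrier) (hv : v ∈ L.carrier) (hne : u ≠ v)
      (f : ρ.inv (L.hat u)),
      ((ρ.traceMap (hat₂_cov_right hu hne) : _ → _) (ρ.incl (hat₂_cov_left hv hne) f) :
        SymmetricAlgebra k V)
        = ρ.demazureOp ((L.hat₂ u v).longest⁻¹ * (L.hat v).longest)⁻¹ f := by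
    intro u v hu hv hne f
    rw [Realization.traceMap_apply hρ, mul_inv_rev, inv_inv, inv_longest, inv_longest]
    rfl
  induction r with
  | pair hu hv hne => exact hstep hu hv hne f
  | @cons u v x hu hv hne r ih =>
    have h1 := length_longest_inv_mul (hat₂_cov_right hu hne).subset
    have h2 := cs.length_mul_le ((L.hat₂ u v).longest⁻¹ * (L.hat v).longest) r.weight
    have h3 := r.length_weight_le
    rw [weight, weightLen] at hr
    have h4 : (cs.length r.weight : ℤ) = r.weightLen := by omega
    rw [iterTraceRing, ih h4, hstep hu hv hne, weight, mul_inv_rev _ r.weight, Realization.demazureOp_mul_eq hρ]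
    rw [← mul_inv_rev, cs.length_inv, cs.length_inv, cs.length_inv]
    omega

/-- The iterated trace on Bott--Samelson bimodules along a sequence of steps. -/
def iterTrace (ρ : Realization cs k V) : {u x : S} → (r : StepSeq L u x) →
    (e : Expression cs (L.hat x) K) → (ρ.BS (r.long e)).carrier →+ (ρ.BS e).carrier
  | _, _, pair hu _ hne, e =>
      Hom.traceAdd (ρ.incl (hat₂_cov_right hu hne)) (ρ.traceMap _) (ρ.BS e)
  | _, _, cons hu _ hne r, e =>
      (r.iterTrace ρ e).comp
        (Hom.traceAdd (ρ.incl (hat₂_cov_right hu hne)) (ρ.traceMap _) (ρ.BS (r.long e)))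

theorem iterTrace_smul_oneTensor {u x : S} (r : StepSeq L u x) (e : Expression cs (L.hat x) K)
    (f : ρ.inv (L.hat u)) :
    r.iterTrace ρ e (f • ρ.oneTensor (r.long e)) = r.iterTraceRing ρ f • ρ.oneTensor e := by
  have hstep : ∀ {u v : S} (hu : u ∈ L.carrier) (hv : v ∈ L.carrier) (hne : u ≠ v)
      (f : ρ.inv (L.hat u)) (e : Expression cs (L.hat v) K),
      Hom.traceAdd (ρ.incl (hat₂_cov_right hu hne)) (ρ.traceMap _) (ρ.BS e)
        (ρ.incl (hat₂_cov_left hv hne) f • tmul _ (ρ.BS e) 1 (ρ.oneTensor e))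
      = (ρ.traceMap (hat₂_cov_right hu hne) : _ → _) (ρ.incl (hat₂_cov_left hv hne) f)
        • ρ.oneTensor e := by
    intro u v hu hv hne f e
    rw [Bimod.smul_tmul, mul_one, Hom.traceAdd_tmul]
  induction r with
  | pair hu hv hne => exact hstep hu hv hne f e
  | cons hu hv hne r ih =>
    refine Eq.trans ?_ (ih e _)
    exact congrArg (r.iterTrace ρ e) (hstep hu hv hne f (r.long e))

theorem traceAdd_contract_eval_pair (hρ : ρ.IsAdmissible) {u v : S} (hu : u ∈ L.carrier)
    (hv : v ∈ L.carrier) (hne : u ≠ v) (e : Expression cs (L.hat v) K)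
    (y : (Bimod.ind (ρ.incl (hat₂_cov_right hu hne)) (ρ.BS e)).carrier) :
    Hom.traceAdd (ρ.incl (hat_cov hu)) (ρ.traceMap _)
        (Bimod.res (ρ.incl (hat_cov hv)) (ρ.BS e))
        (((pair hu hv hne).contract ρ e).eval.toLin y)
      = toRes (ρ.incl (hat_cov hv)) (ρ.BS e) ((pair hu hv hne).iterTrace ρ e y) :=
  Diagram.traceAdd_leftCross_eval (ρ := ρ) (hat₂_cov_left hv hne) (hat_cov hu)
      (hat₂_cov_right hu hne) (hat_cov hv) (hat_carrier_ne hv hne) hρ e y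

/-- Naturality moves the outer trace past the last cap, the crossing turns it into the trace of the
first step, and naturality moves that one past the rest of the contraction. -/
theorem traceAdd_contract_eval_cons (hρ : ρ.IsAdmissible) {u v x : S} (hu : u ∈ L.carrier)
    (hv : v ∈ L.carrier) (hne : u ≠ v) (r : StepSeq L v x) (e : Expression cs (L.hat x) K)
    (y : (Bimod.ind (ρ.incl (hat₂_cov_right hu hne)) (ρ.BS (r.long e))).carrier) :
    Hom.traceAdd (ρ.incl (hat_cov hu)) (ρ.traceMap _)
        (Bimod.res (ρ.incl (hat_cov r.last_mem)) (ρ.BS e))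
        (((cons hu hv hne r).contract ρ e).eval.toLin y)
      = Hom.traceAdd (ρ.incl (hat_cov hv)) (ρ.traceMap _)
        (Bimod.res (ρ.incl (hat_cov r.last_mem)) (ρ.BS e))
        ((r.contract ρ e).eval.toLin
          (Hom.traceAdd (ρ.incl (hat₂_cov_right hu hne)) (ρ.traceMap _) (ρ.BS (r.long e)) y)) := by
  have h1 := Hom.traceAdd_ind (ρ.incl (hat_cov hu)) (ρ.traceMap _)
    (Hom.trace (ρ.incl (hat_cov hv)) (ρ.traceMap _)
      (Bimod.res (ρ.incl (hat_cov r.last_mem)) (ρ.BS e)))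
    ((Diagram.leftCross (ρ := ρ) (hat₂_cov_left hv hne) (hat_cov hu) (hat₂_cov_right hu hne)
      (hat_cov hv) (hat_carrier_ne hv hne) (r.short e)).eval.toLin
        ((Hom.ind (ρ.incl (hat₂_cov_right hu hne)) (r.contract ρ e).eval).toLin y))
  have h2 := Diagram.traceAdd_leftCross_eval (ρ := ρ) (hat₂_cov_left hv hne) (hat_cov hu)
      (hat₂_cov_right hu hne) (hat_cov hv) (hat_carrier_ne hv hne) hρ (r.short e)
        ((Hom.ind (ρ.incl (hat₂_cov_right hu hne)) (r.contract ρ e).eval).toLin y)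
  have h3 := Hom.traceAdd_ind (ρ.incl (hat₂_cov_right hu hne)) (ρ.traceMap _)
    (r.contract ρ e).eval y
  refine Eq.trans ?_ (h1.trans ((congrArg _ h2).trans (congrArg (Hom.trace (ρ.incl (hat_cov hv))
    (ρ.traceMap _) (Bimod.res (ρ.incl (hat_cov r.last_mem)) (ρ.BS e))).toLin h3)))
  rfl

theorem traceAdd_contract_eval (hρ : ρ.IsAdmissible) {u x : S} (r : StepSeq L u x)
    (e : Expression cs (L.hat x) K) (y : (ρ.BS (r.long e)).carrier) :
    Hom.traceAdd (ρ.incl (hat_cov r.fst_mem)) (ρ.traceMap _)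
        (Bimod.res (ρ.incl (hat_cov r.last_mem)) (ρ.BS e)) ((r.contract ρ e).eval.toLin y)
      = toRes (ρ.incl (hat_cov r.last_mem)) (ρ.BS e) (r.iterTrace ρ e y) := by
  induction r with
  | @pair u v hu hv hne =>
    exact traceAdd_contract_eval_pair hρ hu hv hne e y
  | cons hu hv hne r ih =>
    refine (traceAdd_contract_eval_cons hρ hu hv hne r e y).trans ?_
    exact ih e (Hom.traceAdd (ρ.incl (hat₂_cov_right hu hne)) (ρ.traceMap _) (ρ.BS (r.long e)) y)

/-- By nondegeneracy it is enough to compare traces of all multiples by `b`. The left side gives the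
iterated trace of `b`, the right side `∂_{w_L w_{L \ u_0}⁻¹} b`; the switchback condition makes them
equal. -/
theorem contract_eval_oneTensor (hρ : ρ.IsAdmissible) {u x : S} (r : StepSeq L u x)
    (hr : r.IsSwitchback) (e : Expression cs (L.hat x) K) :
    (r.contract ρ e).eval.toLin (ρ.oneTensor (r.long e)) = ρ.oneTensor (r.short e) := by
  refine Hom.eq_of_traceAdd_eq (ρ.incl (hat_cov r.fst_mem)) (ρ.traceMap _)
    (Bimod.res (ρ.incl (hat_cov r.last_mem)) (ρ.BS e))
    (Realization.exists_isCoproduct_traceMap hρ _) fun b => ?_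
  have h1 : b • (r.contract ρ e).eval.toLin (ρ.oneTensor (r.long e))
      = (r.contract ρ e).eval.toLin (b • ρ.oneTensor (r.long e)) := (map_smul _ _ _).symm
  refine (congrArg _ h1).trans ?_
  rw [traceAdd_contract_eval hρ, iterTrace_smul_oneTensor]
  have h2 := Hom.traceAdd_tmul (ρ.incl (hat_cov r.fst_mem)) (ρ.traceMap _)
    (Bimod.res (ρ.incl (hat_cov r.last_mem)) (ρ.BS e)) (b * 1) (ρ.oneTensor e)
  refine Eq.trans ?_ h2.symm
  rw [mul_one]
  refine congrArg (fun c : ρ.inv (L.hat x) => c • ρ.oneTensor e) (Subtype.ext ?_)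
  have h3 : (ρ.incl (hat_cov r.last_mem) ((ρ.traceMap (hat_cov r.fst_mem) : _ → _) b) :
      SymmetricAlgebra k V) = _ := Realization.traceMap_apply hρ (hat_cov r.fst_mem) b
  refine Eq.trans ?_ h3.symm
  rw [iterTraceRing_eq hρ]
  · rw [hr.weight_eq, mul_inv_rev, inv_inv, inv_longest, inv_longest]
  · rw [hr.weight_eq, hr.weightLen_eq, length_longest_inv_mul (hat_cov r.fst_mem).subset]

theorem expand_eval_oneTensor {u x : S} (r : StepSeq L u x) (e : Expression cs (L.hat x) K) :
    (r.expand ρ e).eval.toLin (ρ.oneTensor (r.short e)) = ρ.oneTensor (r.long e) := by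
  induction r with
  | pair hu hv hne =>
    exact Diagram.rightCross_eval_tmul (hat₂_cov_left hv hne) (hat_cov hu)
      (hat₂_cov_right hu hne) (hat_cov hv) (hat_carrier_ne hv hne) e (ρ.oneTensor e)
  | cons hu hv hne r ih =>
    refine (congrArg (Hom.ind (ρ.incl (hat₂_cov_right hu hne)) (r.expand ρ e).eval).toLin
      (Diagram.rightCross_eval_tmul (hat₂_cov_left hv hne) (hat_cov hu)
      (hat₂_cov_right hu hne) (hat_cov hv) (hat_carrier_ne hv hne) (r.short e)
        (ρ.oneTensor (r.short e)))).trans ?_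
    refine (Hom.ind_tmul (ρ.incl (hat₂_cov_right hu hne)) (r.expand ρ e).eval 1
      (ρ.oneTensor (r.short e))).trans ?_
    rw [ih]
    rfl

theorem degree_expand {u x : S} (r : StepSeq L u x) (e : Expression cs (L.hat x) K) :
    (r.expand ρ e).degree = L.len - (L.hat u).len - r.weightLen := by
  induction r with
  | pair hu hv hne => simp only [expand, Diagram.rightCross, Diagram.degree, weightLen]; ring
  | cons hu hv hne r ih =>
    simp only [expand, Diagram.rightCross, Diagram.degree, weightLen, ih]; ring

theorem degree_contract {u x : S} (r : StepSeq L u x) (e : Expression cs (L.hat x) K) :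
    (r.contract ρ e).degree = L.len - (L.hat u).len - r.weightLen := by
  induction r with
  | pair hu hv hne => simp only [contract, Diagram.leftCross, Diagram.degree, weightLen]; ring
  | cons hu hv hne r ih =>
    simp only [contract, Diagram.leftCross, Diagram.degree, weightLen, ih]; ring

end StepSeq

/-! ## Rex moves -/

variable {ρ : Realization cs k V} {I K : Finitary cs} {e e' : Expression cs I K}
  {D : Diagram ρ e e'}

theorem IsElementaryRexMove.eval_oneTensor (hρ : ρ.IsAdmissible) (hD : IsElementaryRexMove ρ D) :
    D.eval.toLin (ρ.oneTensor e) = ρ.oneTensor e' := by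
  induction hD with
  | upUp h₁ h₂ h₃ h₄ hne e =>
    refine (Hom.cross_tmul (ρ.incl h₂) (ρ.incl h₁) (ρ.incl h₄) (ρ.incl h₃)
      (ρ.incl_comp h₁ h₂ h₃ h₄) (ρ.BS e) 1 1 (ρ.oneTensor e)).trans ?_
    rw [map_one, one_mul]
    rfl
  | downDown h₁ h₂ h₃ h₄ hne e => exact Diagram.downCross_eval h₁ h₂ h₃ h₄ hne e _
  | expand r hr e => exact r.expand_eval_oneTensor e
  | contract r hr e => exact r.contract_eval_oneTensor hρ hr e
  | whiskerUp h D hD ih =>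
    refine (Hom.ind_tmul (ρ.incl h) D.eval 1 _).trans ?_
    rw [ih]
    rfl
  | whiskerDown h D hD ih => exact ih

theorem IsElementaryRexMove.degree_eq_zero (hD : IsElementaryRexMove ρ D) : D.degree = 0 := by
  induction hD with
  | upUp h₁ h₂ h₃ h₄ hne e => rfl
  | downDown h₁ h₂ h₃ h₄ hne e => simp only [Diagram.downCross, Diagram.degree]; ring
  | expand r hr e => rw [r.degree_expand, hr.weightLen_eq, sub_self]
  | contract r hr e => rw [r.degree_contract, hr.weightLen_eq, sub_self]
  | whiskerUp h D hD ih => exact ih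
  | whiskerDown h D hD ih => exact ih

theorem IsRexMove.eval_oneTensor (hρ : ρ.IsAdmissible) (hD : IsRexMove ρ D) :
    D.eval.toLin (ρ.oneTensor e) = ρ.oneTensor e' := by
  induction hD with
  | id => rfl
  | comp D D' hD hD' ih =>
    rw [← hD'.eval_oneTensor hρ, ← ih]
    rfl

theorem IsRexMove.degree_eq_zero (hD : IsRexMove ρ D) : D.degree = 0 := by
  induction hD with
  | id => rfl
  | comp D D' hD hD' ih => rw [Diagram.degree, ih, hD'.degree_eq_zero, add_zero]

end SingularSoergel

namespace SingularSoergel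

variable {S W : Type*} [Group W] {M : CoxeterMatrix S} {cs : CoxeterSystem M W}
  {k V : Type*} [Field k] [AddCommGroup V] [Module k V]

open Finitary SingularSoergel.Bimod

/-! ## Diagrams and gradings -/

namespace Realization

variable {ρ : Realization cs k V}

theorem tmul_mem_grading {I J K : Finitary cs} (h : Cov I J) (e : Expression cs J K) {a b n : ℤ}
    {f : ρ.inv I} {x : (ρ.BS e).carrier} (hf : (f : SymmetricAlgebra k V) ∈ symDeg k V a)
    (hx : x ∈ ρ.grading e b) (hn : a + b = n) :
    tmul (ρ.incl h) (ρ.BS e) f x ∈ ρ.grading (.up h e) n :=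
  AddSubgroup.subset_closure ⟨a, b, f, x, hf, hx, hn, rfl⟩

/-- The graded pieces of an induced bimodule are generated by pure tensors of homogeneous elements,
so an additive map need only be tested on these. -/
theorem map_mem_of_grading_up {I J K : Finitary cs} (h : Cov I J) (e : Expression cs J K) {n : ℤ}
    {G : Type*} [AddCommGroup G] (F : (Bimod.ind (ρ.incl h) (ρ.BS e)).carrier →+ G)
    (H : AddSubgroup G)
    (hF : ∀ (a b : ℤ) (f : ρ.inv I) (x : (ρ.BS e).carrier),
      (f : SymmetricAlgebra k V) ∈ symDeg k V a → x ∈ ρ.grading e b → a + b = n →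
        F (tmul (ρ.incl h) (ρ.BS e) f x) ∈ H)
    {x : (Bimod.ind (ρ.incl h) (ρ.BS e)).carrier} (hx : x ∈ ρ.grading (.up h e) n) : F x ∈ H := by
  have h1 : ρ.grading (.up h e) n ≤ H.comap F := by
    refine (AddSubgroup.closure_le _).mpr ?_
    rintro _ ⟨a, b, f, x, hf, hx, hn, rfl⟩
    exact hF a b f x hf hx hn
  exact h1 hx

theorem smul_mem_grading : {I K : Finitary cs} → (e : Expression cs I K) → {a b n : ℤ} →
    {f : ρ.inv I} → {x : (ρ.BS e).carrier} → (f : SymmetricAlgebra k V) ∈ symDeg k V a →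
    x ∈ ρ.grading e b → a + b = n → f • x ∈ ρ.grading e n
  | _, _, .nil I, _, _, _, f, x, hf, hx, hn => by
    subst hn
    exact mul_mem_symDeg (f := (f : SymmetricAlgebra k V)) (g := (id x : ρ.inv I).1) hf hx
  | _, _, .up h e, a, b, n, f, x, hf, hx, hn => by
    refine map_mem_of_grading_up (ρ := ρ) h e
      (DistribSMul.toAddMonoidHom (Bimod.ind (ρ.incl h) (ρ.BS e)).carrier f) _
      (fun a' b' g y hg hy hn' => ?_) hx
    exact tmul_mem_grading h e (mul_mem_symDeg hf hg) hy (by omega)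
  | _, _, .down (I := I) (J := J) h e, a, b, n, f, x, hf, hx, hn =>
    smul_mem_grading e (b := b + (I.len - J.len)) (f := ρ.incl h f) (x := x) hf hx (by omega)

end Realization

namespace Diagram

variable {ρ : Realization cs k V}

open Realization

theorem eval_mem_grading (hρ : ρ.IsAdmissible) {I K : Finitary cs} {e e' : Expression cs I K}
    (D : Diagram ρ e e') {n m : ℤ} {x : (ρ.BS e).carrier} (hx : x ∈ ρ.grading e n)
    (hm : n + D.degree = m) : D.eval.toLin x ∈ ρ.grading e' m := by
  induction D generalizing n m with
  | id e =>
    obtain rfl : n = m := by simpa [degree] using hm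
    exact hx
  | comp D D' ih ih' => exact ih' (ih hx rfl) (by rw [← hm, degree, add_assoc])
  | whiskerUp h D ih =>
    rename_i e e'
    refine map_mem_of_grading_up h e (Hom.ind (ρ.incl h) D.eval).toLin.toAddMonoidHom _
      (fun a b f y hf hy hab => ?_) hx
    refine tmul_mem_grading h e' hf (ih hy rfl) ?_
    rw [← hm, degree, ← hab, add_assoc]
  | whiskerDown h D ih => exact ih hx (by rw [← hm, degree]; ring)
  | box e d f hf => exact smul_mem_grading e hf hx (by rw [← hm, degree, add_comm])
  | @cwCap I J K h e =>
    refine map_mem_of_grading_up h (.down h e)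
      (Hom.mult (ρ.incl h) (ρ.BS e)).toLin.toAddMonoidHom _
      (fun a b f y hf hy hab => ?_) hx
    have h1 : f • (show (ρ.BS e).carrier from y) ∈ ρ.grading e m :=
      smul_mem_grading e hf hy (by rw [← hm, degree, ← hab]; ring)
    rw [← Hom.mult_tmul (ρ.incl h)] at h1
    exact h1
  | @cwCup I J K h e =>
    obtain ⟨b, d, p, hb, hd, hco, -⟩ := exists_homogeneous_coproduct hρ h
    have h1 := Hom.coprod_apply (ρ.incl h) (ρ.traceMap h) (ρ.BS e) b d hco x
    have h2 : ∑ y, tmul (ρ.incl h) (Bimod.res (ρ.incl h) (ρ.BS e)) (b y)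
        (toRes (ρ.incl h) _ (d y • x)) ∈ ρ.grading (.up h (.down h e)) m := by
      -- The factors `b y` and `d y` together have degree `2 (ℓ(J) - ℓ(I))`; the grading shift of
      -- the new down step takes away half of it.
      refine sum_mem fun y _ => tmul_mem_grading h (.down h e) (hb y)
        (b := m - p y) ?_ (by ring)
      refine smul_mem_grading e (hd y) hx ?_
      rw [← hm, degree]
      ring
    rw [← h1] at h2
    exact h2
  | @ccwCap I J K h e =>
    refine map_mem_of_grading_up h e (Hom.traceAdd (ρ.incl h) (ρ.traceMap h) (ρ.BS e)) _
      (fun a b f y hf hy hab => ?_) hx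
    rw [Hom.traceAdd_tmul]
    -- The trace lowers degree by `2 (ℓ(J) - ℓ(I))`, and removing the down step gives back its shift
    -- `ℓ(J) - ℓ(I)`.
    exact smul_mem_grading e (traceMap_mem_symDeg hρ h hf) hy
      (by rw [← hm, degree]; linarith)
  | @ccwCup I J K h e =>
    exact tmul_mem_grading h e one_mem_symDeg hx (by rw [← hm, degree]; ring)
  | @cross I J J' L K h₁ h₂ h₃ h₄ hne e =>
    refine map_mem_of_grading_up h₁ (.up h₂ e)
      (Hom.cross (ρ.incl h₂) (ρ.incl h₁) (ρ.incl h₄) (ρ.incl h₃)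
        (ρ.incl_comp h₁ h₂ h₃ h₄) (ρ.BS e)).toLin.toAddMonoidHom _
      (fun a b f y hf hy hab => ?_) hx
    -- With `f` fixed, the inner tensor factor enters additively, so it too can be reduced to
    -- homogeneous pure tensors.
    let F : (Bimod.ind (ρ.incl h₂) (ρ.BS e)).carrier →+
        (Bimod.ind (ρ.incl h₁) (Bimod.ind (ρ.incl h₂) (ρ.BS e))).carrier :=
      { toFun := tmul (ρ.incl h₁) (Bimod.ind (ρ.incl h₂) (ρ.BS e)) f
        map_zero' := by
          let := (ρ.incl h₁).toAlgebra
          exact TensorProduct.tmul_zero _ f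
        map_add' := by
          let := (ρ.incl h₁).toAlgebra
          exact TensorProduct.tmul_add f }
    refine map_mem_of_grading_up h₂ e
      ((Hom.cross (ρ.incl h₂) (ρ.incl h₁) (ρ.incl h₄) (ρ.incl h₃)
        (ρ.incl_comp h₁ h₂ h₃ h₄) (ρ.BS e)).toLin.toAddMonoidHom.comp F) _
      (fun a' b' g z hg hz hab' => ?_) hy
    have h5 := Hom.cross_tmul (ρ.incl h₂) (ρ.incl h₁) (ρ.incl h₄) (ρ.incl h₃)
        (ρ.incl_comp h₁ h₂ h₃ h₄) (ρ.BS e) f g z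
    have h6 : tmul (ρ.incl h₃) (Bimod.ind (ρ.incl h₄) (ρ.BS e)) (f * ρ.incl h₁ g)
        (tmul (ρ.incl h₄) (ρ.BS e) 1 z) ∈ ρ.grading (.up h₃ (.up h₄ e)) m := by
      refine tmul_mem_grading h₃ (.up h₄ e) (mul_mem_symDeg hf hg)
        (tmul_mem_grading h₄ e one_mem_symDeg hz rfl) ?_
      rw [degree] at hm
      omega
    rw [← h5] at h6
    exact h6

end Diagram

end SingularSoergel

theorem mainTheorem9 {S W k V : Type*} [Group W] {M : CoxeterMatrix S} {cs : CoxeterSystem M W}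
    [Field k] [AddCommGroup V] [Module k V] [FiniteDimensional k V]
    (ρ : SingularSoergel.Realization cs k V) (hρ : ρ.IsAdmissible)
    {I K : SingularSoergel.Finitary cs} {e e' : SingularSoergel.Expression cs I K}
    (D : SingularSoergel.Diagram ρ e e') (hD : SingularSoergel.IsRexMove ρ D) :
    D.eval.toLin (ρ.oneTensor e) = ρ.oneTensor e' ∧
      D.degree = 0 ∧
      ∀ (n : ℤ) (x : (ρ.BS e).carrier), x ∈ ρ.grading e n → D.eval.toLin x ∈ ρ.grading e' n :=
  ⟨hD.eval_oneTensor hρ, hD.degree_eq_zero, fun n x hx =>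
    D.eval_mem_grading hρ hx (by rw [hD.degree_eq_zero, add_zero])⟩
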